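/- Throughout, $z\neq 0$ is a point of the Riemann surface of the logarithm, so $\arg z$ may be any real number and $z^{s}=\exp(s(\log|z|+i\arg z))$. For $n\ge 0$ and $\nu\in\mathbb{C}$ let $$a_n(\nu)=\frac{(4\nu^2-1^2)(4\nu^2-3^2)\cdots(4\nu^2-(2n-1)^2)}{8^n\,n!},\qquad a_0(\nu)=1.$$ Let $K_\nu$ be the modified Bessel function of the second kind and $J_\nu$, $Y_\nu$ the Bessel functions of the first and second kind, and put $\omega=z-\frac{\pi}{2}\nu-\frac{\pi}{4}$. For every integer $N\ge 0$ define $R_N^{(K)}(z,\nu)$ by $$K_\nu(z)=\left(\frac{\pi}{2z}\right)^{1/2}e^{-z}\left(\sum_{n=0}^{N-1}\frac{a_n(\nu)}{z^n}+R_N^{(K)}(z,\nu)\right),$$ and define $R_N^{(J)}(z,\nu)$ by the requirement that for all integers $L,M\ge 0$ $$J_\nu(z)=\left(\frac{2}{\pi z}\right)^{1/2}(P\cos\omega-Q\sin\omega),\qquad Y_\nu(z)=\left(\frac{2}{\pi z}\right)^{1/2}(P\sin\omega+Q\cos\omega),$$ where $$P=\sum_{n=0}^{L-1}(-1)^n\frac{a_{2n}(\nu)}{z^{2n}}+R_{2L}^{(J)}(z,\nu),\qquad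 Q=\sum_{m=0}^{M-1}(-1)^m\frac{a_{2m+1}(\nu)}{z^{2m+1}}-R_{2M+1}^{(J)}(z,\nu).$$ The basic terminants are $$\Lambda_p(w)=w^pe^w\,\Gamma(1-p,w),\qquad \Pi_p(w)=\tfrac12\left(\Lambda_p(we^{\frac{\pi}{2}i})+\Lambda_p(we^{-\frac{\pi}{2}i})\right),$$ where $\Gamma(1-p,w)$ is the upper incomplete gamma function, continued analytically to the Riemann surface of the logarithm from its principal values. **Theorem.** Let $N$ be a non-negative integer and let $\nu$ be a complex number with $|\Re(\nu)|<N+\frac12$. Then $$\left|R_N^{(K)}(z,\nu)\right|\le\frac{|\cos(\pi\nu)|}{|\cos(\pi\Re(\nu))|}\,\frac{|a_N(\Re(\nu))|}{|z|^N}\,\sup_{r\ge1}\left|\Lambda_{N+\frac12}(2zr)\right|$$ provided $|\arg z|<\frac{3\pi}{2}$, and $$\left|R_N^{(J)}(z,\nu)\right|\le\frac{|\cos(\pi\nu)|}{|\cos(\pi\Re(\nu))|}\,\frac{|a_N(\Re(\nu))|}{|z|^N}\,\sup_{r\ge1}\left|\Pi_{N+\frac12}(2zr)\right|$$ provided $|\arg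 z|<\pi$; in both cases the supremum is finite. If $2\Re(\nu)$ is an odd integer, the factor $\frac{|\cos(\pi\nu)|}{|\cos(\pi\Re(\nu))|}|a_N(\Re(\nu))|$ is replaced by its limiting value, that is, by its limit as the order tends to $\nu$ through complex numbers $\mu$ for which $2\Re(\mu)$ is not an odd integer. -/

import Mathlib

open scoped Topology

/-!  Multivalued functions of `z ≠ 0` are functions on the Riemann surface of the logarithm.  A point
`z` of that surface is given by its logarithmic coordinate `ζ = log |z| + i arg z`, where `ζ : ℂ` is
arbitrary.  Thus `z` lies over the complex number `exp ζ`, `|z| = ‖exp ζ‖`, `arg z = ζ.im` (any real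
number), `z ^ s` is `exp (s * ζ)`, the point `z * e ^ (i θ)` has coordinate `ζ + i θ`, and for `c > 0`
the point `c * z` has coordinate `ζ + log c`. -/

noncomputable section

namespace BesselBounds

/-- The coefficient `a_n(ν) = (4ν² - 1²)(4ν² - 3²)⋯(4ν² - (2n-1)²) / (8ⁿ n!)`. -/
def coeffA (n : ℕ) (ν : ℂ) : ℂ :=
  (∏ k ∈ Finset.range n, (4 * ν ^ 2 - (2 * (k : ℂ) + 1) ^ 2)) / (8 ^ n * (n.factorial : ℂ))

/-- The Bessel function of the first kind
`J_ν(z) = ∑ (-1)ᵏ (z/2)^(ν+2k) / (k! Γ(ν+k+1))`, with `z` of logarithmic coordinate `ζ`.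
(At the poles of `Γ`, Mathlib's value `Γ = 0` with `0⁻¹ = 0` gives `1/Γ` its correct value `0`.) -/
def besselJ (ν ζ : ℂ) : ℂ :=
  ∑' k : ℕ, (-1) ^ k * Complex.exp ((ν + 2 * (k : ℂ)) * (ζ - (Real.log 2 : ℂ))) *
    ((k.factorial : ℂ) * Complex.Gamma (ν + (k : ℂ) + 1))⁻¹

/-- The modified Bessel function of the first kind
`I_ν(z) = ∑ (z/2)^(ν+2k) / (k! Γ(ν+k+1))`, with `z` of logarithmic coordinate `ζ`. -/
def besselI (ν ζ : ℂ) : ℂ :=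
  ∑' k : ℕ, Complex.exp ((ν + 2 * (k : ℂ)) * (ζ - (Real.log 2 : ℂ))) *
    ((k.factorial : ℂ) * Complex.Gamma (ν + (k : ℂ) + 1))⁻¹

open scoped Classical in
/-- The Bessel function of the second kind `Y_ν(z) = (cos(πν) J_ν(z) - J_{-ν}(z)) / sin(πν)`,
with the limiting value if `ν` is an integer. -/
def besselY (ν ζ : ℂ) : ℂ :=
  if ∃ n : ℤ, ν = n then
    Filter.limUnder (𝓝[≠] ν) fun μ : ℂ =>
      (Complex.cos (Real.pi * μ) * besselJ μ ζ - besselJ (-μ) ζ) / Complex.sin (Real.pi * μ)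
  else
    (Complex.cos (Real.pi * ν) * besselJ ν ζ - besselJ (-ν) ζ) / Complex.sin (Real.pi * ν)

open scoped Classical in
/-- The modified Bessel function of the second kind
`K_ν(z) = (π/2) (I_{-ν}(z) - I_ν(z)) / sin(πν)`, with the limiting value if `ν` is an integer. -/
def besselK (ν ζ : ℂ) : ℂ :=
  if ∃ n : ℤ, ν = n then
    Filter.limUnder (𝓝[≠] ν) fun μ : ℂ =>
      Real.pi / 2 * (besselI (-μ) ζ - besselI μ ζ) / Complex.sin (Real.pi * μ)
  else
    Real.pi / 2 * (besselI (-ν) ζ - besselI ν ζ) / Complex.sin (Real.pi * ν)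

/-- The remainder `R_N^{(K)}(z, ν)`, the solution of
`K_ν(z) = (π / (2z))^(1/2) e^(-z) (∑_{n<N} a_n(ν) / zⁿ + R_N^{(K)}(z, ν))`. -/
def remainderK (N : ℕ) (ν ζ : ℂ) : ℂ :=
  besselK ν ζ * (Real.sqrt (2 / Real.pi) : ℂ) * Complex.exp (ζ / 2) * Complex.exp (Complex.exp ζ)
    - ∑ n ∈ Finset.range N, coeffA n ν / Complex.exp ζ ^ n

/-- The phase `ω = z - πν/2 - π/4`. -/
def phase (ν ζ : ℂ) : ℂ := Complex.exp ζ - Real.pi / 2 * ν - Real.pi / 4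

/-- The function `P` in `J_ν(z) = (2/(πz))^(1/2) (P cos ω - Q sin ω)`,
`Y_ν(z) = (2/(πz))^(1/2) (P sin ω + Q cos ω)`. -/
def hankelP (ν ζ : ℂ) : ℂ :=
  (Real.sqrt (Real.pi / 2) : ℂ) * Complex.exp (ζ / 2) *
    (besselJ ν ζ * Complex.cos (phase ν ζ) + besselY ν ζ * Complex.sin (phase ν ζ))

/-- The function `Q` in `J_ν(z) = (2/(πz))^(1/2) (P cos ω - Q sin ω)`,
`Y_ν(z) = (2/(πz))^(1/2) (P sin ω + Q cos ω)`. -/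
def hankelQ (ν ζ : ℂ) : ℂ :=
  (Real.sqrt (Real.pi / 2) : ℂ) * Complex.exp (ζ / 2) *
    (besselY ν ζ * Complex.cos (phase ν ζ) - besselJ ν ζ * Complex.sin (phase ν ζ))

/-- The remainder `R_N^{(J)}(z, ν)`: the even-indexed ones belong to the expansion of `P`, the
odd-indexed ones (with the opposite sign) to the expansion of `Q`, that is
`P = ∑_{n<N} (-1)ⁿ a_{2n}(ν) / z^(2n) + R_{2N}^{(J)}` and
`Q = ∑_{m<M} (-1)ᵐ a_{2m+1}(ν) / z^(2m+1) - R_{2M+1}^{(J)}`. -/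
def remainderJ (N : ℕ) (ν ζ : ℂ) : ℂ :=
  if Even N then
    hankelP ν ζ - ∑ n ∈ Finset.range (N / 2),
      (-1) ^ n * (coeffA (2 * n) ν / Complex.exp ζ ^ (2 * n))
  else
    (∑ m ∈ Finset.range (N / 2),
      (-1) ^ m * (coeffA (2 * m + 1) ν / Complex.exp ζ ^ (2 * m + 1))) - hankelQ ν ζ

/-- The upper incomplete gamma function `Γ(a, w) = ∫_w^∞ t^(a-1) e^(-t) dt` on the Riemann surface
of the logarithm, `w` having logarithmic coordinate `ζ`.  The path runs from `w` along the circle of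
radius `|w|` to the point `|w|` of argument `0`, and from there along the positive real axis; the
integral over the arc is written with `t = exp (log |w| + i u)`. -/
def incompleteGamma (a ζ : ℂ) : ℂ :=
  (∫ t : ℝ in Set.Ioi (Real.exp ζ.re), (t : ℂ) ^ (a - 1) * Complex.exp (-(t : ℂ)))
    - ∫ u : ℝ in (0 : ℝ)..ζ.im,
        Complex.I * Complex.exp (a * ((ζ.re : ℂ) + u * Complex.I)) *
          Complex.exp (-Complex.exp ((ζ.re : ℂ) + u * Complex.I))

/-- The basic terminant `Λ_p(w) = w^p e^w Γ(1 - p, w)`. -/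
def terminantLambda (p ζ : ℂ) : ℂ :=
  Complex.exp (p * ζ) * Complex.exp (Complex.exp ζ) * incompleteGamma (1 - p) ζ

/-- The basic terminant `Π_p(w) = (Λ_p(w e^(πi/2)) + Λ_p(w e^(-πi/2))) / 2`. -/
def terminantPi (p ζ : ℂ) : ℂ :=
  (terminantLambda p (ζ + Real.pi / 2 * Complex.I) +
    terminantLambda p (ζ - Real.pi / 2 * Complex.I)) / 2

/-- The quantity `(|cos(πν)| / |cos(π Re ν)|) |a_N(Re ν)|`, for `2 Re ν` not an odd integer. -/
def orderQuotient (N : ℕ) (ν : ℂ) : ℝ :=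
  ‖Complex.cos (Real.pi * ν)‖ / |Real.cos (Real.pi * ν.re)| * ‖coeffA N (ν.re : ℂ)‖

open scoped Classical in
/-- The quantity `(|cos(πν)| / |cos(π Re ν)|) |a_N(Re ν)|`; if `2 Re ν` is an odd integer, its
limiting value along orders `μ → ν` for which `2 Re μ` is not an odd integer. -/
def orderFactor (N : ℕ) (ν : ℂ) : ℝ :=
  if Real.cos (Real.pi * ν.re) = 0 then
    Filter.limUnder (𝓝[{μ : ℂ | Real.cos (Real.pi * μ.re) ≠ 0}] ν) (orderQuotient N)
  else
    orderQuotient N ν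

theorem gamma_mul_gamma_mul_cos (N : ℕ) (x : ℝ) (hx : Real.cos (Real.pi * x) ≠ 0) :
    Real.Gamma ((N : ℝ) + 1 / 2 + x) * Real.Gamma ((N : ℝ) + 1 / 2 - x) *
      Real.cos (Real.pi * x) =
    Real.pi * ∏ k ∈ Finset.range N, (((k : ℝ) + 1 / 2) ^ 2 - x ^ 2) := by
  induction N with
  | zero =>
    have h := Real.Gamma_mul_Gamma_one_sub (1 / 2 + x)
    have h2 : Real.sin (Real.pi * (1 / 2 + x)) = Real.cos (Real.pi * x) := by
      rw [← Real.sin_add_pi_div_two]; congr 1; ring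
    rw [h2] at h
    have h3 : (1 : ℝ) - (1 / 2 + x) = 1 / 2 - x := by ring
    rw [h3] at h
    simp only [Nat.cast_zero, zero_add, Finset.range_zero, Finset.prod_empty, mul_one, h]
    field_simp
  | succ n ih =>
    have key : ∀ s : ℝ, Real.cos (Real.pi * s) ≠ 0 → (n : ℝ) + 1 / 2 + s ≠ 0 := by
      intro s hs h0
      apply hs
      have : s = -((n : ℝ) + 1 / 2) := by linarith
      rw [this, Real.cos_eq_zero_iff]
      exact ⟨-(n : ℤ) - 1, by push_cast; ring⟩
    have h1 := key x hx
    have h2 := key (-x) (by rwa [mul_neg, Real.cos_neg])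
    have e1 : ((n + 1 : ℕ) : ℝ) + 1 / 2 + x = ((n : ℝ) + 1 / 2 + x) + 1 := by push_cast; ring
    have e2 : ((n + 1 : ℕ) : ℝ) + 1 / 2 - x = ((n : ℝ) + 1 / 2 + -x) + 1 := by push_cast; ring
    rw [e1, e2, Real.Gamma_add_one h1, Real.Gamma_add_one h2, Finset.prod_range_succ,
      ← mul_assoc Real.pi, ← ih, ← sub_eq_add_neg]
    ring

theorem orderQuotient_eq (N : ℕ) (μ : ℂ) (hμ : Real.cos (Real.pi * μ.re) ≠ 0) :
    orderQuotient N μ = ‖Complex.cos (Real.pi * μ)‖ *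
      |Real.Gamma ((N : ℝ) + 1 / 2 + μ.re) * Real.Gamma ((N : ℝ) + 1 / 2 - μ.re)| /
        (Real.pi * (2 ^ N * N.factorial)) := by
  have h := gamma_mul_gamma_mul_cos N μ.re hμ
  have ha : coeffA N (μ.re : ℂ) =
      ((((-4) ^ N * ∏ k ∈ Finset.range N, (((k : ℝ) + 1 / 2) ^ 2 - μ.re ^ 2)) /
        (8 ^ N * (N.factorial : ℝ)) : ℝ) : ℂ) := by
    unfold coeffA
    push_cast
    congr 1
    rw [← Finset.card_range N, ← Finset.prod_const, Finset.card_range, ← Finset.prod_mul_distrib]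
    exact Finset.prod_congr rfl fun k _ => by ring
  have hP : |∏ k ∈ Finset.range N, (((k : ℝ) + 1 / 2) ^ 2 - μ.re ^ 2)| =
      |Real.Gamma ((N : ℝ) + 1 / 2 + μ.re) * Real.Gamma ((N : ℝ) + 1 / 2 - μ.re)| *
        |Real.cos (Real.pi * μ.re)| / Real.pi := by
    rw [← abs_mul, h, abs_mul, abs_of_pos Real.pi_pos, mul_div_cancel_left₀ _ Real.pi_pos.ne']
  unfold orderQuotient
  rw [ha, Complex.norm_real, Real.norm_eq_abs, abs_div, abs_mul, hP, abs_pow, abs_neg,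
    abs_of_pos (by norm_num : (0 : ℝ) < 4), abs_of_pos (by positivity : (0 : ℝ) < 8 ^ N * N.factorial)]
  have h8 : (8 : ℝ) ^ N = 4 ^ N * 2 ^ N := by rw [← mul_pow]; norm_num
  have := Real.pi_pos
  have := abs_pos.mpr hμ
  rw [h8]
  field_simp

/-- The limiting value in `orderFactor` exists, and `orderFactor` is the limit also at the other
orders, whenever `|Re ν| < N + 1/2`. -/
theorem tendsto_orderQuotient (N : ℕ) (ν : ℂ) (hν : |ν.re| < (N : ℝ) + 1 / 2) :
    Filter.Tendsto (orderQuotient N) (𝓝[{μ : ℂ | Real.cos (Real.pi * μ.re) ≠ 0}] ν)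
      (𝓝 (orderFactor N ν)) := by
  obtain ⟨hl, hr⟩ := abs_lt.mp hν
  set g : ℂ → ℝ := fun μ => ‖Complex.cos (Real.pi * μ)‖ *
      |Real.Gamma ((N : ℝ) + 1 / 2 + μ.re) * Real.Gamma ((N : ℝ) + 1 / 2 - μ.re)| /
        (Real.pi * (2 ^ N * N.factorial)) with hg
  have hG : ∀ s : ℝ, 0 < s → ContinuousAt Real.Gamma s := fun s hs =>
    (Real.differentiableAt_Gamma fun m h => by
      have : (0 : ℝ) ≤ m := Nat.cast_nonneg m
      linarith).continuousAt
  have hc : ContinuousAt g ν := by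
    have c1 : ContinuousAt (fun μ : ℂ => Real.Gamma ((N : ℝ) + 1 / 2 + μ.re)) ν :=
      ContinuousAt.comp (f := fun μ : ℂ => (N : ℝ) + 1 / 2 + μ.re) (hG _ (by linarith))
        (by fun_prop)
    have c2 : ContinuousAt (fun μ : ℂ => Real.Gamma ((N : ℝ) + 1 / 2 - μ.re)) ν :=
      ContinuousAt.comp (f := fun μ : ℂ => (N : ℝ) + 1 / 2 - μ.re) (hG _ (by linarith))
        (by fun_prop)
    have c3 : ContinuousAt (fun μ : ℂ => ‖Complex.cos (Real.pi * μ)‖) ν := by fun_prop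
    exact (c3.mul (c1.mul c2).abs).div_const _
  have ht : Filter.Tendsto (orderQuotient N)
      (𝓝[{μ : ℂ | Real.cos (Real.pi * μ.re) ≠ 0}] ν) (𝓝 (g ν)) := by
    refine (hc.tendsto.mono_left nhdsWithin_le_nhds).congr' ?_
    filter_upwards [self_mem_nhdsWithin] with μ hμ
    exact (orderQuotient_eq N μ hμ).symm
  have hv : orderFactor N ν = g ν := by
    unfold orderFactor
    split_ifs with h0
    · have hne : (𝓝[{μ : ℂ | Real.cos (Real.pi * μ.re) ≠ 0}] ν).NeBot := by
        rw [← mem_closure_iff_nhdsWithin_neBot]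
        have hlim : Filter.Tendsto (fun n : ℕ => ν + ((1 / ((n : ℝ) + 1 + 1) : ℝ) : ℂ))
            Filter.atTop (𝓝 ν) := by
          have h1 : Filter.Tendsto (fun n : ℕ => 1 / ((n : ℝ) + 1 + 1)) Filter.atTop (𝓝 0) := by
            have := (Filter.tendsto_add_atTop_iff_nat (f := fun n : ℕ => 1 / ((n : ℝ) + 1)) 1).mpr
              tendsto_one_div_add_atTop_nhds_zero_nat
            simpa using this
          have h2 := (Complex.continuous_ofReal.tendsto 0).comp h1
          simpa using h2.const_add ν
        refine mem_closure_of_tendsto hlim (Filter.Eventually.of_forall fun n => ?_)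
        have hn : (0 : ℝ) ≤ n := Nat.cast_nonneg n
        have hd : 0 < 1 / ((n : ℝ) + 1 + 1) := by positivity
        have hd1 : 1 / ((n : ℝ) + 1 + 1) < 1 := by
          rw [div_lt_one (by positivity)]; linarith
        have hs : 0 < Real.sin (Real.pi * (1 / ((n : ℝ) + 1 + 1))) :=
          Real.sin_pos_of_pos_of_lt_pi (by positivity) (by nlinarith [Real.pi_pos])
        have hsin : Real.sin (Real.pi * ν.re) ≠ 0 := by
          intro h
          have := Real.sin_sq_add_cos_sq (Real.pi * ν.re)
          rw [h, h0] at this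
          norm_num at this
        show Real.cos (Real.pi * (ν + ((1 / ((n : ℝ) + 1 + 1) : ℝ) : ℂ)).re) ≠ 0
        rw [Complex.add_re, Complex.ofReal_re, mul_add, Real.cos_add, h0, zero_mul, zero_sub]
        exact neg_ne_zero.mpr (mul_ne_zero hsin hs.ne')
      exact ht.limUnder_eq
    · exact orderQuotient_eq N ν h0
  rw [hv]
  exact ht

/-- `J_ν = (2/(πz))^(1/2) (P cos ω - Q sin ω)`, with `P` and `Q` written as truncated expansions
plus remainders. -/
theorem besselJ_eq (N M : ℕ) (ν ζ : ℂ) :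
    besselJ ν ζ = (Real.sqrt (2 / Real.pi) : ℂ) * Complex.exp (-ζ / 2) *
      (Complex.cos (phase ν ζ) * ((∑ n ∈ Finset.range N,
          (-1) ^ n * (coeffA (2 * n) ν / Complex.exp ζ ^ (2 * n))) + remainderJ (2 * N) ν ζ) -
        Complex.sin (phase ν ζ) * ((∑ m ∈ Finset.range M,
          (-1) ^ m * (coeffA (2 * m + 1) ν / Complex.exp ζ ^ (2 * m + 1))) -
            remainderJ (2 * M + 1) ν ζ)) := by
  have h1 : (2 * M + 1) / 2 = M := by omega
  have h2 : (Real.sqrt (2 / Real.pi) : ℂ) * (Real.sqrt (Real.pi / 2) : ℂ) = 1 := by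
    rw [← Complex.ofReal_mul, ← Real.sqrt_mul (by positivity)]
    have := Real.pi_pos.ne'
    rw [show 2 / Real.pi * (Real.pi / 2) = 1 by field_simp]
    simp
  have h3 : Complex.exp (-ζ / 2) * Complex.exp (ζ / 2) = 1 := by
    rw [← Complex.exp_add]; ring_nf; simp
  have h4 := Complex.sin_sq_add_cos_sq (phase ν ζ)
  simp only [remainderJ, even_two_mul, if_true, Nat.not_even_two_mul_add_one, if_false, h1,
    Nat.mul_div_cancel_left N two_pos, add_sub_cancel, sub_sub_cancel, hankelP, hankelQ]
  linear_combination (-(besselJ ν ζ)) * (Complex.exp (-ζ / 2) * Complex.exp (ζ / 2)) * h2 -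
    besselJ ν ζ * h3 - besselJ ν ζ * (Real.sqrt (2 / Real.pi) : ℂ) *
      (Real.sqrt (Real.pi / 2) : ℂ) * Complex.exp (-ζ / 2) * Complex.exp (ζ / 2) * h4

end BesselBounds

end

/-!
With `c(u) = 1 + cosh u`, both bounds follow from the integral representation
`R_N^{(K)}(z, ν) = κ z^(-N) ∫ e^(νu) c(u)^(-N-1/2) Λ_{N+1/2}(z c(u)) du`,
valid for `|Re ν| < N + 1/2` and `|arg z| < 3π/2` (`remainderK_eq`).  Here `κ` is such that
`κ ∫ e^(νu) c(u)^(-N-1/2) du = a_N(ν)`.  Since `c(u) ≥ 2`, every `z c(u)` is of the form `2zr` with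
`r ≥ 1`, so the terminant may be replaced by its supremum; what remains is `|κ|` times the integral of
the absolute value of the weight, that is, the Beta integral at the order `Re ν`, and this product is
the factor of the theorem (`norm_remainderConst_mul_integral`).  The suprema are finite because
`Λ_p` is bounded on each closed subsector of `|arg w| < 3π/2`, as one sees by rotating the path of
integration in the incomplete gamma function by a third of `arg w` (`norm_terminantLambda_le`).

The representation is proved by showing that the truncated expansion with this integral as its
remainder (`hankelExpansion`) is `K_ν`.  The relations `Λ_p(w) = 1 - (p/w) Λ_{p+1}(w)` and
`w Λ_p' = p (Λ_p - Λ_{p+1})` and a double integration by parts in `u` show that it solves the modified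
Bessel equation.  On the positive real axis it decays, as does Macdonald's integral
`½ ∫ exp(-z cosh u + νu) du`.  So their Wronskian, a constant, is zero, and comparison of the leading
terms at infinity shows that the two agree for large `z`.  Macdonald's integral in turn equals
`(π/2) (I_{-ν} - I_ν) / sin(πν)`: both sides satisfy the same recurrences in the order and agree to
leading order at `z = 0`, and a Gronwall argument for the pair of orders `ν`, `1 - ν` with
`0 < Re ν < 1` shows that the difference vanishes (`eq_zero_of_coupled_system`).  Analytic continuation
in `z` gives the identity in the whole sector, continuity in `ν` the orders with integral real part,
and for integer orders it identifies the limit by which `K_ν` is defined.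

For `J_ν` and `Y_ν`, the functions `P ± iQ` are the values of `K_ν` at `z e^(∓πi/2)` freed from the
exponential factor (`hankelP_add_I_mul_hankelQ`, `hankelP_sub_I_mul_hankelQ`), so that `R_N^{(J)}` is,
up to sign, the same integral with `Λ_{N+1/2}` replaced by `Π_{N+1/2}` (`exists_remainderJ_eq`).
-/

noncomputable section

namespace BesselBounds

open MeasureTheory Filter Set

/-! ### The incomplete gamma function and the basic terminant -/

theorem integrableOn_cpow_mul_exp_neg (a : ℂ) {c : ℝ} (hc : 0 < c) :
    IntegrableOn (fun t : ℝ => (t : ℂ) ^ (a - 1) * Complex.exp (-(t : ℂ))) (Ioi c) := by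
  have hreal : IntegrableOn (fun t : ℝ => Real.exp (-t) * t ^ (a.re - 1)) (Ioi c) := by
    refine integrable_of_isBigO_exp_neg (b := 1 / 2) (by norm_num) ?_ ?_
    · refine ContinuousOn.mul (by fun_prop) ?_
      exact continuousOn_id.rpow_const fun t ht => Or.inl (hc.trans_le ht).ne'
    · exact (Real.Gamma_integrand_isLittleO _).isBigO
  refine Integrable.mono' hreal ?_ ?_
  · refine ContinuousOn.aestronglyMeasurable ?_ measurableSet_Ioi
    refine ContinuousOn.mul ?_ (by fun_prop)
    intro t ht
    exact (Complex.continuousAt_ofReal_cpow_const _ _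
      (Or.inr (hc.trans ht).ne')).continuousWithinAt
  · refine (ae_restrict_iff' measurableSet_Ioi).mpr (Eventually.of_forall fun t ht => ?_)
    rw [norm_mul, Complex.norm_cpow_eq_rpow_re_of_pos (hc.trans ht), Complex.norm_exp]
    simp [mul_comm]

/-- `Γ(a, ·)` is, up to sign, the primitive of the entire function `e^(aζ) e^(-e^ζ)` that vanishes
at `+∞` along the real axis. -/
theorem exists_primitive_incompleteGamma (a : ℂ) :
    ∃ G : ℂ → ℂ, (∀ ζ, HasDerivAt G (Complex.exp (a * ζ) * Complex.exp (-Complex.exp ζ)) ζ) ∧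
      (∀ ζ, incompleteGamma a ζ = -G ζ) ∧
      Tendsto (fun x : ℝ => G (x : ℂ)) atTop (𝓝 0) := by
  have hd : Differentiable ℂ fun ζ : ℂ => Complex.exp (a * ζ) * Complex.exp (-Complex.exp ζ) := by
    fun_prop
  obtain ⟨G, hG⟩ := hd.isExactOn_univ
  replace hG : ∀ ζ, HasDerivAt G (Complex.exp (a * ζ) * Complex.exp (-Complex.exp ζ)) ζ :=
    fun ζ => hG ζ (mem_univ ζ)
  set f : ℝ → ℂ := fun t => (t : ℂ) ^ (a - 1) * Complex.exp (-(t : ℂ)) with hf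
  have hlog : ∀ t : ℝ, 0 < t → HasDerivAt (fun s : ℝ => G ((Real.log s : ℝ) : ℂ)) (f t) t := by
    intro t ht
    have h1 := (hG (Real.log t : ℝ)).comp_ofReal
    have h2 := HasDerivAt.scomp t h1 (Real.hasDerivAt_log ht.ne')
    refine h2.congr_deriv ?_
    have ht' : (t : ℂ) ≠ 0 := by exact_mod_cast ht.ne'
    have e1 : Complex.exp ((Real.log t : ℝ) : ℂ) = t := by
      rw [← Complex.ofReal_exp, Real.exp_log ht]
    simp only [hf]
    rw [e1, Complex.real_smul, Complex.cpow_sub _ _ ht', Complex.cpow_one,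
      Complex.cpow_def_of_ne_zero ht', ← Complex.ofReal_log ht.le, mul_comm a]
    push_cast
    field_simp
  have hint : ∀ c : ℝ, 0 < c → IntegrableOn f (Ioi c) := fun c hc =>
    integrableOn_cpow_mul_exp_neg a hc
  have hftc : ∀ b : ℝ, 1 ≤ b → ∫ t in (1 : ℝ)..b, f t = G ((Real.log b : ℝ) : ℂ) - G 0 := by
    intro b hb
    rw [intervalIntegral.integral_eq_sub_of_hasDerivAt (f := fun s : ℝ => G ((Real.log s : ℝ) : ℂ))]
    · simp
    · intro t ht
      rw [uIcc_of_le hb] at ht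
      exact hlog t (by linarith [ht.1])
    · rw [intervalIntegrable_iff_integrableOn_Ioc_of_le hb]
      exact (hint 1 one_pos).mono_set Ioc_subset_Ioi_self
  set C : ℂ := G 0 + ∫ t in Ioi (1 : ℝ), f t with hC
  have hlim : Tendsto (fun b : ℝ => G ((Real.log b : ℝ) : ℂ)) atTop (𝓝 C) := by
    have h := (intervalIntegral_tendsto_integral_Ioi 1 (hint 1 one_pos) tendsto_id).const_add (G 0)
    refine h.congr' ?_
    filter_upwards [eventually_ge_atTop (1 : ℝ)] with b hb
    simp only [id]
    rw [hftc b hb]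
    ring
  have hlim' : Tendsto (fun x : ℝ => G (x : ℂ)) atTop (𝓝 C) := by
    have := hlim.comp Real.tendsto_exp_atTop
    refine this.congr fun x => ?_
    simp
  refine ⟨fun ζ => G ζ - C, fun ζ => (hG ζ).sub_const C, fun ζ => ?_, ?_⟩
  · have hx : 0 < Real.exp ζ.re := Real.exp_pos _
    have h1 : ∫ t in Ioi (Real.exp ζ.re), f t = C - G ((ζ.re : ℝ) : ℂ) := by
      have := integral_Ioi_of_hasDerivAt_of_tendsto
        (f := fun s : ℝ => G ((Real.log s : ℝ) : ℂ)) (f' := f) (a := Real.exp ζ.re) (m := C)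
        (hlog _ hx).continuousAt.continuousWithinAt (fun t ht => hlog t (hx.trans ht))
        (hint _ hx) hlim
      simpa using this
    have h2 : ∫ u : ℝ in (0 : ℝ)..ζ.im,
        Complex.I * Complex.exp (a * ((ζ.re : ℂ) + u * Complex.I)) *
          Complex.exp (-Complex.exp ((ζ.re : ℂ) + u * Complex.I)) = G ζ - G ((ζ.re : ℝ) : ℂ) := by
      rw [intervalIntegral.integral_eq_sub_of_hasDerivAt
        (f := fun u : ℝ => G ((ζ.re : ℂ) + u * Complex.I))]
      · simp [Complex.re_add_im]
      · intro u _
        have h3 : HasDerivAt (fun w : ℂ => (ζ.re : ℂ) + w * Complex.I) Complex.I (u : ℂ) := by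
          simpa using ((hasDerivAt_id (u : ℂ)).mul_const Complex.I).const_add (ζ.re : ℂ)
        have h4 := ((hG ((ζ.re : ℂ) + u * Complex.I)).comp (u : ℂ) h3).comp_ofReal
        refine h4.congr_deriv ?_
        ring
      · exact Continuous.intervalIntegrable (by fun_prop) _ _
    unfold incompleteGamma
    rw [h1, h2]
    ring
  · simpa using hlim'.sub_const C

theorem hasDerivAt_incompleteGamma (a ζ : ℂ) :
    HasDerivAt (incompleteGamma a) (-(Complex.exp (a * ζ) * Complex.exp (-Complex.exp ζ))) ζ := by
  obtain ⟨G, hG, hΓ, -⟩ := exists_primitive_incompleteGamma a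
  rw [show incompleteGamma a = fun ζ => -G ζ from funext hΓ]
  exact (hG ζ).neg

theorem tendsto_incompleteGamma_ofReal (a : ℂ) :
    Tendsto (fun x : ℝ => incompleteGamma a x) atTop (𝓝 0) := by
  obtain ⟨G, -, hΓ, h0⟩ := exists_primitive_incompleteGamma a
  simpa [hΓ] using h0.neg

/-- `e^(bx) exp(-c e^x) → 0` as `x → +∞`. -/
theorem tendsto_exp_mul_exp_neg_exp (b : ℝ) {c : ℝ} (hc : 0 < c) :
    Tendsto (fun x : ℝ => Real.exp (b * x) * Real.exp (-(c * Real.exp x))) atTop (𝓝 0) := by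
  have h := (tendsto_rpow_mul_exp_neg_mul_atTop_nhds_zero b c hc).comp Real.tendsto_exp_atTop
  refine h.congr fun x => ?_
  simp only [Function.comp]
  rw [← Real.exp_mul, mul_comm x b, neg_mul]

/-- The recurrence `Γ(a + 1, w) = a Γ(a, w) + w^a e^(-w)`. -/
theorem incompleteGamma_add_one (a ζ : ℂ) :
    incompleteGamma (a + 1) ζ =
      a * incompleteGamma a ζ + Complex.exp (a * ζ) * Complex.exp (-Complex.exp ζ) := by
  set F : ℂ → ℂ := fun ζ => incompleteGamma (a + 1) ζ - a * incompleteGamma a ζ -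
    Complex.exp (a * ζ) * Complex.exp (-Complex.exp ζ) with hF
  have hder : ∀ ζ, HasDerivAt F 0 ζ := by
    intro ζ
    have h1 : HasDerivAt (fun ζ : ℂ => Complex.exp (a * ζ)) (Complex.exp (a * ζ) * a) ζ := by
      simpa using ((hasDerivAt_id ζ).const_mul a).cexp
    have h2 := h1.mul (Complex.hasDerivAt_exp ζ).neg.cexp
    have h3 := ((hasDerivAt_incompleteGamma (a + 1) ζ).sub
      ((hasDerivAt_incompleteGamma a ζ).const_mul a)).sub h2
    refine h3.congr_deriv ?_
    simp only [Pi.neg_apply]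
    rw [add_mul, one_mul, Complex.exp_add]
    ring
  have hconst : ∀ x y, F x = F y :=
    is_const_of_deriv_eq_zero (fun ζ => (hder ζ).differentiableAt) fun ζ => (hder ζ).deriv
  have hlim : Tendsto (fun x : ℝ => F (x : ℂ)) atTop (𝓝 0) := by
    have h1 := (tendsto_incompleteGamma_ofReal (a + 1)).sub
      ((tendsto_incompleteGamma_ofReal a).const_mul a)
    have h2 : Tendsto (fun x : ℝ => Complex.exp (a * x) * Complex.exp (-Complex.exp x)) atTop
        (𝓝 0) := by
      rw [tendsto_zero_iff_norm_tendsto_zero]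
      refine (tendsto_exp_mul_exp_neg_exp a.re one_pos).congr fun x => ?_
      rw [norm_mul, Complex.norm_exp, Complex.norm_exp]
      simp [Complex.exp_ofReal_re]
    simpa [hF] using h1.sub h2
  have h0 : F ζ = 0 := by
    refine tendsto_nhds_unique (f := fun x : ℝ => F (x : ℂ)) (l := atTop) ?_ hlim
    exact tendsto_const_nhds.congr fun x => hconst ζ x
  simp only [hF] at h0
  linear_combination h0

/-- Decay of the incomplete gamma function in closed subsectors of the right half-plane. -/
theorem tendsto_incompleteGamma {ψ : ℝ} (hψ : ψ < Real.pi / 2) (a : ℂ) {l : Filter ℝ} {s : ℝ → ℂ}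
    (hre : Tendsto (fun σ => (s σ).re) l atTop) (him : ∀ᶠ σ in l, |(s σ).im| ≤ ψ) :
    Tendsto (fun σ => incompleteGamma a (s σ)) l (𝓝 0) := by
  rcases lt_or_ge ψ 0 with h0 | h0
  · have : l = ⊥ := by
      rw [← eventually_false_iff_eq_bot]
      filter_upwards [him] with σ hσ
      linarith [abs_nonneg (s σ).im]
    rw [this]; exact tendsto_bot
  have hcos : 0 < Real.cos ψ := Real.cos_pos_of_mem_Ioo ⟨by linarith, hψ⟩
  have hbd : ∀ᶠ σ in l, ‖incompleteGamma a (s σ) - incompleteGamma a ((s σ).re : ℝ)‖ ≤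
      Real.exp (a.re * (s σ).re) * Real.exp (-(Real.cos ψ * Real.exp (s σ).re)) *
        (Real.exp (|a.im| * ψ) * ψ) := by
    filter_upwards [him] with σ hσ
    set w := s σ
    set C := Real.exp (a.re * w.re) * Real.exp (-(Real.cos ψ * Real.exp w.re)) *
      Real.exp (|a.im| * ψ) with hC
    have hder : ∀ y ∈ Icc (-ψ) ψ, HasDerivWithinAt
        (fun y : ℝ => incompleteGamma a ((w.re : ℂ) + y * Complex.I))
        (-(Complex.exp (a * ((w.re : ℂ) + y * Complex.I)) *
          Complex.exp (-Complex.exp ((w.re : ℂ) + y * Complex.I))) * Complex.I) (Icc (-ψ) ψ) y := by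
      intro u _
      have h3 : HasDerivAt (fun v : ℂ => (w.re : ℂ) + v * Complex.I) Complex.I (u : ℂ) := by
        simpa using ((hasDerivAt_id (u : ℂ)).mul_const Complex.I).const_add (w.re : ℂ)
      exact ((hasDerivAt_incompleteGamma a
        ((w.re : ℂ) + u * Complex.I)).comp (u : ℂ) h3).comp_ofReal.hasDerivWithinAt
    have hle : ∀ y ∈ Icc (-ψ) ψ, ‖-(Complex.exp (a * ((w.re : ℂ) + y * Complex.I)) *
          Complex.exp (-Complex.exp ((w.re : ℂ) + y * Complex.I))) * Complex.I‖ ≤ C := by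
      intro y hy
      rw [norm_mul, norm_neg, norm_mul, Complex.norm_I, mul_one, Complex.norm_exp,
        Complex.norm_exp, Complex.neg_re, Complex.exp_re]
      have hy' : |y| ≤ ψ := abs_le.mpr hy
      have hc : Real.cos ψ ≤ Real.cos y := by
        rw [← Real.cos_abs y]
        exact Real.cos_le_cos_of_nonneg_of_le_pi (abs_nonneg y) (by linarith [Real.pi_pos]) hy'
      simp only [Complex.mul_re, Complex.add_re, Complex.add_im, Complex.ofReal_re,
        Complex.ofReal_im, Complex.mul_im, Complex.I_re, Complex.I_im, mul_zero, mul_one,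
        add_zero, zero_add, sub_self]
      rw [hC, ← Real.exp_add, ← Real.exp_add, ← Real.exp_add]
      apply Real.exp_le_exp.mpr
      have h1 : -(a.im * y) ≤ |a.im| * ψ := by
        calc -(a.im * y) ≤ |a.im * y| := neg_le_abs _
          _ = |a.im| * |y| := abs_mul _ _
          _ ≤ _ := by gcongr
      have h2 := mul_le_mul_of_nonneg_right hc (Real.exp_pos w.re).le
      nlinarith
    have := (convex_Icc (-ψ) ψ).norm_image_sub_le_of_norm_hasDerivWithin_le hder hle
      (x := 0) (y := w.im) ⟨by linarith, h0⟩ (abs_le.mp hσ)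
    simp only [Complex.re_add_im, Complex.ofReal_zero, zero_mul, add_zero, sub_zero] at this
    refine this.trans ?_
    rw [hC, ← mul_assoc]
    exact mul_le_mul_of_nonneg_left (by simpa using hσ) (by positivity)
  have hz : Tendsto (fun σ => Real.exp (a.re * (s σ).re) *
      Real.exp (-(Real.cos ψ * Real.exp (s σ).re)) * (Real.exp (|a.im| * ψ) * ψ)) l (𝓝 0) := by
    simpa using ((tendsto_exp_mul_exp_neg_exp a.re hcos).comp hre).mul_const
      (Real.exp (|a.im| * ψ) * ψ)
  have h1 := squeeze_zero_norm' hbd hz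
  have h2 := (tendsto_incompleteGamma_ofReal a).comp hre
  simpa using h1.add h2

/-- `‖1 + x e^(2iφ)‖ ≥ cos φ` for `x ≥ 0`. -/
theorem cos_le_norm_one_add_mul_exp {x : ℝ} (hx : 0 ≤ x) (φ : ℝ) :
    Real.cos φ ≤ ‖1 + (x : ℂ) * Complex.exp ((2 * φ : ℝ) * Complex.I)‖ := by
  have h : ‖1 + (x : ℂ) * Complex.exp ((2 * φ : ℝ) * Complex.I)‖ ^ 2 =
      1 + 2 * x * Real.cos (2 * φ) + x ^ 2 := by
    rw [Complex.sq_norm, Complex.normSq_apply]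
    simp only [Complex.add_re, Complex.add_im, Complex.mul_re, Complex.mul_im, Complex.ofReal_re,
      Complex.ofReal_im, Complex.one_re, Complex.one_im, Complex.exp_ofReal_mul_I_re,
      Complex.exp_ofReal_mul_I_im]
    nlinarith [Real.sin_sq_add_cos_sq (2 * φ)]
  refine le_of_abs_le (abs_le_of_sq_le_sq ?_ (norm_nonneg _))
  rw [h, Real.cos_two_mul]
  nlinarith [Real.sin_sq_add_cos_sq φ, sq_nonneg (1 - x), sq_nonneg (Real.sin φ),
    mul_nonneg hx (sq_nonneg (Real.cos φ)), mul_nonneg (sq_nonneg (1 - x)) (sq_nonneg (Real.sin φ))]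

theorem one_add_mul_exp_mem_slitPlane {x : ℝ} (hx : 0 ≤ x) {φ : ℝ} (hφ : |φ| < Real.pi / 2) :
    1 + (x : ℂ) * Complex.exp ((2 * φ : ℝ) * Complex.I) ∈ Complex.slitPlane := by
  obtain ⟨h1, h2⟩ := abs_lt.mp hφ
  rw [Complex.mem_slitPlane_iff]
  simp only [Complex.add_re, Complex.add_im, Complex.mul_re, Complex.mul_im, Complex.ofReal_re,
      Complex.ofReal_im, Complex.one_re, Complex.one_im, Complex.exp_ofReal_mul_I_re,
      Complex.exp_ofReal_mul_I_im]
  by_cases hc : 0 ≤ Real.cos (2 * φ)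
  · left; nlinarith [mul_nonneg hx hc]
  rcases hx.eq_or_lt with rfl | hx
  · left; simp
  right
  intro h
  have hs : Real.sin (2 * φ) = 0 := by
    have h' : x * Real.sin (2 * φ) = 0 := by linarith
    exact (mul_eq_zero.mp h').resolve_left hx.ne'
  have := (Real.sin_eq_zero_iff_of_lt_of_lt (by linarith) (by linarith)).mp hs
  rw [this] at hc
  simp at hc

/-- The basic terminant is bounded on each closed subsector of `|arg w| < 3π/2`.  With
`φ = (arg w)/3`, the integral for `Γ(1 - p, w)` is taken along the ray `t = w + σ e^(iφ)`, on which
`|e^(-t)|` decays like `e^(-σ cos φ)` and `|t / w| ≥ cos φ`. -/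
theorem norm_terminantLambda_le {p : ℝ} (hp : 0 ≤ p) {ζ : ℂ} (hζ : |ζ.im| < 3 * Real.pi / 2) :
    ‖terminantLambda (p : ℂ) ζ‖ ≤ (Real.cos (ζ.im / 3) ^ (p + 1))⁻¹ := by
  set φ := ζ.im / 3 with hφ
  have hφ' : |φ| < Real.pi / 2 := by
    rw [hφ, abs_div, abs_of_pos (by norm_num : (0 : ℝ) < 3)]; linarith
  have him : ζ.im = 3 * φ := by rw [hφ]; ring
  have hcos : 0 < Real.cos φ := Real.cos_pos_of_mem_Ioo (abs_lt.mp hφ')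
  set r := Real.exp (-ζ.re) with hr
  have hr0 : 0 < r := Real.exp_pos _
  set b : ℂ := (r : ℂ) * Complex.exp ((2 * (-φ) : ℝ) * Complex.I) with hb
  have hb' : b = Complex.exp (φ * Complex.I - ζ) := by
    rw [hb, hr, Complex.ofReal_exp, ← Complex.exp_add]
    congr 1
    apply Complex.ext
    · simp
    · simp [him]; ring
  set q : ℝ → ℂ := fun σ => 1 + σ * b with hq
  have hqe : ∀ σ : ℝ, q σ = 1 + ((σ * r : ℝ) : ℂ) * Complex.exp ((2 * (-φ) : ℝ) * Complex.I) := by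
    intro σ; simp only [hq, hb]; push_cast; ring
  have hqs : ∀ σ : ℝ, 0 ≤ σ → q σ ∈ Complex.slitPlane := fun σ hσ => by
    rw [hqe]
    exact one_add_mul_exp_mem_slitPlane (by positivity) (by rwa [abs_neg])
  have hqc : ∀ σ : ℝ, 0 ≤ σ → Real.cos φ ≤ ‖q σ‖ := fun σ hσ => by
    rw [hqe, ← Real.cos_neg φ]
    exact cos_le_norm_one_add_mul_exp (by positivity) _
  -- the logarithmic coordinate of the point `w + σ e^(iφ) = w (1 + σ b)` of the ray
  set s : ℝ → ℂ := fun σ => ζ + Complex.log (q σ) with hs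
  set F' : ℝ → ℂ := fun σ => -(Complex.exp ((1 - p) * s σ) * Complex.exp (-Complex.exp (s σ))) *
    (b / q σ) with hF'
  have hder : ∀ σ : ℝ, 0 ≤ σ → HasDerivAt (fun σ : ℝ => incompleteGamma (1 - p) (s σ)) (F' σ) σ := by
    intro σ hσ
    have h1 : HasDerivAt (fun w : ℂ => 1 + w * b) b (σ : ℂ) := by
      simpa using ((hasDerivAt_id (σ : ℂ)).mul_const b).const_add 1
    have h2 : HasDerivAt (fun w : ℂ => ζ + Complex.log (1 + w * b)) (b / q σ) (σ : ℂ) :=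
      (h1.clog (hqs σ hσ)).const_add ζ
    exact ((hasDerivAt_incompleteGamma (1 - p) (s σ)).comp (σ : ℂ) h2).comp_ofReal
  set K := Real.exp (-(p * ζ.re)) * Real.exp (-(Complex.exp ζ).re) * (Real.cos φ ^ p)⁻¹ with hK
  have hbound : ∀ σ : ℝ, 0 ≤ σ → ‖F' σ‖ ≤ K * Real.exp (-(Real.cos φ) * σ) := by
    intro σ hσ
    have hq0 : q σ ≠ 0 := Complex.slitPlane_ne_zero (hqs σ hσ)
    have hn0 : 0 < ‖q σ‖ := norm_pos_iff.mpr hq0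
    have e1 : Complex.exp (s σ) = Complex.exp ζ + σ * Complex.exp (φ * Complex.I) := by
      simp only [hs]
      rw [Complex.exp_add, Complex.exp_log hq0, hq, hb', Complex.exp_sub]
      have := Complex.exp_ne_zero ζ
      field_simp
    have e2 : ‖Complex.exp ((1 - p) * s σ)‖ = Real.exp ((1 - p) * ζ.re) * ‖q σ‖ ^ (1 - p) := by
      rw [Complex.norm_exp, Real.rpow_def_of_pos hn0, ← Real.exp_add]
      congr 1
      simp only [hs, Complex.mul_re, Complex.add_re, Complex.sub_re, Complex.sub_im,
        Complex.one_re, Complex.one_im, Complex.ofReal_re, Complex.ofReal_im, Complex.log_re]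
      ring
    have e3 : ‖Complex.exp (-Complex.exp (s σ))‖ =
        Real.exp (-(Complex.exp ζ).re) * Real.exp (-(Real.cos φ) * σ) := by
      rw [Complex.norm_exp, e1, ← Real.exp_add]
      congr 1
      simp [Complex.exp_ofReal_mul_I_re]
      ring
    have e4 : ‖b‖ = Real.exp (-ζ.re) := by
      rw [hb', Complex.norm_exp]; simp
    simp only [hF', norm_mul, norm_neg, norm_div]
    rw [e2, e3, e4, Real.rpow_sub hn0, Real.rpow_one, hK]
    have e5 : (‖q σ‖ ^ p)⁻¹ ≤ (Real.cos φ ^ p)⁻¹ :=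
      inv_anti₀ (Real.rpow_pos_of_pos hcos p) (Real.rpow_le_rpow hcos.le (hqc σ hσ) hp)
    have e6 : Real.exp (-(p * ζ.re)) = Real.exp ((1 - p) * ζ.re) * Real.exp (-ζ.re) := by
      rw [← Real.exp_add]; ring_nf
    calc _ = Real.exp (-(p * ζ.re)) * Real.exp (-(Complex.exp ζ).re) * (‖q σ‖ ^ p)⁻¹ *
          Real.exp (-(Real.cos φ) * σ) := by
          rw [e6]; field_simp
      _ ≤ _ := by gcongr
  have hgint : IntegrableOn (fun σ : ℝ => K * Real.exp (-(Real.cos φ) * σ)) (Ioi 0) :=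
    (exp_neg_integrableOn_Ioi 0 hcos).const_mul K
  have hqcont : Continuous q := by fun_prop
  have hscont : ContinuousOn s (Ioi 0) := by
    refine continuousOn_const.add ?_
    exact hqcont.continuousOn.clog fun σ hσ => hqs σ (le_of_lt hσ)
  have hF'int : IntegrableOn F' (Ioi 0) := by
    refine Integrable.mono' hgint ?_ ?_
    · refine ContinuousOn.aestronglyMeasurable ?_ measurableSet_Ioi
      refine ContinuousOn.mul ?_ (continuousOn_const.div hqcont.continuousOn
        fun σ hσ => Complex.slitPlane_ne_zero (hqs σ (le_of_lt hσ)))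
      exact ((continuousOn_const.mul hscont).cexp.mul hscont.cexp.neg.cexp).neg
    · exact (ae_restrict_iff' measurableSet_Ioi).mpr
        (Eventually.of_forall fun σ hσ => hbound σ (le_of_lt hσ))
  have hre : Tendsto (fun σ => (s σ).re) atTop atTop := by
    have h1 : Tendsto (fun σ => ‖q σ‖) atTop atTop := by
      refine tendsto_atTop_mono (f := fun σ : ℝ => σ * r - 1) (fun σ => ?_) ?_
      · have h2 : ‖(σ : ℂ) * b‖ ≤ ‖q σ‖ + 1 := by
          have : (σ : ℂ) * b = q σ - 1 := by simp [hq]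
          rw [this]
          simpa using norm_sub_le (q σ) 1
        have h3 : σ * r ≤ ‖(σ : ℂ) * b‖ := by
          rw [norm_mul, hb, norm_mul, Complex.norm_exp_ofReal_mul_I, Complex.norm_real,
            Complex.norm_real, mul_one, Real.norm_eq_abs, Real.norm_eq_abs, abs_of_pos hr0]
          exact mul_le_mul_of_nonneg_right (le_abs_self σ) hr0.le
        linarith
      · exact tendsto_atTop_add_const_right _ _ (tendsto_id.atTop_mul_const hr0)
    have h2 := tendsto_atTop_add_const_left atTop ζ.re (Real.tendsto_log_atTop.comp h1)
    refine h2.congr fun σ => ?_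
    simp [hs, Complex.log_re]
  have hφ2 := abs_lt.mp hφ'
  have hargb : Complex.arg b = 2 * (-φ) := by
    rw [hb, Complex.arg_real_mul _ hr0, Complex.arg_exp_mul_I]
    exact (toIocMod_eq_self _).mpr ⟨by linarith, by linarith⟩
  have hbs : b ∈ Complex.slitPlane := by
    rw [Complex.mem_slitPlane_iff_arg, hargb]
    refine ⟨by intro h; linarith, ?_⟩
    rw [hb']; exact Complex.exp_ne_zero _
  -- the argument of the ray tends to `3φ - 2φ = φ`, so it ends in the right half-plane
  have himlim : Tendsto (fun σ => (s σ).im) atTop (𝓝 φ) := by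
    have h1 : Tendsto (fun σ : ℝ => ((σ⁻¹ : ℝ) : ℂ) + b) atTop (𝓝 b) := by
      have := (Complex.continuous_ofReal.tendsto 0).comp tendsto_inv_atTop_zero
      simpa using this.add_const b
    have h2 := ((Complex.continuousAt_arg hbs).tendsto.comp h1).const_add ζ.im
    rw [hargb, him] at h2
    have h3 : 3 * φ + 2 * -φ = φ := by ring
    rw [h3] at h2
    refine h2.congr' ?_
    filter_upwards [eventually_gt_atTop (0 : ℝ)] with σ hσ
    have h4 : q σ = (σ : ℂ) * (((σ⁻¹ : ℝ) : ℂ) + b) := by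
      have : (σ : ℂ) ≠ 0 := by exact_mod_cast hσ.ne'
      simp only [hq]; push_cast; field_simp
    simp only [hs, Complex.add_im, Complex.log_im, Function.comp, him]
    rw [h4, Complex.arg_real_mul _ hσ]
  have hlim : Tendsto (fun σ => incompleteGamma (1 - p) (s σ)) atTop (𝓝 0) := by
    refine tendsto_incompleteGamma (ψ := (|φ| + Real.pi / 2) / 2) (by linarith) _ hre ?_
    have := himlim.abs.eventually_lt_const (u := (|φ| + Real.pi / 2) / 2) (by linarith)
    exact this.mono fun _ h => h.le
  have hint := integral_Ioi_of_hasDerivAt_of_tendsto (hder 0 le_rfl).continuousAt.continuousWithinAt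
    (fun σ hσ => hder σ (le_of_lt hσ)) hF'int hlim
  have hs0 : s 0 = ζ := by simp [hs, hq]
  have hΓ : ‖incompleteGamma (1 - p) ζ‖ ≤ K * (Real.cos φ)⁻¹ := by
    have h1 : ‖∫ σ in Ioi 0, F' σ‖ ≤ ∫ σ in Ioi 0, K * Real.exp (-(Real.cos φ) * σ) :=
      norm_integral_le_of_norm_le hgint ((ae_restrict_iff' measurableSet_Ioi).mpr
        (Eventually.of_forall fun σ hσ => hbound σ (le_of_lt hσ)))
    rw [hint, hs0, zero_sub, norm_neg, integral_const_mul] at h1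
    have h2 : ∫ σ : ℝ in Ioi 0, Real.exp (-(Real.cos φ) * σ) = (Real.cos φ)⁻¹ := by
      rw [integral_exp_mul_Ioi (by linarith)]
      simp [neg_div_neg_eq]
    rwa [h2] at h1
  unfold terminantLambda
  rw [norm_mul, norm_mul, Complex.norm_exp, Complex.norm_exp]
  have e1 : ((p : ℂ) * ζ).re = p * ζ.re := by simp
  rw [e1]
  calc _ ≤ Real.exp (p * ζ.re) * Real.exp (Complex.exp ζ).re * (K * (Real.cos φ)⁻¹) := by gcongr
    _ = _ := by
      rw [hK, Real.exp_neg, Real.exp_neg, Real.rpow_add_one hcos.ne']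
      have := Real.exp_ne_zero (p * ζ.re)
      have := Real.exp_ne_zero (Complex.exp ζ).re
      field_simp

/-- The contiguous relation `Λ_p(w) = 1 - (p / w) Λ_(p+1)(w)`. -/
theorem terminantLambda_eq_one_sub (p ζ : ℂ) :
    terminantLambda p ζ = 1 - p * Complex.exp (-ζ) * terminantLambda (p + 1) ζ := by
  have h := incompleteGamma_add_one (-p) ζ
  unfold terminantLambda
  have e1 : (1 : ℂ) - p = -p + 1 := by ring
  have e2 : (1 : ℂ) - (p + 1) = -p := by ring
  have e3 : Complex.exp (-p * ζ) = (Complex.exp (p * ζ))⁻¹ := by rw [neg_mul, Complex.exp_neg]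
  rw [e1, e2, h, add_mul p 1 ζ, one_mul, Complex.exp_add, e3, Complex.exp_neg, Complex.exp_neg]
  have h1 := Complex.exp_ne_zero (p * ζ)
  have h2 := Complex.exp_ne_zero ζ
  have h3 := Complex.exp_ne_zero (Complex.exp ζ)
  field_simp
  ring

theorem hasDerivAt_terminantLambda (p ζ : ℂ) :
    HasDerivAt (terminantLambda p)
      (p * (terminantLambda p ζ - terminantLambda (p + 1) ζ)) ζ := by
  have h1 : HasDerivAt (fun ζ : ℂ => Complex.exp (p * ζ)) (Complex.exp (p * ζ) * p) ζ := by
    simpa using ((hasDerivAt_id ζ).const_mul p).cexp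
  have h2 := (h1.mul (Complex.hasDerivAt_exp ζ).cexp).mul (hasDerivAt_incompleteGamma (1 - p) ζ)
  refine h2.congr_deriv ?_
  have h3 : Complex.exp ζ * terminantLambda p ζ =
      Complex.exp ζ - p * terminantLambda (p + 1) ζ := by
    rw [terminantLambda_eq_one_sub, Complex.exp_neg]
    have := Complex.exp_ne_zero ζ
    field_simp
  have h4 : p * terminantLambda (p + 1) ζ = Complex.exp ζ - Complex.exp ζ * terminantLambda p ζ := by
    rw [h3]; ring
  rw [mul_sub, h4]
  simp only [terminantLambda, Pi.mul_apply]
  rw [sub_mul, one_mul, Complex.exp_sub, Complex.exp_neg]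
  have h1 := Complex.exp_ne_zero (p * ζ)
  have h2 := Complex.exp_ne_zero ζ
  have h3 := Complex.exp_ne_zero (Complex.exp ζ)
  field_simp
  ring

/-! ### Weighted integrals of the basic terminant -/

theorem integrable_exp_neg_mul_abs {b : ℝ} (hb : 0 < b) :
    Integrable fun u : ℝ => Real.exp (-(b * |u|)) := by
  rw [← integrableOn_univ, ← Iic_union_Ioi (a := (0 : ℝ))]
  refine IntegrableOn.union ?_ ?_
  · refine (integrableOn_exp_mul_Iic hb 0).congr_fun (fun u hu => ?_) measurableSet_Iic
    simp only [abs_of_nonpos (mem_Iic.mp hu)]; ring_nf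
  · refine (exp_neg_integrableOn_Ioi 0 hb).congr_fun (fun u hu => ?_) measurableSet_Ioi
    simp only [abs_of_pos (mem_Ioi.mp hu)]; ring_nf

theorem one_add_cosh_pos (u : ℝ) : 0 < 1 + Real.cosh u := by linarith [Real.cosh_pos u]

/-- The weight `e^(νu) (1 + cosh u)^(-s)`. -/
def coshWeight (ν : ℂ) (s u : ℝ) : ℂ :=
  Complex.exp (ν * u) * (((1 + Real.cosh u) ^ (-s) : ℝ) : ℂ)

theorem continuous_coshWeight (ν : ℂ) (s : ℝ) : Continuous (coshWeight ν s) := by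
  unfold coshWeight
  refine Continuous.mul (by fun_prop) (Complex.continuous_ofReal.comp ?_)
  exact (continuous_const.add Real.continuous_cosh).rpow_const
    fun u => Or.inl (one_add_cosh_pos u).ne'

theorem norm_coshWeight (ν : ℂ) (s u : ℝ) :
    ‖coshWeight ν s u‖ = Real.exp (ν.re * u) * (1 + Real.cosh u) ^ (-s) := by
  unfold coshWeight
  rw [norm_mul, Complex.norm_exp, Complex.norm_real, Real.norm_eq_abs,
    abs_of_pos (Real.rpow_pos_of_pos (one_add_cosh_pos u) _)]
  simp

theorem norm_coshWeight_le {ν : ℂ} {s τ : ℝ} (hs : 0 ≤ s) (hν : |ν.re| ≤ τ) (u : ℝ) :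
    ‖coshWeight ν s u‖ ≤ 2 ^ s * Real.exp (-((s - τ) * |u|)) := by
  rw [norm_coshWeight]
  have h1 : Real.exp |u| / 2 ≤ 1 + Real.cosh u := by
    rw [← Real.cosh_abs u, Real.cosh_eq]
    linarith [Real.exp_pos (-|u|)]
  have h2 : (1 + Real.cosh u) ^ (-s) ≤ (Real.exp |u| / 2) ^ (-s) :=
    Real.rpow_le_rpow_of_nonpos (by positivity) h1 (by linarith)
  have h3 : (Real.exp |u| / 2) ^ (-s) = 2 ^ s * Real.exp (-(s * |u|)) := by
    rw [Real.div_rpow (Real.exp_pos _).le zero_le_two, ← Real.exp_mul, Real.rpow_neg zero_le_two]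
    rw [div_inv_eq_mul, mul_comm]
    ring_nf
  have h4 : Real.exp (ν.re * u) ≤ Real.exp (τ * |u|) := by
    apply Real.exp_le_exp.mpr
    calc ν.re * u ≤ |ν.re * u| := le_abs_self _
      _ = |ν.re| * |u| := abs_mul _ _
      _ ≤ _ := by gcongr
  calc _ ≤ Real.exp (τ * |u|) * (2 ^ s * Real.exp (-(s * |u|))) := by
        rw [← h3]; gcongr
    _ = _ := by
      rw [mul_left_comm, ← Real.exp_add]; ring_nf

theorem integrable_coshWeight {ν : ℂ} {s : ℝ} (hν : |ν.re| < s) : Integrable (coshWeight ν s) := by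
  have hs : 0 ≤ s := (abs_nonneg _).trans hν.le
  refine Integrable.mono' ((integrable_exp_neg_mul_abs (sub_pos.mpr hν)).const_mul (2 ^ s))
    (continuous_coshWeight ν s).aestronglyMeasurable (Eventually.of_forall fun u => ?_)
  exact norm_coshWeight_le hs le_rfl u

theorem integrable_coshWeight_mul {ν : ℂ} {s : ℝ} (hν : |ν.re| < s) {g : ℝ → ℂ}
    (hg : Continuous g) {M : ℝ} (hM : ∀ u, ‖g u‖ ≤ M) :
    Integrable fun u => coshWeight ν s u * g u :=
  (integrable_coshWeight hν).mul_bdd hg.aestronglyMeasurable (Eventually.of_forall hM)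

/-- The Beta integral `∫ e^(νu) (1 + cosh u)^(-s) du = 2^s Γ(s + ν) Γ(s - ν) / Γ(2s)`. -/
theorem integral_coshWeight {ν : ℂ} {s : ℝ} (hν : |ν.re| < s) :
    (∫ u, coshWeight ν s u) * Complex.Gamma (2 * s) =
      (2 ^ s : ℝ) * (Complex.Gamma (s + ν) * Complex.Gamma (s - ν)) := by
  obtain ⟨h1, h2⟩ := abs_lt.mp hν
  rw [Complex.Gamma_mul_Gamma_eq_betaIntegral (by simp; linarith) (by simp; linarith)]
  have hB : Complex.betaIntegral (s + ν) (s - ν) = (2 ^ (-s) : ℝ) * ∫ u, coshWeight ν s u := by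
    unfold Complex.betaIntegral
    -- the substitution `x = 1 / (1 + e^(-u))`, for which `x (1 - x) = 1 / (2 (1 + cosh u))`
    rw [intervalIntegral.integral_of_le zero_le_one, integral_Ioc_eq_integral_Ioo,
      ← Real.range_sigmoid, ← image_univ, integral_image_eq_integral_abs_deriv_smul
        MeasurableSet.univ (fun u _ => (Real.hasDerivAt_sigmoid u).hasDerivWithinAt)
        Real.sigmoid_injective.injOn, Measure.restrict_univ, ← integral_const_mul]
    congr 1
    funext u
    have hx0 := Real.sigmoid_pos u
    have hx1 : 0 < 1 - Real.sigmoid u := by linarith [Real.sigmoid_lt_one u]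
    have hc := one_add_cosh_pos u
    have hprod : Real.sigmoid u * (1 - Real.sigmoid u) = (2 * (1 + Real.cosh u))⁻¹ := by
      rw [Real.sigmoid_def, Real.cosh_eq, Real.exp_neg]
      have := Real.exp_pos u
      field_simp
      ring
    have hlog : Real.log (Real.sigmoid u) - Real.log (1 - Real.sigmoid u) = u := by
      have : Real.sigmoid u = Real.exp u * (1 - Real.sigmoid u) := by
        rw [Real.sigmoid_def, Real.exp_neg]
        have := Real.exp_pos u
        field_simp
        ring
      rw [← Real.log_div hx0.ne' hx1.ne', (div_eq_iff hx1.ne').mpr this, Real.log_exp]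
    have hsum : Real.log (Real.sigmoid u) + Real.log (1 - Real.sigmoid u) =
        -(Real.log 2 + Real.log (1 + Real.cosh u)) := by
      rw [← Real.log_mul hx0.ne' hx1.ne', hprod, Real.log_inv, Real.log_mul two_ne_zero hc.ne']
    have hx1' : (1 - (Real.sigmoid u : ℂ)) = ((1 - Real.sigmoid u : ℝ) : ℂ) := by push_cast; rfl
    rw [abs_of_pos (mul_pos hx0 hx1), hx1', Complex.real_smul, coshWeight,
      Complex.cpow_def_of_ne_zero (by exact_mod_cast hx0.ne'),
      Complex.cpow_def_of_ne_zero (by exact_mod_cast hx1.ne'),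
      ← Complex.ofReal_log hx0.le, ← Complex.ofReal_log hx1.le]
    rw [Real.rpow_def_of_pos hc, Real.rpow_def_of_pos two_pos]
    nth_rewrite 1 [← Real.exp_log hx0, ← Real.exp_log hx1]
    simp only [Complex.ofReal_mul, Complex.ofReal_exp]
    rw [← Complex.exp_add, ← Complex.exp_add, ← Complex.exp_add, ← Complex.exp_add,
      ← Complex.exp_add]
    congr 1
    have hlog' : ((Real.log (Real.sigmoid u) : ℝ) : ℂ) =
      (u - (Real.log 2 + Real.log (1 + Real.cosh u))) / 2 := by
      rw [← Complex.ofReal_add, ← Complex.ofReal_sub]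
      rw [show (2 : ℂ) = ((2 : ℝ) : ℂ) by norm_num, ← Complex.ofReal_div]
      congr 1; linarith
    have hlog'' : ((Real.log (1 - Real.sigmoid u) : ℝ) : ℂ) =
      (-u - (Real.log 2 + Real.log (1 + Real.cosh u))) / 2 := by
      rw [← Complex.ofReal_add, ← Complex.ofReal_neg, ← Complex.ofReal_sub]
      rw [show (2 : ℂ) = ((2 : ℝ) : ℂ) by norm_num, ← Complex.ofReal_div]
      congr 1; linarith
    rw [hlog', hlog'']
    push_cast
    ring
  rw [hB, Real.rpow_neg zero_le_two]
  have : (((2 : ℝ) ^ s : ℝ) : ℂ) ≠ 0 := by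
    exact_mod_cast (Real.rpow_pos_of_pos two_pos s).ne'
  push_cast at *
  field_simp
  ring_nf

/-- The integral `∫ e^(νu) (1 + cosh u)^(-s) Λ_p(z (1 + cosh u)) du`, with `z` of logarithmic
coordinate `ζ`. -/
def terminantIntegral (ν : ℂ) (s p : ℝ) (ζ : ℂ) : ℂ :=
  ∫ u : ℝ, coshWeight ν s u * terminantLambda p (ζ + (Real.log (1 + Real.cosh u) : ℝ))

theorem continuous_terminantLambda (p : ℂ) : Continuous (terminantLambda p) :=
  continuous_iff_continuousAt.mpr fun ζ => (hasDerivAt_terminantLambda p ζ).continuousAt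

theorem continuous_log_one_add_cosh : Continuous fun u : ℝ => Real.log (1 + Real.cosh u) :=
  (continuous_const.add Real.continuous_cosh).log fun u => (one_add_cosh_pos u).ne'

theorem continuous_terminantLambda_add_log (p : ℂ) (ζ : ℂ) :
    Continuous fun u : ℝ => terminantLambda p (ζ + (Real.log (1 + Real.cosh u) : ℝ)) :=
  (continuous_terminantLambda p).comp
    (continuous_const.add (Complex.continuous_ofReal.comp continuous_log_one_add_cosh))

theorem norm_terminantLambda_add_ofReal_le {p : ℝ} (hp : 0 ≤ p) {ζ : ℂ}
    (hζ : |ζ.im| < 3 * Real.pi / 2) (x : ℝ) :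
    ‖terminantLambda p (ζ + (x : ℂ))‖ ≤ (Real.cos (ζ.im / 3) ^ (p + 1))⁻¹ := by
  have := norm_terminantLambda_le hp (ζ := ζ + (x : ℂ)) (by simpa using hζ)
  simpa using this

theorem integrable_terminantIntegral {ν : ℂ} {s p : ℝ} (hν : |ν.re| < s) (hp : 0 ≤ p) {ζ : ℂ}
    (hζ : |ζ.im| < 3 * Real.pi / 2) :
    Integrable fun u : ℝ =>
      coshWeight ν s u * terminantLambda p (ζ + (Real.log (1 + Real.cosh u) : ℝ)) :=
  integrable_coshWeight_mul hν (continuous_terminantLambda_add_log p ζ)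
    fun _ => norm_terminantLambda_add_ofReal_le hp hζ _

theorem inv_cos_rpow_le {y θ p : ℝ} (hp : 0 ≤ p) (hy : |y| ≤ θ) (hθ : θ < 3 * Real.pi / 2) :
    (Real.cos (y / 3) ^ (p + 1))⁻¹ ≤ (Real.cos (θ / 3) ^ (p + 1))⁻¹ := by
  have h0 : 0 ≤ θ := (abs_nonneg y).trans hy
  have hpi := Real.pi_pos
  have hc : 0 < Real.cos (θ / 3) := Real.cos_pos_of_mem_Ioo ⟨by linarith, by linarith⟩
  refine inv_anti₀ (Real.rpow_pos_of_pos hc _) (Real.rpow_le_rpow hc.le ?_ (by linarith))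
  rw [← Real.cos_abs (y / 3), abs_div, abs_of_pos (by norm_num : (0 : ℝ) < 3)]
  exact Real.cos_le_cos_of_nonneg_of_le_pi (by positivity) (by linarith) (by linarith)

theorem hasDerivAt_terminantIntegral {ν : ℂ} {s p : ℝ} (hν : |ν.re| < s) (hp : 0 ≤ p) {ζ : ℂ}
    (hζ : |ζ.im| < 3 * Real.pi / 2) :
    HasDerivAt (terminantIntegral ν s p)
      (p * (terminantIntegral ν s p ζ - terminantIntegral ν s (p + 1) ζ)) ζ := by
  set θ := (|ζ.im| + 3 * Real.pi / 2) / 2 with hθ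
  have hθ1 : |ζ.im| < θ := by linarith
  have hθ2 : θ < 3 * Real.pi / 2 := by linarith
  have hS : {w : ℂ | |w.im| < θ} ∈ 𝓝 ζ :=
    (isOpen_lt (by fun_prop) continuous_const).mem_nhds hθ1
  have hF := hasDerivAt_integral_of_dominated_loc_of_deriv_le (μ := volume) (x₀ := ζ)
    (F := fun w u => coshWeight ν s u * terminantLambda p (w + (Real.log (1 + Real.cosh u) : ℝ)))
    (F' := fun w u => coshWeight ν s u *
      (p * (terminantLambda p (w + (Real.log (1 + Real.cosh u) : ℝ)) -
        terminantLambda ((p + 1 : ℝ) : ℂ) (w + (Real.log (1 + Real.cosh u) : ℝ)))))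
    (bound := fun u => ‖coshWeight ν s u‖ *
      (p * ((Real.cos (θ / 3) ^ (p + 1))⁻¹ + (Real.cos (θ / 3) ^ (p + 1 + 1))⁻¹))) hS
    (Eventually.of_forall fun w => ((continuous_coshWeight ν s).mul
      (continuous_terminantLambda_add_log p w)).aestronglyMeasurable)
    (integrable_terminantIntegral hν hp hζ)
    ((continuous_coshWeight ν s).mul (continuous_const.mul
      ((continuous_terminantLambda_add_log p ζ).sub
        (continuous_terminantLambda_add_log _ ζ)))).aestronglyMeasurable
    (Eventually.of_forall fun u w hw => ?_)
    ((integrable_coshWeight hν).norm.mul_const _)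
    (Eventually.of_forall fun u w hw => ?_)
  · refine hF.2.congr_deriv ?_
    unfold terminantIntegral
    rw [← integral_sub (integrable_terminantIntegral hν hp hζ)
      (integrable_terminantIntegral hν (by linarith) hζ), ← integral_const_mul]
    congr 1
    funext u
    ring
  · have hw' : |w.im| < θ := hw
    rw [norm_mul]
    refine mul_le_mul_of_nonneg_left ?_ (norm_nonneg _)
    rw [norm_mul, Complex.norm_real, Real.norm_eq_abs, abs_of_nonneg hp]
    refine mul_le_mul_of_nonneg_left ((norm_sub_le _ _).trans (add_le_add ?_ ?_)) hp
    · exact (norm_terminantLambda_add_ofReal_le hp (hw'.trans hθ2) _).trans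
        (inv_cos_rpow_le hp hw'.le hθ2)
    · exact (norm_terminantLambda_add_ofReal_le (by linarith) (hw'.trans hθ2) _).trans
        (inv_cos_rpow_le (by linarith) hw'.le hθ2)
  · have h1 := (hasDerivAt_terminantLambda p (w + (Real.log (1 + Real.cosh u) : ℝ))).comp w
      ((hasDerivAt_id w).add_const ((Real.log (1 + Real.cosh u) : ℝ) : ℂ))
    refine (h1.const_mul (coshWeight ν s u)).congr_deriv ?_
    push_cast
    ring

theorem continuousAt_terminantIntegral_order {ν : ℂ} {s p : ℝ} (hν : |ν.re| < s) (hp : 0 ≤ p)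
    {ζ : ℂ} (hζ : |ζ.im| < 3 * Real.pi / 2) :
    ContinuousAt (fun μ => terminantIntegral μ s p ζ) ν := by
  have hs : 0 ≤ s := (abs_nonneg _).trans hν.le
  set τ := (|ν.re| + s) / 2 with hτ
  have hτ1 : |ν.re| < τ := by linarith
  have hτ2 : τ < s := by linarith
  have hS : ∀ᶠ μ : ℂ in 𝓝 ν, |μ.re| < τ :=
    (isOpen_lt (by fun_prop) continuous_const).mem_nhds hτ1
  refine continuousAt_of_dominated
    (bound := fun u => 2 ^ s * Real.exp (-((s - τ) * |u|)) * (Real.cos (ζ.im / 3) ^ (p + 1))⁻¹)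
    (Eventually.of_forall fun μ => ((continuous_coshWeight μ s).mul
      (continuous_terminantLambda_add_log p ζ)).aestronglyMeasurable) ?_ ?_ ?_
  · filter_upwards [hS] with μ hμ
    refine Eventually.of_forall fun u => ?_
    rw [norm_mul]
    exact mul_le_mul (norm_coshWeight_le hs hμ.le u) (norm_terminantLambda_add_ofReal_le hp hζ _)
      (norm_nonneg _) (by positivity)
  · exact ((integrable_exp_neg_mul_abs (sub_pos.mpr hτ2)).const_mul _).mul_const _
  · refine Eventually.of_forall fun u => ?_
    unfold coshWeight
    fun_prop

/-- `Λ_p(w) = 1 - (p / w) Λ_(p+1)(w)` at `w = z (1 + cosh u)`. -/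
theorem terminantLambda_add_log (p ζ : ℂ) (u : ℝ) :
    terminantLambda p (ζ + (Real.log (1 + Real.cosh u) : ℝ)) =
      1 - p * Complex.exp (-ζ) / ((1 + Real.cosh u : ℝ) : ℂ) *
        terminantLambda (p + 1) (ζ + (Real.log (1 + Real.cosh u) : ℝ)) := by
  rw [terminantLambda_eq_one_sub, neg_add, Complex.exp_add]
  have : Complex.exp (-((Real.log (1 + Real.cosh u) : ℝ) : ℂ)) =
      ((1 + Real.cosh u : ℝ) : ℂ)⁻¹ := by
    rw [Complex.exp_neg, ← Complex.ofReal_exp, Real.exp_log (one_add_cosh_pos u)]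
  rw [this]
  ring

theorem coshWeight_add_one (ν : ℂ) (s u : ℝ) :
    coshWeight ν (s + 1) u = coshWeight ν s u / ((1 + Real.cosh u : ℝ) : ℂ) := by
  unfold coshWeight
  rw [neg_add, ← sub_eq_add_neg, Real.rpow_sub_one (one_add_cosh_pos u).ne']
  push_cast
  ring

theorem terminantIntegral_eq_sub {ν : ℂ} {s p : ℝ} (hν : |ν.re| < s) (hp : 0 ≤ p) {ζ : ℂ}
    (hζ : |ζ.im| < 3 * Real.pi / 2) :
    terminantIntegral ν s p ζ = (∫ u, coshWeight ν s u) -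
      p * Complex.exp (-ζ) * terminantIntegral ν (s + 1) (p + 1) ζ := by
  unfold terminantIntegral
  rw [← integral_const_mul, ← integral_sub (integrable_coshWeight hν)
    ((integrable_terminantIntegral (by linarith) (by linarith) hζ).const_mul _)]
  congr 1
  funext u
  rw [terminantLambda_add_log, coshWeight_add_one]
  push_cast
  ring

/-! ### The differential equation for the remainder integral -/

theorem hasDerivAt_coshWeight (ν : ℂ) (s u : ℝ) :
    HasDerivAt (coshWeight ν s)
      (coshWeight ν s u * (ν - s * ((Real.sinh u / (1 + Real.cosh u) : ℝ) : ℂ))) u := by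
  have hc := one_add_cosh_pos u
  have h1 : HasDerivAt (fun u : ℝ => Complex.exp (ν * u)) (Complex.exp (ν * u) * ν) u := by
    have : HasDerivAt (fun w : ℂ => Complex.exp (ν * w)) (Complex.exp (ν * u) * ν) (u : ℂ) := by
      simpa using ((hasDerivAt_id (u : ℂ)).const_mul ν).cexp
    exact this.comp_ofReal
  have h2 : HasDerivAt (fun u : ℝ => (1 + Real.cosh u) ^ (-s))
      (Real.sinh u * (-s) * (1 + Real.cosh u) ^ (-s - 1)) u :=
    ((Real.hasDerivAt_cosh u).const_add 1).rpow_const (Or.inl hc.ne')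
  refine (h1.mul h2.ofReal_comp).congr_deriv ?_
  rw [Real.rpow_sub_one hc.ne', coshWeight]
  push_cast
  ring

theorem hasDerivAt_terminantLambda_add_log (p ζ : ℂ) (u : ℝ) :
    HasDerivAt (fun u : ℝ => terminantLambda p (ζ + (Real.log (1 + Real.cosh u) : ℝ)))
      (p * (terminantLambda p (ζ + (Real.log (1 + Real.cosh u) : ℝ)) -
        terminantLambda (p + 1) (ζ + (Real.log (1 + Real.cosh u) : ℝ))) *
        ((Real.sinh u / (1 + Real.cosh u) : ℝ) : ℂ)) u := by
  have h1 : HasDerivAt (fun u : ℝ => ζ + ((Real.log (1 + Real.cosh u) : ℝ) : ℂ))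
      ((Real.sinh u / (1 + Real.cosh u) : ℝ) : ℂ) u :=
    (((Real.hasDerivAt_cosh u).const_add 1).log
      (one_add_cosh_pos u).ne').ofReal_comp.const_add ζ
  exact (hasDerivAt_terminantLambda p _).comp u h1

theorem abs_sinh_div_le (u : ℝ) : |Real.sinh u / (1 + Real.cosh u)| ≤ 1 := by
  have hc := one_add_cosh_pos u
  rw [abs_div, abs_of_pos hc, div_le_one hc]
  refine abs_le_of_sq_le_sq ?_ hc.le
  nlinarith [Real.cosh_sq u, Real.cosh_pos u]

theorem continuous_sinh_div : Continuous fun u : ℝ => Real.sinh u / (1 + Real.cosh u) :=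
  Real.continuous_sinh.div (continuous_const.add Real.continuous_cosh)
    fun u => (one_add_cosh_pos u).ne'

/-- Double integration by parts of `e^(νu) (1 + cosh u)^(-p) Λ_p(z (1 + cosh u))` in `u`:
`∂_u² - ν²` applied to the factor of `e^(νu)` integrates to zero. -/
theorem integral_coshWeight_mul_second_deriv {ν : ℂ} {p : ℝ} (hν : |ν.re| < p) {ζ : ℂ}
    (hζ : |ζ.im| < 3 * Real.pi / 2) :
    Integrable (fun u : ℝ => coshWeight ν p u *
      (-p * ((1 - ((1 + Real.cosh u : ℝ) : ℂ)⁻¹) *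
          terminantLambda (p + 1) (ζ + (Real.log (1 + Real.cosh u) : ℝ)) -
        (p + 1) * (1 - 2 * ((1 + Real.cosh u : ℝ) : ℂ)⁻¹) *
          terminantLambda (p + 2) (ζ + (Real.log (1 + Real.cosh u) : ℝ))) -
        ν ^ 2 * terminantLambda p (ζ + (Real.log (1 + Real.cosh u) : ℝ)))) ∧
    ∫ u : ℝ, coshWeight ν p u *
      (-p * ((1 - ((1 + Real.cosh u : ℝ) : ℂ)⁻¹) *
          terminantLambda (p + 1) (ζ + (Real.log (1 + Real.cosh u) : ℝ)) -
        (p + 1) * (1 - 2 * ((1 + Real.cosh u : ℝ) : ℂ)⁻¹) *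
          terminantLambda (p + 2) (ζ + (Real.log (1 + Real.cosh u) : ℝ))) -
        ν ^ 2 * terminantLambda p (ζ + (Real.log (1 + Real.cosh u) : ℝ))) = 0 := by
  have hp : 0 ≤ p := (abs_nonneg _).trans hν.le
  have b0 := norm_terminantLambda_add_ofReal_le hp hζ
  have b1 := norm_terminantLambda_add_ofReal_le (p := p + 1) (by linarith) hζ
  have b2 := norm_terminantLambda_add_ofReal_le (p := p + 2) (by linarith) hζ
  push_cast at b1 b2
  set B0 := (Real.cos (ζ.im / 3) ^ (p + 1))⁻¹
  set B1 := (Real.cos (ζ.im / 3) ^ (p + 1 + 1))⁻¹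
  set B2 := (Real.cos (ζ.im / 3) ^ (p + 2 + 1))⁻¹
  have c0 := continuous_terminantLambda_add_log p ζ
  have c1 := continuous_terminantLambda_add_log (p + 1) ζ
  have c2 := continuous_terminantLambda_add_log (p + 2) ζ
  have cinv : Continuous fun u : ℝ => ((1 + Real.cosh u : ℝ) : ℂ)⁻¹ :=
    (Complex.continuous_ofReal.comp (continuous_const.add Real.continuous_cosh)).inv₀ fun u => by
      show ((1 + Real.cosh u : ℝ) : ℂ) ≠ 0
      exact_mod_cast (one_add_cosh_pos u).ne'
  have binv : ∀ u : ℝ, ‖((1 + Real.cosh u : ℝ) : ℂ)⁻¹‖ ≤ 1 := fun u => by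
    rw [norm_inv, Complex.norm_real, Real.norm_eq_abs, abs_of_pos (one_add_cosh_pos u)]
    exact inv_le_one_of_one_le₀ (by linarith [Real.cosh_pos u])
  have hint : Integrable (fun u : ℝ => coshWeight ν p u *
      (-p * ((1 - ((1 + Real.cosh u : ℝ) : ℂ)⁻¹) *
          terminantLambda (p + 1) (ζ + (Real.log (1 + Real.cosh u) : ℝ)) -
        (p + 1) * (1 - 2 * ((1 + Real.cosh u : ℝ) : ℂ)⁻¹) *
          terminantLambda (p + 2) (ζ + (Real.log (1 + Real.cosh u) : ℝ))) -
        ν ^ 2 * terminantLambda p (ζ + (Real.log (1 + Real.cosh u) : ℝ)))) := by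
    refine integrable_coshWeight_mul hν (M := p * (2 * B1 + (p + 1) * 3 * B2) + ‖ν‖ ^ 2 * B0)
      (by fun_prop) fun u => ?_
    have hp1 : ‖(p : ℂ) + 1‖ = p + 1 := by
      rw [← Complex.ofReal_one, ← Complex.ofReal_add, Complex.norm_real, Real.norm_eq_abs,
        abs_of_nonneg (by linarith)]
    have hp0 : ‖-(p : ℂ)‖ = p := by
      rw [norm_neg, Complex.norm_real, Real.norm_eq_abs, abs_of_nonneg hp]
    have i1 : ‖1 - ((1 + Real.cosh u : ℝ) : ℂ)⁻¹‖ ≤ 2 := by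
      refine (norm_sub_le _ _).trans ?_
      rw [norm_one]; linarith [binv u]
    have i2 : ‖1 - 2 * ((1 + Real.cosh u : ℝ) : ℂ)⁻¹‖ ≤ 3 := by
      refine (norm_sub_le _ _).trans ?_
      rw [norm_one, norm_mul, Complex.norm_ofNat]; linarith [binv u]
    refine (norm_sub_le _ _).trans (add_le_add ?_ ?_)
    · rw [norm_mul, hp0]
      refine mul_le_mul_of_nonneg_left ((norm_sub_le _ _).trans (add_le_add ?_ ?_)) hp
      · rw [norm_mul]
        exact mul_le_mul i1 (b1 _) (norm_nonneg _) zero_le_two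
      · rw [norm_mul, norm_mul, hp1]
        exact mul_le_mul (mul_le_mul_of_nonneg_left i2 (by linarith)) (b2 _) (norm_nonneg _)
          (by positivity)
    · rw [norm_mul, norm_pow]
      exact mul_le_mul_of_nonneg_left (b0 _) (by positivity)
  refine ⟨hint, ?_⟩
  refine integral_eq_zero_of_hasDerivAt_of_integrable
    (f := fun u : ℝ => coshWeight ν p u *
      (-p * ((Real.sinh u / (1 + Real.cosh u) : ℝ) : ℂ) *
        terminantLambda (p + 1) (ζ + (Real.log (1 + Real.cosh u) : ℝ)) -
        ν * terminantLambda p (ζ + (Real.log (1 + Real.cosh u) : ℝ)))) (fun u => ?_) hint ?_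
  · have hc := one_add_cosh_pos u
    have hr : HasDerivAt (fun u : ℝ => Real.sinh u / (1 + Real.cosh u))
        (1 + Real.cosh u)⁻¹ u := by
      refine ((Real.hasDerivAt_sinh u).div ((Real.hasDerivAt_cosh u).const_add 1)
        hc.ne').congr_deriv ?_
      have := Real.cosh_sq u
      field_simp
      nlinarith
    have h := (hasDerivAt_coshWeight ν p u).mul
      (((hr.ofReal_comp.const_mul (-(p : ℂ))).mul
        (hasDerivAt_terminantLambda_add_log (p + 1) ζ u)).sub
        ((hasDerivAt_terminantLambda_add_log p ζ u).const_mul ν))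
    refine h.congr_deriv ?_
    have hsq : ((Real.sinh u / (1 + Real.cosh u) : ℝ) : ℂ) ^ 2 =
        1 - 2 * ((1 + Real.cosh u : ℝ) : ℂ)⁻¹ := by
      rw [← Complex.ofReal_inv, ← Complex.ofReal_pow,
        show (1 - 2 * (((1 + Real.cosh u)⁻¹ : ℝ) : ℂ)) =
          ((1 - 2 * (1 + Real.cosh u)⁻¹ : ℝ) : ℂ) by push_cast; ring]
      congr 1
      have := Real.cosh_sq u
      field_simp
      nlinarith
    have e2 : (p : ℂ) + 1 + 1 = p + 2 := by ring
    simp only [e2, Pi.mul_apply, Pi.sub_apply, Complex.ofReal_inv]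
    set R := ((Real.sinh u / (1 + Real.cosh u) : ℝ) : ℂ)
    set c := ((1 + Real.cosh u : ℝ) : ℂ)⁻¹
    linear_combination (coshWeight ν p u * p * (p + 1) *
      terminantLambda (p + 2) (ζ + (Real.log (1 + Real.cosh u) : ℝ)) -
      coshWeight ν p u * p *
      terminantLambda (p + 1) (ζ + (Real.log (1 + Real.cosh u) : ℝ))) * hsq
  · refine integrable_coshWeight_mul hν (M := p * B1 + ‖ν‖ * B0) ?_ fun u => ?_
    · have := Complex.continuous_ofReal.comp continuous_sinh_div
      simp only [Function.comp_def] at this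
      fun_prop
    · refine (norm_sub_le _ _).trans (add_le_add ?_ ?_)
      · rw [norm_mul, norm_mul, norm_neg, Complex.norm_real, Complex.norm_real, Real.norm_eq_abs,
          Real.norm_eq_abs, abs_of_nonneg hp]
        exact mul_le_mul (mul_le_of_le_one_right hp (abs_sinh_div_le u)) (b1 _) (norm_nonneg _) hp
      · rw [norm_mul]
        exact mul_le_mul_of_nonneg_left (b0 _) (norm_nonneg _)

/-- The linear relation between contiguous integrals to which the modified Bessel equation for the
remainder reduces. -/
theorem terminantIntegral_relation {ν : ℂ} {p : ℝ} (hν : |ν.re| < p) {ζ : ℂ}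
    (hζ : |ζ.im| < 3 * Real.pi / 2) :
    -(Complex.exp ζ + ν ^ 2) * terminantIntegral ν p p ζ +
      (2 * Complex.exp ζ - 1) * p * terminantIntegral ν p (p + 1) ζ +
      p * (p + 1) * terminantIntegral ν p (p + 2) ζ =
    (2 * p - 1) * Complex.exp ζ * ∫ u, coshWeight ν p u := by
  have hp : 0 ≤ p := (abs_nonneg _).trans hν.le
  have i0 := integrable_terminantIntegral hν hp hζ
  have i1 := integrable_terminantIntegral hν (p := p + 1) (by linarith) hζ
  have i2 := integrable_terminantIntegral hν (p := p + 2) (by linarith) hζ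
  have iW := integrable_coshWeight hν
  rw [← sub_eq_zero, ← (integral_coshWeight_mul_second_deriv hν hζ).2]
  unfold terminantIntegral
  rw [← integral_const_mul, ← integral_const_mul, ← integral_const_mul, ← integral_const_mul]
  rw [← integral_add (i0.const_mul _) (i1.const_mul _),
    ← integral_add (by exact (i0.const_mul _).add (i1.const_mul _)) (i2.const_mul _),
    ← integral_sub (by exact ((i0.const_mul _).add (i1.const_mul _)).add (i2.const_mul _))
      (iW.const_mul _)]
  congr 1
  funext u
  have r0 := terminantLambda_add_log p ζ u
  have r1 := terminantLambda_add_log (p + 1) ζ u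
  have e2 : (p : ℂ) + 1 + 1 = p + 2 := by ring
  rw [e2] at r1
  rw [div_eq_mul_inv] at r0 r1
  push_cast at r0 r1 ⊢
  have hz : Complex.exp ζ * Complex.exp (-ζ) = 1 := by rw [← Complex.exp_add]; simp
  set c := (1 + Complex.cosh u)⁻¹
  set w := coshWeight ν p u
  set L0 := terminantLambda p (ζ + (Real.log (1 + Real.cosh u) : ℝ))
  set L1 := terminantLambda (p + 1) (ζ + (Real.log (1 + Real.cosh u) : ℝ))
  set L2 := terminantLambda (p + 2) (ζ + (Real.log (1 + Real.cosh u) : ℝ))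
  linear_combination (-w * Complex.exp ζ) * r0 + (2 * w * p * Complex.exp ζ) * r1 +
    (w * p * c * L1 - 2 * w * p * (p + 1) * c * L2) * hz

/-! ### The expansion with integral remainder -/

theorem gamma_mul_gamma_mul_complex_cos (N : ℕ) {x : ℂ} (hx : Complex.cos (Real.pi * x) ≠ 0) :
    Complex.Gamma ((N : ℂ) + 1 / 2 + x) * Complex.Gamma ((N : ℂ) + 1 / 2 - x) *
      Complex.cos (Real.pi * x) =
    Real.pi * ∏ k ∈ Finset.range N, (((k : ℂ) + 1 / 2) ^ 2 - x ^ 2) := by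
  induction N with
  | zero =>
    have h := Complex.Gamma_mul_Gamma_one_sub (1 / 2 + x)
    have h2 : Complex.sin (Real.pi * (1 / 2 + x)) = Complex.cos (Real.pi * x) := by
      rw [← Complex.sin_add_pi_div_two]; congr 1; ring
    rw [h2, show (1 : ℂ) - (1 / 2 + x) = 1 / 2 - x by ring] at h
    simp only [Nat.cast_zero, zero_add, Finset.range_zero, Finset.prod_empty, mul_one, h]
    field_simp
  | succ n ih =>
    have key : ∀ s : ℂ, Complex.cos (Real.pi * s) ≠ 0 → (n : ℂ) + 1 / 2 + s ≠ 0 := by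
      intro s hs h0
      apply hs
      have : s = -((n : ℂ) + 1 / 2) := by linear_combination h0
      rw [this, Complex.cos_eq_zero_iff]
      exact ⟨-(n : ℤ) - 1, by push_cast; ring⟩
    have h1 := key x hx
    have h2 := key (-x) (by rwa [mul_neg, Complex.cos_neg])
    have e1 : ((n + 1 : ℕ) : ℂ) + 1 / 2 + x = ((n : ℂ) + 1 / 2 + x) + 1 := by push_cast; ring
    have e2 : ((n + 1 : ℕ) : ℂ) + 1 / 2 - x = ((n : ℂ) + 1 / 2 + -x) + 1 := by push_cast; ring
    rw [e1, e2, Complex.Gamma_add_one _ h1, Complex.Gamma_add_one _ h2, Finset.prod_range_succ,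
      ← mul_assoc (Real.pi : ℂ), ← ih, ← sub_eq_add_neg]
    ring

theorem coeffA_succ (n : ℕ) (ν : ℂ) :
    coeffA (n + 1) ν * (2 * ((n : ℂ) + 1)) = coeffA n ν * (ν ^ 2 - ((n : ℂ) + 1 / 2) ^ 2) := by
  unfold coeffA
  rw [Finset.prod_range_succ, pow_succ, Nat.factorial_succ]
  have h1 : ((n : ℂ) + 1) ≠ 0 := by exact_mod_cast n.succ_ne_zero
  have h2 : (n.factorial : ℂ) ≠ 0 := by exact_mod_cast n.factorial_ne_zero
  push_cast
  field_simp
  ring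

theorem coeffA_eq_prod (N : ℕ) (ν : ℂ) :
    coeffA N ν * (2 ^ N * N.factorial) =
      (-1) ^ N * ∏ k ∈ Finset.range N, (((k : ℂ) + 1 / 2) ^ 2 - ν ^ 2) := by
  induction N with
  | zero => simp [coeffA]
  | succ n ih =>
    rw [Finset.prod_range_succ, pow_succ, pow_succ, Nat.factorial_succ]
    push_cast
    linear_combination (2 ^ n * (n.factorial : ℂ)) * coeffA_succ n ν +
      (ν ^ 2 - ((n : ℂ) + 1 / 2) ^ 2) * ih

/-- The closed form of `a_N(ν)` in terms of the gamma function. -/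
theorem coeffA_eq_gamma (N : ℕ) {ν : ℂ} (hν : |ν.re| < (N : ℝ) + 1 / 2) :
    coeffA N ν * (Real.pi * (2 ^ N * N.factorial)) = (-1) ^ N * Complex.cos (Real.pi * ν) *
      (Complex.Gamma ((N : ℂ) + 1 / 2 + ν) * Complex.Gamma ((N : ℂ) + 1 / 2 - ν)) := by
  have h := coeffA_eq_prod N ν
  by_cases hc : Complex.cos (Real.pi * ν) = 0
  · have hprod : ∏ k ∈ Finset.range N, (((k : ℂ) + 1 / 2) ^ 2 - ν ^ 2) = 0 := by
      obtain ⟨m, hm⟩ := Complex.cos_eq_zero_iff.mp hc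
      have hpi : (Real.pi : ℂ) ≠ 0 := by exact_mod_cast Real.pi_ne_zero
      have hν' : ν = (m : ℂ) + 1 / 2 := by
        have : (Real.pi : ℂ) * ν = Real.pi * ((m : ℂ) + 1 / 2) := by rw [hm]; ring
        exact mul_left_cancel₀ hpi this
      have hre : ν.re = (m : ℝ) + 1 / 2 := by rw [hν']; simp
      rw [hre] at hν
      obtain ⟨hl, hr⟩ := abs_lt.mp hν
      rw [Finset.prod_eq_zero_iff]
      rcases le_or_gt 0 m with h0 | h0
      · obtain ⟨k, rfl⟩ := Int.eq_ofNat_of_zero_le h0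
        refine ⟨k, Finset.mem_range.mpr ?_, ?_⟩
        · have : (k : ℝ) < N := by push_cast at hr; linarith
          exact_mod_cast this
        · rw [hν']; push_cast; ring
      · obtain ⟨k, hk⟩ := Int.eq_ofNat_of_zero_le (show 0 ≤ -m - 1 by lia)
        have hm' : m = -(k : ℤ) - 1 := by lia
        subst hm'
        refine ⟨k, Finset.mem_range.mpr ?_, ?_⟩
        · have : (k : ℝ) < N := by push_cast at hl; linarith
          exact_mod_cast this
        · rw [hν']; push_cast; ring
    rw [hc, mul_left_comm, h, hprod]
    ring
  · have hg := gamma_mul_gamma_mul_complex_cos N hc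
    linear_combination (Real.pi : ℂ) * h - (-1) ^ N * hg

/-- The constant in the integral representation of the remainder, so normalised that its product with
`∫ e^(νu) (1 + cosh u)^(-N-1/2) du` is `a_N(ν)`. -/
def remainderConst (N : ℕ) (ν : ℂ) : ℂ :=
  (-1) ^ N * Complex.cos (Real.pi * ν) * ((2 * N).factorial : ℂ) /
    (Real.pi * (2 ^ N * N.factorial) * (((2 : ℝ) ^ ((N : ℝ) + 1 / 2) : ℝ) : ℂ))

theorem integral_coshWeight_half (N : ℕ) {ν : ℂ} (hν : |ν.re| < (N : ℝ) + 1 / 2) :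
    (∫ u, coshWeight ν ((N : ℝ) + 1 / 2) u) * ((2 * N).factorial : ℂ) =
      (((2 : ℝ) ^ ((N : ℝ) + 1 / 2) : ℝ) : ℂ) *
        (Complex.Gamma ((N : ℂ) + 1 / 2 + ν) * Complex.Gamma ((N : ℂ) + 1 / 2 - ν)) := by
  have h := integral_coshWeight hν
  rw [show (2 : ℂ) * (((N : ℝ) + 1 / 2 : ℝ) : ℂ) = ((2 * N : ℕ) : ℂ) + 1 by push_cast; ring,
    Complex.Gamma_nat_eq_factorial] at h
  rw [h]
  push_cast
  ring

theorem remainderConst_mul_integral (N : ℕ) {ν : ℂ} (hν : |ν.re| < (N : ℝ) + 1 / 2) :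
    remainderConst N ν * ∫ u, coshWeight ν ((N : ℝ) + 1 / 2) u = coeffA N ν := by
  have h1 := integral_coshWeight_half N hν
  have h2 := coeffA_eq_gamma N hν
  have hpi : (Real.pi : ℂ) ≠ 0 := by exact_mod_cast Real.pi_ne_zero
  have h3 : (N.factorial : ℂ) ≠ 0 := by exact_mod_cast N.factorial_ne_zero
  have h4 : (((2 : ℝ) ^ ((N : ℝ) + 1 / 2) : ℝ) : ℂ) ≠ 0 := by
    exact_mod_cast (Real.rpow_pos_of_pos two_pos _).ne'
  unfold remainderConst
  rw [div_mul_eq_mul_div, div_eq_iff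
    (mul_ne_zero (mul_ne_zero hpi (mul_ne_zero (pow_ne_zero _ two_ne_zero) h3)) h4)]
  linear_combination ((-1) ^ N * Complex.cos (Real.pi * ν)) * h1 -
    (((2 : ℝ) ^ ((N : ℝ) + 1 / 2) : ℝ) : ℂ) * h2

theorem norm_integral_coshWeight_mul_le {ν : ℂ} {s : ℝ} (hν : |ν.re| < s) {g : ℝ → ℂ} {M : ℝ}
    (hM : ∀ u, ‖g u‖ ≤ M) :
    ‖∫ u, coshWeight ν s u * g u‖ ≤ (∫ u, ‖coshWeight ν s u‖) * M := by
  rw [← integral_mul_const]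
  refine norm_integral_le_of_norm_le ((integrable_coshWeight hν).norm.mul_const M)
    (Eventually.of_forall fun u => ?_)
  rw [norm_mul]
  exact mul_le_mul_of_nonneg_left (hM u) (norm_nonneg _)

/-- The truncated expansion of `K_ν` with integral remainder, without the factor `(π/2)^(1/2)`. -/
def hankelExpansion (N : ℕ) (ν ζ : ℂ) : ℂ :=
  ∑ n ∈ Finset.range N, coeffA n ν * Complex.exp (-Complex.exp ζ - ((n : ℂ) + 1 / 2) * ζ) +
    remainderConst N ν * (Complex.exp (-Complex.exp ζ - ((N : ℂ) + 1 / 2) * ζ) *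
      terminantIntegral ν ((N : ℝ) + 1 / 2) ((N : ℝ) + 1 / 2) ζ)

/-- The derivative of `hankelExpansion`. -/
def hankelExpansionDeriv (N : ℕ) (ν ζ : ℂ) : ℂ :=
  ∑ n ∈ Finset.range N, coeffA n ν * (-(Complex.exp ζ + ((n : ℂ) + 1 / 2)) *
      Complex.exp (-Complex.exp ζ - ((n : ℂ) + 1 / 2) * ζ)) +
    remainderConst N ν * (Complex.exp (-Complex.exp ζ - ((N : ℂ) + 1 / 2) * ζ) *
      (-(Complex.exp ζ + ((N : ℂ) + 1 / 2)) *
          terminantIntegral ν ((N : ℝ) + 1 / 2) ((N : ℝ) + 1 / 2) ζ +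
        ((N : ℂ) + 1 / 2) * (terminantIntegral ν ((N : ℝ) + 1 / 2) ((N : ℝ) + 1 / 2) ζ -
          terminantIntegral ν ((N : ℝ) + 1 / 2) ((N : ℝ) + 1 / 2 + 1) ζ)))

theorem hasDerivAt_exp_neg_exp_sub (s ζ : ℂ) :
    HasDerivAt (fun ζ => Complex.exp (-Complex.exp ζ - s * ζ))
      (-(Complex.exp ζ + s) * Complex.exp (-Complex.exp ζ - s * ζ)) ζ := by
  have h := ((Complex.hasDerivAt_exp ζ).neg.sub ((hasDerivAt_id ζ).const_mul s)).cexp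
  refine h.congr_deriv ?_
  simp only [Pi.sub_apply, Pi.neg_apply, id]
  ring

theorem hasDerivAt_hankelExpansion {N : ℕ} {ν : ℂ} (hν : |ν.re| < (N : ℝ) + 1 / 2) {ζ : ℂ}
    (hζ : |ζ.im| < 3 * Real.pi / 2) :
    HasDerivAt (hankelExpansion N ν) (hankelExpansionDeriv N ν ζ) ζ := by
  have hp : (0 : ℝ) ≤ (N : ℝ) + 1 / 2 := by positivity
  have h1 : HasDerivAt (fun ζ => ∑ n ∈ Finset.range N,
      coeffA n ν * Complex.exp (-Complex.exp ζ - ((n : ℂ) + 1 / 2) * ζ)) _ ζ :=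
    HasDerivAt.fun_sum fun n _ => (hasDerivAt_exp_neg_exp_sub ((n : ℂ) + 1 / 2) ζ).const_mul
      (coeffA n ν)
  have h2 := (((hasDerivAt_exp_neg_exp_sub ((N : ℂ) + 1 / 2) ζ).mul
    (hasDerivAt_terminantIntegral hν hp hζ)).const_mul (remainderConst N ν))
  refine (h1.add h2).congr_deriv ?_
  unfold hankelExpansionDeriv
  push_cast
  ring

/-- The modified Bessel operator applied to the truncated expansion telescopes to a single term. -/
theorem sum_modified_bessel (N : ℕ) (ν ζ : ℂ) :
    ∑ n ∈ Finset.range N, coeffA n ν * ((((Complex.exp ζ + ((n : ℂ) + 1 / 2)) ^ 2 -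
        Complex.exp ζ) - (Complex.exp ζ ^ 2 + ν ^ 2)) *
        Complex.exp (-Complex.exp ζ - ((n : ℂ) + 1 / 2) * ζ)) =
      -(2 * N * coeffA N ν * Complex.exp ζ *
        Complex.exp (-Complex.exp ζ - ((N : ℂ) + 1 / 2) * ζ)) := by
  induction N with
  | zero => simp
  | succ n ih =>
    rw [Finset.sum_range_succ, ih]
    have h1 : Complex.exp (-Complex.exp ζ - ((n : ℂ) + 1 / 2) * ζ) =
        Complex.exp ζ * Complex.exp (-Complex.exp ζ - (((n + 1 : ℕ) : ℂ) + 1 / 2) * ζ) := by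
      rw [← Complex.exp_add]; congr 1; push_cast; ring
    rw [h1]
    push_cast
    linear_combination (Complex.exp ζ *
      Complex.exp (-Complex.exp ζ - ((n + 1 : ℂ) + 1 / 2) * ζ)) * coeffA_succ n ν

/-- The expansion solves the modified Bessel equation `(z d/dz)² y = (z² + ν²) y`. -/
theorem hasDerivAt_hankelExpansionDeriv {N : ℕ} {ν : ℂ} (hν : |ν.re| < (N : ℝ) + 1 / 2) {ζ : ℂ}
    (hζ : |ζ.im| < 3 * Real.pi / 2) :
    HasDerivAt (hankelExpansionDeriv N ν)
      ((Complex.exp ζ ^ 2 + ν ^ 2) * hankelExpansion N ν ζ) ζ := by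
  have hp : (0 : ℝ) ≤ (N : ℝ) + 1 / 2 := by positivity
  have he : ∀ s : ℂ, HasDerivAt (fun ζ => -(Complex.exp ζ + s)) (-Complex.exp ζ) ζ := fun s =>
    ((Complex.hasDerivAt_exp ζ).add_const s).neg
  have h1 : HasDerivAt (fun ζ => ∑ n ∈ Finset.range N,
      coeffA n ν * (-(Complex.exp ζ + ((n : ℂ) + 1 / 2)) *
        Complex.exp (-Complex.exp ζ - ((n : ℂ) + 1 / 2) * ζ))) _ ζ :=
    HasDerivAt.fun_sum fun n _ => ((he ((n : ℂ) + 1 / 2)).mul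
      (hasDerivAt_exp_neg_exp_sub ((n : ℂ) + 1 / 2) ζ)).const_mul (coeffA n ν)
  have d0 := hasDerivAt_terminantIntegral hν hp hζ
  have d1 := hasDerivAt_terminantIntegral hν (p := (N : ℝ) + 1 / 2 + 1) (by linarith) hζ
  have h2 := ((hasDerivAt_exp_neg_exp_sub ((N : ℂ) + 1 / 2) ζ).mul
    (((he ((N : ℂ) + 1 / 2)).mul d0).add
      ((d0.sub d1).const_mul ((N : ℂ) + 1 / 2)))).const_mul (remainderConst N ν)
  refine (h1.add h2).congr_deriv ?_
  have hS := sum_modified_bessel N ν ζ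
  have hT := terminantIntegral_relation hν hζ
  have hW := remainderConst_mul_integral N hν
  unfold hankelExpansion
  have e1 : (N : ℝ) + 1 / 2 + 1 + 1 = (N : ℝ) + 1 / 2 + 2 := by ring
  rw [e1]
  simp only [Pi.mul_apply, Pi.add_apply, Pi.sub_apply]
  set T0 := terminantIntegral ν ((N : ℝ) + 1 / 2) ((N : ℝ) + 1 / 2) ζ
  set T1 := terminantIntegral ν ((N : ℝ) + 1 / 2) ((N : ℝ) + 1 / 2 + 1) ζ
  set T2 := terminantIntegral ν ((N : ℝ) + 1 / 2) ((N : ℝ) + 1 / 2 + 2) ζ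
  set e := Complex.exp (-Complex.exp ζ - ((N : ℂ) + 1 / 2) * ζ)
  have hsum : ∑ n ∈ Finset.range N, coeffA n ν * (-Complex.exp ζ *
        Complex.exp (-Complex.exp ζ - ((n : ℂ) + 1 / 2) * ζ) +
        -(Complex.exp ζ + ((n : ℂ) + 1 / 2)) * (-(Complex.exp ζ + ((n : ℂ) + 1 / 2)) *
        Complex.exp (-Complex.exp ζ - ((n : ℂ) + 1 / 2) * ζ))) =
      (Complex.exp ζ ^ 2 + ν ^ 2) * ∑ n ∈ Finset.range N,
        coeffA n ν * Complex.exp (-Complex.exp ζ - ((n : ℂ) + 1 / 2) * ζ) -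
      (2 * N * coeffA N ν * Complex.exp ζ * e) := by
    rw [sub_eq_add_neg, ← hS, Finset.mul_sum, ← Finset.sum_add_distrib]
    refine Finset.sum_congr rfl fun n _ => ?_
    ring
  rw [hsum, ← hW]
  push_cast at hT ⊢
  linear_combination (remainderConst N ν * e) * hT

/-! ### Asymptotics of the expansion on the positive real axis -/

theorem tendsto_exp_neg_exp_sub (s : ℂ) :
    Tendsto (fun x : ℝ => Complex.exp (-Complex.exp x - s * x)) atTop (𝓝 0) := by
  rw [tendsto_zero_iff_norm_tendsto_zero]
  refine (tendsto_exp_mul_exp_neg_exp (-s.re) one_pos).congr fun x => ?_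
  rw [Complex.norm_exp, ← Real.exp_add]
  congr 1
  simp [Complex.exp_ofReal_re]
  ring

theorem isBoundedUnder_norm_terminantIntegral {ν : ℂ} {s p : ℝ} (hν : |ν.re| < s) (hp : 0 ≤ p) :
    IsBoundedUnder (· ≤ ·) atTop (norm ∘ fun x : ℝ => terminantIntegral ν s p (x : ℂ)) := by
  refine isBoundedUnder_of ⟨(∫ u, ‖coshWeight ν s u‖) * 1, fun x => ?_⟩
  refine norm_integral_coshWeight_mul_le hν fun u => ?_
  have := norm_terminantLambda_add_ofReal_le hp (ζ := (x : ℂ))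
    (by simpa using (by positivity : 0 < 3 * Real.pi / 2)) (Real.log (1 + Real.cosh u))
  simpa using this

theorem tendsto_hankelExpansion {N : ℕ} {ν : ℂ} (hν : |ν.re| < (N : ℝ) + 1 / 2) :
    Tendsto (fun x : ℝ => hankelExpansion N ν x) atTop (𝓝 0) := by
  have hp : (0 : ℝ) ≤ (N : ℝ) + 1 / 2 := by positivity
  unfold hankelExpansion
  have h1 : Tendsto (fun x : ℝ => ∑ n ∈ Finset.range N,
      coeffA n ν * Complex.exp (-Complex.exp x - ((n : ℂ) + 1 / 2) * x)) atTop
      (𝓝 (∑ n ∈ Finset.range N, coeffA n ν * 0)) :=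
    tendsto_finsetSum _ fun n _ => (tendsto_exp_neg_exp_sub _).const_mul _
  have h2 := ((tendsto_exp_neg_exp_sub ((N : ℂ) + 1 / 2)).zero_mul_isBoundedUnder_le
    (isBoundedUnder_norm_terminantIntegral hν hp)).const_mul (remainderConst N ν)
  simpa using h1.add h2

theorem tendsto_hankelExpansionDeriv {N : ℕ} {ν : ℂ} (hν : |ν.re| < (N : ℝ) + 1 / 2) :
    Tendsto (fun x : ℝ => hankelExpansionDeriv N ν x) atTop (𝓝 0) := by
  have hp : (0 : ℝ) ≤ (N : ℝ) + 1 / 2 := by positivity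
  have he : ∀ s : ℂ, Tendsto (fun x : ℝ => -(Complex.exp x + s) *
      Complex.exp (-Complex.exp x - s * x)) atTop (𝓝 0) := by
    intro s
    have h := ((tendsto_exp_neg_exp_sub (s - 1)).add
      ((tendsto_exp_neg_exp_sub s).const_mul s)).neg
    simp only [mul_zero, add_zero, neg_zero] at h
    refine h.congr fun x => ?_
    have : Complex.exp (-Complex.exp x - (s - 1) * x) =
        Complex.exp x * Complex.exp (-Complex.exp x - s * x) := by
      rw [← Complex.exp_add]; ring_nf
    rw [this]; ring
  have h1 : Tendsto (fun x : ℝ => ∑ n ∈ Finset.range N,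
      coeffA n ν * (-(Complex.exp x + ((n : ℂ) + 1 / 2)) *
        Complex.exp (-Complex.exp x - ((n : ℂ) + 1 / 2) * x))) atTop
      (𝓝 (∑ n ∈ Finset.range N, coeffA n ν * 0)) :=
    tendsto_finsetSum _ fun n _ => (he _).const_mul _
  have b0 := isBoundedUnder_norm_terminantIntegral hν hp
  have b1 := isBoundedUnder_norm_terminantIntegral hν (p := (N : ℝ) + 1 / 2 + 1) (by linarith)
  have h2 := (he ((N : ℂ) + 1 / 2)).zero_mul_isBoundedUnder_le b0
  have h3 := (tendsto_exp_neg_exp_sub ((N : ℂ) + 1 / 2)).zero_mul_isBoundedUnder_le b0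
  have h4 := (tendsto_exp_neg_exp_sub ((N : ℂ) + 1 / 2)).zero_mul_isBoundedUnder_le b1
  have h5 := (h2.add ((h3.sub h4).const_mul ((N : ℂ) + 1 / 2))).const_mul (remainderConst N ν)
  have h6 := h1.add h5
  simp only [mul_zero, Finset.sum_const_zero, sub_zero, add_zero] at h6
  refine h6.congr fun x => ?_
  unfold hankelExpansionDeriv
  ring

/-- `z^(1/2) e^z` times the expansion tends to `a_0 = 1`; the contiguous relation turns the remainder
into the term `n = N` plus a remainder with an additional factor `1/z`. -/
theorem tendsto_exp_mul_hankelExpansion {N : ℕ} {ν : ℂ} (hν : |ν.re| < (N : ℝ) + 1 / 2) :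
    Tendsto (fun x : ℝ => Complex.exp (Complex.exp x + x / 2) * hankelExpansion N ν x) atTop
      (𝓝 1) := by
  have hp : (0 : ℝ) ≤ (N : ℝ) + 1 / 2 := by positivity
  have hpow : ∀ n : ℕ, Tendsto (fun x : ℝ => Complex.exp (-((n + 1 : ℕ) : ℂ) * x)) atTop (𝓝 0) := by
    intro n
    rw [tendsto_zero_iff_norm_tendsto_zero]
    have h : Tendsto (fun x : ℝ => -((n : ℝ) + 1) * x) atTop atBot :=
      tendsto_id.const_mul_atTop_of_neg (by linarith [Nat.cast_nonneg (α := ℝ) n])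
    refine (Real.tendsto_exp_atBot.comp h).congr fun x => ?_
    rw [Complex.norm_exp]
    simp
  have h1 : Tendsto (fun x : ℝ => ∑ n ∈ Finset.range N,
      coeffA (n + 1) ν * Complex.exp (-((n + 1 : ℕ) : ℂ) * x)) atTop
      (𝓝 (∑ n ∈ Finset.range N, coeffA (n + 1) ν * 0)) :=
    tendsto_finsetSum _ fun n _ => (hpow n).const_mul _
  have h2 := ((hpow N).zero_mul_isBoundedUnder_le
    (isBoundedUnder_norm_terminantIntegral (ν := ν) (s := (N : ℝ) + 1 / 2 + 1)
      (p := (N : ℝ) + 1 / 2 + 1) (by linarith) (by linarith))).const_mul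
      (-(remainderConst N ν * ((N : ℂ) + 1 / 2)))
  have h3 := (h1.add h2).const_add 1
  simp only [mul_zero, Finset.sum_const_zero, add_zero] at h3
  refine h3.congr fun x => ?_
  have hT := terminantIntegral_eq_sub hν hp (ζ := (x : ℂ))
    (by simpa using (by positivity : 0 < 3 * Real.pi / 2))
  have hW := remainderConst_mul_integral N hν
  have he : ∀ n : ℕ, Complex.exp (Complex.exp x + x / 2) *
      Complex.exp (-Complex.exp x - ((n : ℂ) + 1 / 2) * x) = Complex.exp (-(n : ℂ) * x) := by
    intro n; rw [← Complex.exp_add]; ring_nf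
  have hs : ∑ n ∈ Finset.range N, coeffA (n + 1) ν * Complex.exp (-((n + 1 : ℕ) : ℂ) * x) =
      ∑ n ∈ Finset.range N, coeffA n ν * Complex.exp (-(n : ℂ) * x) +
        coeffA N ν * Complex.exp (-(N : ℂ) * x) - 1 := by
    rw [← Finset.sum_range_succ, Finset.sum_range_succ']
    simp [coeffA]
  unfold hankelExpansion
  rw [mul_add (Complex.exp (Complex.exp x + x / 2)), Finset.mul_sum, hs]
  have hs2 : ∑ n ∈ Finset.range N, Complex.exp (Complex.exp x + x / 2) *
      (coeffA n ν * Complex.exp (-Complex.exp x - ((n : ℂ) + 1 / 2) * x)) =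
      ∑ n ∈ Finset.range N, coeffA n ν * Complex.exp (-(n : ℂ) * x) :=
    Finset.sum_congr rfl fun n _ => by rw [mul_left_comm, he]
  have he1 : Complex.exp (-((N + 1 : ℕ) : ℂ) * x) =
      Complex.exp (-(N : ℂ) * x) * Complex.exp (-x) := by
    rw [← Complex.exp_add]; push_cast; ring_nf
  rw [hs2, hT, he1, ← hW]
  push_cast
  linear_combination (-remainderConst N ν * ((∫ u, coshWeight ν ((N : ℝ) + 1 / 2) u) -
    ((N : ℂ) + 1 / 2) * Complex.exp (-x) *
      terminantIntegral ν ((N : ℝ) + 1 / 2 + 1) ((N : ℝ) + 1 / 2 + 1) x)) * he N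

/-! ### The series of the modified Bessel function of the first kind -/

/-- `1 / Γ(ν + k + 1)` is bounded uniformly in `k` and in `ν` from a bounded set. -/
theorem exists_norm_inv_Gamma_le (R : ℝ) :
    ∃ M : ℝ, 0 ≤ M ∧ ∀ (k : ℕ) (ν : ℂ), ‖ν‖ ≤ R → ‖(Complex.Gamma (ν + k + 1))⁻¹‖ ≤ M := by
  have hB : ∀ k : ℕ, ∃ B : ℝ, ∀ ν : ℂ, ‖ν‖ ≤ R → ‖(Complex.Gamma (ν + k + 1))⁻¹‖ ≤ B := by
    intro k
    have hc : Continuous fun ν : ℂ => (Complex.Gamma (ν + k + 1))⁻¹ :=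
      Complex.differentiable_one_div_Gamma.continuous.comp (by fun_prop)
    obtain ⟨B, hB⟩ := (isCompact_closedBall (0 : ℂ) R).exists_bound_of_continuousOn hc.continuousOn
    exact ⟨B, fun ν hν => hB ν (by simpa using hν)⟩
  choose B hB using hB
  obtain ⟨K, hK⟩ := exists_nat_ge R
  have hle : ∀ k ≤ K, B k ≤ ∑ j ∈ Finset.range (K + 1), |B j| := fun k hk =>
    (le_abs_self _).trans (Finset.single_le_sum (f := fun j => |B j|) (fun _ _ => abs_nonneg _)
      (Finset.mem_range.mpr (by lia)))
  refine ⟨∑ j ∈ Finset.range (K + 1), |B j|, Finset.sum_nonneg fun _ _ => abs_nonneg _,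
    fun k ν hν => ?_⟩
  rcases le_total k K with hk | hk
  · exact (hB k ν hν).trans (hle k hk)
  · induction k, hk using Nat.le_induction with
    | base => exact (hB K ν hν).trans (hle K le_rfl)
    | succ m hm ih =>
      refine le_trans ?_ ih
      rw [Complex.one_div_Gamma_eq_self_mul_one_div_Gamma_add_one (ν + m + 1), norm_mul,
        show ν + ((m + 1 : ℕ) : ℂ) + 1 = ν + m + 1 + 1 by push_cast; ring]
      refine le_mul_of_one_le_left (norm_nonneg _) ?_
      have h1 : ((m : ℝ) + 1) ≤ ‖ν + m + 1‖ + ‖ν‖ := by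
        have h2 : ((m : ℂ) + 1) = (ν + m + 1) - ν := by ring
        have h3 : ‖(m : ℂ) + 1‖ = (m : ℝ) + 1 := by
          rw [show (m : ℂ) + 1 = ((m + 1 : ℕ) : ℂ) by push_cast; rfl, Complex.norm_natCast]
          push_cast; rfl
        rw [← h3, h2]
        exact norm_sub_le _ _
      have h4 : (K : ℝ) ≤ m := by exact_mod_cast hm
      linarith

/-- The `k`-th term of the series of `I_ν`. -/
def besselITerm (ν ζ : ℂ) (k : ℕ) : ℂ :=
  Complex.exp ((ν + 2 * (k : ℂ)) * (ζ - (Real.log 2 : ℂ))) *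
    ((k.factorial : ℂ) * Complex.Gamma (ν + (k : ℂ) + 1))⁻¹

theorem besselI_eq_tsum (ν ζ : ℂ) : besselI ν ζ = ∑' k, besselITerm ν ζ k := rfl

/-- A bound for the terms of the series of `I_ν(z)` and their derivatives, uniform on bounded sets
of orders and of logarithmic coordinates. -/
theorem exists_summable_bound_besselITerm (R : ℝ) :
    ∃ b : ℕ → ℝ, Summable b ∧ ∀ (k : ℕ) (ν ζ : ℂ), ‖ν‖ ≤ R → ‖ζ‖ ≤ R →
      ‖besselITerm ν ζ k‖ ≤ b k ∧ ‖(ν + 2 * (k : ℂ)) * besselITerm ν ζ k‖ ≤ b k := by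
  rcases lt_or_ge R 0 with hR | hR
  · exact ⟨0, summable_zero, fun k ν ζ h => absurd (norm_nonneg ν) (by linarith)⟩
  obtain ⟨M, hM0, hM⟩ := exists_norm_inv_Gamma_le R
  set S := R + Real.log 2 with hS
  have hlog : 0 ≤ Real.log 2 := Real.log_nonneg one_le_two
  refine ⟨fun k => (R + 2) * (Real.exp (R * S) * M) * ((2 * Real.exp (2 * S)) ^ k / k.factorial),
    (Real.summable_pow_div_factorial _).mul_left _, fun k ν ζ hν hζ => ?_⟩
  have hξ : ‖ζ - (Real.log 2 : ℂ)‖ ≤ S := by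
    refine (norm_sub_le _ _).trans ?_
    rw [Complex.norm_real, Real.norm_eq_abs, abs_of_nonneg hlog]
    linarith
  have hk : (k : ℝ) ≤ 2 ^ k := by exact_mod_cast k.lt_two_pow_self.le
  have h2k : (1 : ℝ) ≤ 2 ^ k := one_le_pow₀ one_le_two
  have h2 : ‖ν + 2 * (k : ℂ)‖ ≤ R + 2 * k := by
    refine (norm_add_le _ _).trans ?_
    rw [norm_mul, Complex.norm_ofNat, Complex.norm_natCast]
    linarith
  have hT : ‖besselITerm ν ζ k‖ ≤ Real.exp (R * S) * M * (Real.exp (2 * S) ^ k / k.factorial) := by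
    unfold besselITerm
    rw [norm_mul, mul_inv, norm_mul, norm_inv, Complex.norm_natCast]
    have h1 : ‖Complex.exp ((ν + 2 * (k : ℂ)) * (ζ - (Real.log 2 : ℂ)))‖ ≤
        Real.exp (R * S) * Real.exp (2 * S) ^ k := by
      refine (Complex.norm_exp_le_exp_norm _).trans ?_
      rw [← Real.exp_nat_mul, ← Real.exp_add, norm_mul]
      apply Real.exp_le_exp.mpr
      calc _ ≤ (R + 2 * k) * S := by gcongr
        _ = _ := by ring
    calc _ ≤ (Real.exp (R * S) * Real.exp (2 * S) ^ k) * ((k.factorial : ℝ)⁻¹ * M) := by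
          gcongr
          exact hM k ν hν
      _ = _ := by ring
  have hA : 0 ≤ Real.exp (R * S) * M * (Real.exp (2 * S) ^ k / k.factorial) := by positivity
  have hb : (R + 2) * (Real.exp (R * S) * M) * ((2 * Real.exp (2 * S)) ^ k / k.factorial) =
      ((R + 2) * 2 ^ k) * (Real.exp (R * S) * M * (Real.exp (2 * S) ^ k / k.factorial)) := by
    rw [mul_pow]; ring
  simp only [hb]
  refine ⟨hT.trans (le_mul_of_one_le_left hA (by nlinarith)), ?_⟩
  rw [norm_mul]
  refine mul_le_mul (h2.trans ?_) hT (norm_nonneg _) (by positivity)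
  nlinarith

theorem summable_besselITerm (ν ζ : ℂ) : Summable (besselITerm ν ζ) := by
  obtain ⟨b, hb, h⟩ := exists_summable_bound_besselITerm (max ‖ν‖ ‖ζ‖)
  exact Summable.of_norm_bounded hb fun k => (h k ν ζ (le_max_left _ _) (le_max_right _ _)).1

theorem summable_mul_besselITerm (ν ζ : ℂ) :
    Summable fun k : ℕ => (ν + 2 * (k : ℂ)) * besselITerm ν ζ k := by
  obtain ⟨b, hb, h⟩ := exists_summable_bound_besselITerm (max ‖ν‖ ‖ζ‖)
  exact Summable.of_norm_bounded hb fun k => (h k ν ζ (le_max_left _ _) (le_max_right _ _)).2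

theorem hasDerivAt_besselI (ν ζ : ℂ) :
    HasDerivAt (besselI ν) (∑' k : ℕ, (ν + 2 * (k : ℂ)) * besselITerm ν ζ k) ζ := by
  set R := max ‖ν‖ (‖ζ‖ + 1)
  obtain ⟨b, hb, h⟩ := exists_summable_bound_besselITerm R
  have hR : ‖ζ‖ < R := lt_of_lt_of_le (by linarith) (le_max_right _ _)
  refine hasDerivAt_tsum_of_isPreconnected (t := Metric.ball (0 : ℂ) R) (y₀ := ζ)
    (g := fun k ζ => besselITerm ν ζ k)
    (g' := fun k ζ => (ν + 2 * (k : ℂ)) * besselITerm ν ζ k) hb Metric.isOpen_ball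
    (convex_ball (0 : ℂ) R).isPreconnected ?_ ?_ (by simpa using hR) (summable_besselITerm ν ζ)
    (by simpa using hR)
  · intro k w _
    have h1 : HasDerivAt (fun w : ℂ => (ν + 2 * (k : ℂ)) * (w - (Real.log 2 : ℂ)))
        (ν + 2 * (k : ℂ)) w := by
      simpa using ((hasDerivAt_id w).sub_const (Real.log 2 : ℂ)).const_mul (ν + 2 * (k : ℂ))
    refine (h1.cexp.mul_const _).congr_deriv ?_
    unfold besselITerm
    ring
  · intro k w hw
    exact (h k ν w (le_max_left _ _) (by simpa using (mem_ball_zero_iff.mp hw).le)).2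

theorem exp_sub_log_two (ζ : ℂ) :
    2 * Complex.exp (ζ - (Real.log 2 : ℂ)) = Complex.exp ζ := by
  have h : Complex.exp (Real.log 2 : ℂ) = 2 := by
    rw [← Complex.ofReal_exp, Real.exp_log two_pos]; norm_num
  rw [Complex.exp_sub, h]
  ring

/-- `z I_ν' = ν I_ν + z I_(ν+1)`. -/
theorem hasDerivAt_besselI_add_one (ν ζ : ℂ) :
    HasDerivAt (besselI ν) (ν * besselI ν ζ + Complex.exp ζ * besselI (ν + 1) ζ) ζ := by
  refine (hasDerivAt_besselI ν ζ).congr_deriv ?_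
  have hs : Summable fun k : ℕ => 2 * (k : ℂ) * besselITerm ν ζ k := by
    refine ((summable_mul_besselITerm ν ζ).sub ((summable_besselITerm ν ζ).mul_left ν)).congr
      fun k => ?_
    ring
  have h1 : ∑' k : ℕ, (ν + 2 * (k : ℂ)) * besselITerm ν ζ k =
      ν * besselI ν ζ + ∑' k : ℕ, 2 * (k : ℂ) * besselITerm ν ζ k := by
    rw [besselI_eq_tsum, ← tsum_mul_left, ← ((summable_besselITerm ν ζ).mul_left ν).tsum_add hs]
    exact tsum_congr fun k => by ring
  rw [h1, hs.tsum_eq_zero_add, besselI_eq_tsum (ν + 1), ← tsum_mul_left]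
  simp only [Nat.cast_zero, mul_zero, zero_mul, zero_add]
  congr 1
  refine tsum_congr fun k => ?_
  unfold besselITerm
  have e1 : (ν + 2 * ((k + 1 : ℕ) : ℂ)) * (ζ - (Real.log 2 : ℂ)) =
      (ζ - (Real.log 2 : ℂ)) + (ν + 1 + 2 * (k : ℂ)) * (ζ - (Real.log 2 : ℂ)) := by
    push_cast; ring
  have e2 : ν + ((k + 1 : ℕ) : ℂ) + 1 = ν + 1 + k + 1 := by push_cast; ring
  rw [e1, e2, Complex.exp_add, ← exp_sub_log_two ζ, Nat.factorial_succ]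
  have h3 : ((k : ℂ) + 1) ≠ 0 := by exact_mod_cast k.succ_ne_zero
  push_cast
  rw [mul_inv, mul_inv, mul_inv]
  field_simp

/-- `z I_ν' = -ν I_ν + z I_(ν-1)`. -/
theorem hasDerivAt_besselI_sub_one (ν ζ : ℂ) :
    HasDerivAt (besselI ν) (-ν * besselI ν ζ + Complex.exp ζ * besselI (ν - 1) ζ) ζ := by
  refine (hasDerivAt_besselI ν ζ).congr_deriv ?_
  rw [besselI_eq_tsum, besselI_eq_tsum, ← tsum_mul_left, ← tsum_mul_left,
    ← ((summable_besselITerm ν ζ).mul_left (-ν)).tsum_add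
      ((summable_besselITerm (ν - 1) ζ).mul_left _)]
  refine tsum_congr fun k => ?_
  unfold besselITerm
  have e1 : (ν + 2 * (k : ℂ)) * (ζ - (Real.log 2 : ℂ)) =
      (ζ - (Real.log 2 : ℂ)) + (ν - 1 + 2 * (k : ℂ)) * (ζ - (Real.log 2 : ℂ)) := by
    ring
  have e2 : ν - 1 + (k : ℂ) + 1 = ν + k := by ring
  rw [e1, e2, Complex.exp_add, ← exp_sub_log_two ζ, mul_inv, mul_inv,
    Complex.one_div_Gamma_eq_self_mul_one_div_Gamma_add_one (ν + k)]
  ring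

theorem continuous_besselI_order (ζ : ℂ) : Continuous fun ν => besselI ν ζ := by
  rw [continuous_iff_continuousAt]
  intro ν
  set R := max (‖ν‖ + 1) ‖ζ‖
  obtain ⟨b, hb, h⟩ := exists_summable_bound_besselITerm R
  have hR : ‖ν‖ < R := lt_of_lt_of_le (by linarith) (le_max_left _ _)
  have hc : ContinuousOn (fun ν => ∑' k, besselITerm ν ζ k) (Metric.ball (0 : ℂ) R) := by
    refine continuousOn_tsum (u := b) (fun k => Continuous.continuousOn ?_) hb fun k μ hμ =>
      (h k μ ζ (mem_ball_zero_iff.mp hμ).le (le_max_right _ _)).1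
    have hg : Continuous fun ν : ℂ => (Complex.Gamma (ν + k + 1))⁻¹ :=
      Complex.differentiable_one_div_Gamma.continuous.comp (by fun_prop)
    unfold besselITerm
    simp only [mul_inv]
    fun_prop
  exact hc.continuousAt (Metric.isOpen_ball.mem_nhds (by simpa using hR))

/-- The leading behaviour of `I_ν(z)` as `z → 0`. -/
theorem tendsto_exp_mul_besselI (ν : ℂ) :
    Tendsto (fun x : ℝ => Complex.exp (-ν * x) * besselI ν x) atBot
      (𝓝 (Complex.exp (-ν * (Real.log 2 : ℂ)) * (Complex.Gamma (ν + 1))⁻¹)) := by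
  obtain ⟨b, hb, h⟩ := exists_summable_bound_besselITerm (max ‖ν‖ 0)
  have hterm : ∀ (x : ℝ) (k : ℕ), Complex.exp (-ν * x) * besselITerm ν x k =
      Complex.exp (2 * (k : ℂ) * x) * besselITerm ν 0 k := by
    intro x k
    unfold besselITerm
    rw [← mul_assoc, ← mul_assoc, ← Complex.exp_add, ← Complex.exp_add]
    ring_nf
  have hlim : Tendsto (fun x : ℝ => ∑' k : ℕ, Complex.exp (2 * (k : ℂ) * x) * besselITerm ν 0 k)
      atBot (𝓝 (∑' k : ℕ, if k = 0 then besselITerm ν 0 0 else 0)) := by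
    refine tendsto_tsum_of_dominated_convergence hb (fun k => ?_) ?_
    · rcases Nat.eq_zero_or_pos k with rfl | hk
      · simp
      · rw [if_neg hk.ne', tendsto_zero_iff_norm_tendsto_zero]
        have hk' : (0 : ℝ) < k := by exact_mod_cast hk
        have h1 : Tendsto (fun x : ℝ => 2 * (k : ℝ) * x) atBot atBot :=
          tendsto_id.const_mul_atBot (by positivity)
        have h2 := (Real.tendsto_exp_atBot.comp h1).mul_const ‖besselITerm ν 0 k‖
        rw [zero_mul] at h2
        refine h2.congr fun x => ?_
        rw [norm_mul, Complex.norm_exp]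
        simp
    · filter_upwards [eventually_le_atBot (0 : ℝ)] with x hx k
      rw [norm_mul, Complex.norm_exp]
      refine (mul_le_of_le_one_left (norm_nonneg _) ?_).trans
        (h k ν 0 (le_max_left _ _) (by simp)).1
      rw [Real.exp_le_one_iff]
      simp only [Complex.mul_re, Complex.re_ofNat, Complex.natCast_re, Complex.im_ofNat,
        Complex.natCast_im, Complex.ofReal_re, Complex.ofReal_im, mul_zero, sub_zero]
      have : (0 : ℝ) ≤ 2 * k := by positivity
      exact mul_nonpos_of_nonneg_of_nonpos this hx
  rw [tsum_ite_eq] at hlim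
  have h0 : besselITerm ν 0 0 = Complex.exp (-ν * (Real.log 2 : ℂ)) * (Complex.Gamma (ν + 1))⁻¹ := by
    simp [besselITerm]
  rw [h0] at hlim
  refine hlim.congr fun x => ?_
  rw [besselI_eq_tsum, ← tsum_mul_left]
  exact tsum_congr fun k => (hterm x k).symm

/-! ### The integral of Macdonald's function on the positive real axis -/

theorem one_add_sq_div_two_le_cosh (u : ℝ) : 1 + u ^ 2 / 2 ≤ Real.cosh u := by
  have h1 : |u / 2| ≤ |Real.sinh (u / 2)| := by
    rw [Real.abs_sinh]; exact Real.self_le_sinh_iff.mpr (abs_nonneg _)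
  have h2 := sq_le_sq.mpr h1
  have h3 := Real.cosh_two_mul (u / 2)
  rw [Real.cosh_sq, mul_div_cancel₀ u two_ne_zero] at h3
  nlinarith

theorem integrable_exp_neg_mul_cosh {m : ℝ} (hm : 0 < m) (σ : ℝ) :
    Integrable fun u : ℝ => Real.exp (-(m * Real.cosh u) + σ * u) := by
  have h := (integrable_cexp_quadratic (b := ((m / 2 : ℝ) : ℂ))
    (by rw [Complex.ofReal_re]; positivity) (σ : ℂ) 0).norm
  refine Integrable.mono' h (Continuous.aestronglyMeasurable
    (Real.continuous_exp.comp (((continuous_const.mul Real.continuous_cosh).neg).add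
      (continuous_const.mul continuous_id)))) (Eventually.of_forall fun u => ?_)
  rw [Real.norm_eq_abs, abs_of_pos (Real.exp_pos _), Complex.norm_exp]
  apply Real.exp_le_exp.mpr
  have h1 : (-((m / 2 : ℝ) : ℂ) * (u : ℂ) ^ 2 + (σ : ℂ) * u + 0).re = -(m / 2) * u ^ 2 + σ * u := by
    rw [← Complex.ofReal_pow, ← Complex.ofReal_neg, ← Complex.ofReal_mul, ← Complex.ofReal_mul,
      add_zero, ← Complex.ofReal_add, Complex.ofReal_re]
  rw [h1]
  nlinarith [one_add_sq_div_two_le_cosh u]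

/-- The integral `½ ∫ exp(-z cosh u + νu) du` for `z = e^x > 0`, that is `K_ν(z)`. -/
def macdonald (ν : ℂ) (x : ℝ) : ℂ :=
  (∫ u : ℝ, Complex.exp (((-(Real.exp x * Real.cosh u) : ℝ) : ℂ) + ν * u)) / 2

theorem macdonald_neg (ν : ℂ) (x : ℝ) : macdonald (-ν) x = macdonald ν x := by
  unfold macdonald
  rw [← integral_neg_eq_self]
  simp

/-- The integral `∫ exp(-(e^u + e^(2x-u))/2 + νu) du`, which is `2 e^(νx) K_ν(e^x)`. -/
def macdonaldShift (ν : ℂ) (x : ℝ) : ℂ :=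
  ∫ u : ℝ, Complex.exp (((-((Real.exp u + Real.exp (2 * x - u)) / 2) : ℝ) : ℂ) + ν * u)

theorem exp_mul_macdonald (ν : ℂ) (x : ℝ) :
    Complex.exp (ν * x) * macdonald ν x = macdonaldShift ν x / 2 := by
  unfold macdonald macdonaldShift
  rw [mul_div_assoc', ← integral_const_mul, ← integral_sub_right_eq_self _ x]
  congr 2
  funext u
  rw [← Complex.exp_add]
  congr 1
  have : Real.exp x * Real.cosh (u - x) = (Real.exp u + Real.exp (2 * x - u)) / 2 := by
    rw [Real.cosh_eq, mul_div_assoc', mul_add, ← Real.exp_add, ← Real.exp_add]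
    ring_nf
  rw [this]
  push_cast
  ring

theorem continuous_macdonaldShift_integrand (ν : ℂ) (x : ℝ) : Continuous fun u : ℝ =>
    Complex.exp (((-((Real.exp u + Real.exp (2 * x - u)) / 2) : ℝ) : ℂ) + ν * u) := by
  fun_prop

theorem norm_macdonaldShift_integrand (ν : ℂ) (x u : ℝ) :
    ‖Complex.exp (((-((Real.exp u + Real.exp (2 * x - u)) / 2) : ℝ) : ℂ) + ν * u)‖ =
      Real.exp (-((Real.exp u + Real.exp (2 * x - u)) / 2) + ν.re * u) := by
  rw [Complex.norm_exp]
  simp only [Complex.add_re, Complex.ofReal_re, Complex.mul_re, Complex.ofReal_im, mul_zero,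
    sub_zero]

theorem norm_macdonaldShift_integrand_le (ν : ℂ) {y x : ℝ} (hxy : y ≤ x) (u : ℝ) :
    ‖Complex.exp (((-((Real.exp u + Real.exp (2 * x - u)) / 2) : ℝ) : ℂ) + ν * u)‖ ≤
      Real.exp (-(min 1 (Real.exp (2 * y)) * Real.cosh u) + ν.re * u) := by
  rw [norm_macdonaldShift_integrand]
  apply Real.exp_le_exp.mpr
  have h1 : Real.exp (2 * y - u) ≤ Real.exp (2 * x - u) := Real.exp_le_exp.mpr (by linarith)
  have h2 : Real.exp (2 * y - u) = Real.exp (2 * y) * Real.exp (-u) := by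
    rw [← Real.exp_add]; ring_nf
  have h3 := mul_le_mul_of_nonneg_right (min_le_left 1 (Real.exp (2 * y))) (Real.exp_pos u).le
  have h4 := mul_le_mul_of_nonneg_right (min_le_right 1 (Real.exp (2 * y))) (Real.exp_pos (-u)).le
  rw [Real.cosh_eq]
  nlinarith

theorem integrable_macdonaldShift (ν : ℂ) (x : ℝ) : Integrable fun u : ℝ =>
    Complex.exp (((-((Real.exp u + Real.exp (2 * x - u)) / 2) : ℝ) : ℂ) + ν * u) :=
  Integrable.mono' (integrable_exp_neg_mul_cosh (lt_min one_pos (Real.exp_pos (2 * x))) ν.re)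
    (continuous_macdonaldShift_integrand ν x).aestronglyMeasurable
    (Eventually.of_forall fun u => norm_macdonaldShift_integrand_le ν le_rfl u)

theorem hasDerivAt_macdonaldShift (ν : ℂ) (x : ℝ) :
    HasDerivAt (macdonaldShift ν)
      (-((Real.exp (2 * x) : ℝ) : ℂ) * macdonaldShift (ν - 1) x) x := by
  have hpt : ∀ y u : ℝ, ((-(Real.exp (2 * y - u)) : ℝ) : ℂ) *
      Complex.exp (((-((Real.exp u + Real.exp (2 * y - u)) / 2) : ℝ) : ℂ) + ν * u) =
      -((Real.exp (2 * y) : ℝ) : ℂ) *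
      Complex.exp (((-((Real.exp u + Real.exp (2 * y - u)) / 2) : ℝ) : ℂ) + (ν - 1) * u) := by
    intro y u
    rw [Complex.ofReal_neg, neg_mul, neg_mul, Complex.ofReal_exp, Complex.ofReal_exp,
      ← Complex.exp_add, ← Complex.exp_add]
    congr 2
    push_cast
    ring
  have h := hasDerivAt_integral_of_dominated_loc_of_deriv_le (μ := volume) (x₀ := x)
    (F := fun (y : ℝ) (u : ℝ) =>
      Complex.exp (((-((Real.exp u + Real.exp (2 * y - u)) / 2) : ℝ) : ℂ) + ν * u))
    (F' := fun (y : ℝ) (u : ℝ) => ((-(Real.exp (2 * y - u)) : ℝ) : ℂ) *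
      Complex.exp (((-((Real.exp u + Real.exp (2 * y - u)) / 2) : ℝ) : ℂ) + ν * u))
    (bound := fun u => Real.exp (2 * (x + 1)) *
      Real.exp (-(min 1 (Real.exp (2 * (x - 1))) * Real.cosh u) + (ν - 1).re * u))
    (s := Ioo (x - 1) (x + 1)) (Ioo_mem_nhds (by linarith) (by linarith))
    (Eventually.of_forall fun y => (continuous_macdonaldShift_integrand ν y).aestronglyMeasurable)
    (integrable_macdonaldShift ν x) (Continuous.aestronglyMeasurable (by fun_prop))
    (Eventually.of_forall fun u y hy => ?_)
    ((integrable_exp_neg_mul_cosh (lt_min one_pos (Real.exp_pos _)) _).const_mul _)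
    (Eventually.of_forall fun u y hy => ?_)
  · refine h.2.congr_deriv ?_
    unfold macdonaldShift
    rw [← integral_const_mul]
    exact integral_congr_ae (Eventually.of_forall fun u => hpt x u)
  · rw [hpt, norm_mul, norm_neg, Complex.norm_real, Real.norm_eq_abs, abs_of_pos (Real.exp_pos _)]
    exact mul_le_mul (Real.exp_le_exp.mpr (by linarith [hy.2]))
      (norm_macdonaldShift_integrand_le _ hy.1.le u) (norm_nonneg _) (Real.exp_pos _).le
  · have h1 : HasDerivAt (fun y : ℝ => 2 * y - u) 2 y := by
      simpa using ((hasDerivAt_id y).const_mul 2).sub_const u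
    have h2 : HasDerivAt (fun y : ℝ => -((Real.exp u + Real.exp (2 * y - u)) / 2))
        (-(Real.exp (2 * y - u))) y := by
      refine ((h1.exp.const_add (Real.exp u)).div_const 2).neg.congr_deriv ?_
      ring
    refine (h2.ofReal_comp.add_const (ν * u)).cexp.congr_deriv ?_
    ring

theorem macdonald_eq (ν : ℂ) (x : ℝ) :
    macdonald ν x = Complex.exp (-ν * x) * (macdonaldShift ν x / 2) := by
  rw [← exp_mul_macdonald, ← mul_assoc, ← Complex.exp_add]
  simp

/-- `z K_ν' = -ν K_ν - z K_(ν-1)`. -/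
theorem hasDerivAt_macdonald (ν : ℂ) (x : ℝ) :
    HasDerivAt (macdonald ν)
      (-ν * macdonald ν x - Complex.exp x * macdonald (ν - 1) x) x := by
  have h1 : HasDerivAt (fun y : ℝ => Complex.exp (-ν * y)) (Complex.exp (-ν * x) * -ν) x := by
    have : HasDerivAt (fun w : ℂ => Complex.exp (-ν * w)) (Complex.exp (-ν * x) * -ν) (x : ℂ) := by
      simpa using ((hasDerivAt_id (x : ℂ)).const_mul (-ν)).cexp
    exact this.comp_ofReal
  have h2 := h1.mul ((hasDerivAt_macdonaldShift ν x).div_const 2)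
  rw [show macdonald ν = fun x : ℝ => Complex.exp (-ν * x) * (macdonaldShift ν x / 2) from
    funext (macdonald_eq ν)]
  refine h2.congr_deriv ?_
  rw [macdonald_eq (ν - 1)]
  have : Complex.exp x * Complex.exp (-(ν - 1) * x) =
      Complex.exp (-ν * x) * ((Real.exp (2 * x) : ℝ) : ℂ) := by
    rw [Complex.ofReal_exp, ← Complex.exp_add, ← Complex.exp_add]
    congr 1; push_cast; ring
  linear_combination (macdonaldShift (ν - 1) x / 2) * this

/-- `z K_ν' = ν K_ν - z K_(ν+1)`. -/
theorem hasDerivAt_macdonald_add_one (ν : ℂ) (x : ℝ) :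
    HasDerivAt (macdonald ν)
      (ν * macdonald ν x - Complex.exp x * macdonald (ν + 1) x) x := by
  have h := hasDerivAt_macdonald (-ν) x
  rw [show macdonald (-ν) = macdonald ν from funext (macdonald_neg ν), neg_neg,
    show -ν - 1 = -(ν + 1) by ring, macdonald_neg] at h
  exact h

theorem range_exp_eq : Real.exp '' univ = Ioi 0 := by
  rw [image_univ, Real.range_exp]

/-- `∫ exp(-e^u / 2 + νu) du = 2^ν Γ(ν)`. -/
theorem integral_exp_neg_exp {ν : ℂ} (hν : 0 < ν.re) :
    ∫ u : ℝ, Complex.exp (((-(Real.exp u / 2) : ℝ) : ℂ) + ν * u) =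
      Complex.exp (ν * (Real.log 2 : ℂ)) * Complex.Gamma ν := by
  have h := Complex.integral_cpow_mul_exp_neg_mul_Ioi hν (r := 1 / 2) (by norm_num)
  rw [← range_exp_eq, integral_image_eq_integral_abs_deriv_smul MeasurableSet.univ
    (fun u _ => (Real.hasDerivAt_exp u).hasDerivWithinAt) Real.exp_injective.injOn,
    Measure.restrict_univ] at h
  have h2 : ((1 : ℂ) / ((1 / 2 : ℝ) : ℂ)) ^ ν = Complex.exp (ν * (Real.log 2 : ℂ)) := by
    rw [show (1 : ℂ) / ((1 / 2 : ℝ) : ℂ) = ((2 : ℝ) : ℂ) by push_cast; norm_num,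
      Complex.cpow_def_of_ne_zero (by norm_num), ← Complex.ofReal_log zero_le_two, mul_comm]
  rw [← h2, ← h]
  congr 1
  funext u
  rw [abs_of_pos (Real.exp_pos u), Complex.real_smul,
    Complex.cpow_def_of_ne_zero (by exact_mod_cast (Real.exp_pos u).ne'),
    ← Complex.ofReal_log (Real.exp_pos u).le, Real.log_exp, Complex.ofReal_exp,
    ← Complex.exp_add, ← Complex.exp_add]
  congr 1
  push_cast
  ring

theorem integrable_exp_neg_exp {σ : ℝ} (hσ : 0 < σ) :
    Integrable fun u : ℝ => Real.exp (-(Real.exp u / 2) + σ * u) := by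
  have h := integrableOn_rpow_mul_exp_neg_mul_rpow (p := 1) (s := σ - 1) (b := 1 / 2)
    (by linarith) one_pos (by norm_num)
  rw [← range_exp_eq, integrableOn_image_iff_integrableOn_abs_deriv_smul MeasurableSet.univ
    (fun u _ => (Real.hasDerivAt_exp u).hasDerivWithinAt) Real.exp_injective.injOn,
    integrableOn_univ] at h
  refine h.congr (Eventually.of_forall fun u => ?_)
  simp only [Real.rpow_one, smul_eq_mul]
  rw [abs_of_pos (Real.exp_pos u), ← Real.exp_mul, ← Real.exp_add, ← Real.exp_add]
  ring_nf

/-- The leading behaviour of Macdonald's function as `z → 0`. -/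
theorem tendsto_exp_mul_macdonald_atBot {ν : ℂ} (hν : 0 < ν.re) :
    Tendsto (fun x : ℝ => Complex.exp (ν * x) * macdonald ν x) atBot
      (𝓝 (Complex.exp (ν * (Real.log 2 : ℂ)) * Complex.Gamma ν / 2)) := by
  rw [← integral_exp_neg_exp hν]
  have h : Tendsto (fun x : ℝ => macdonaldShift ν x) atBot
      (𝓝 (∫ u : ℝ, Complex.exp (((-(Real.exp u / 2) : ℝ) : ℂ) + ν * u))) := by
    refine tendsto_integral_filter_of_dominated_convergence _ (Eventually.of_forall fun x =>
      (continuous_macdonaldShift_integrand ν x).aestronglyMeasurable)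
      (Eventually.of_forall fun x => Eventually.of_forall fun u => ?_) (integrable_exp_neg_exp hν)
      (Eventually.of_forall fun u => ?_)
    · rw [norm_macdonaldShift_integrand]
      apply Real.exp_le_exp.mpr
      linarith [Real.exp_pos (2 * x - u)]
    · have h1 : Tendsto (fun x : ℝ => 2 * x - u) atBot atBot :=
        tendsto_atBot_add_const_right _ _ (tendsto_id.const_mul_atBot two_pos)
      have h2 := (((Real.tendsto_exp_atBot.comp h1).const_add (Real.exp u)).div_const 2).neg
      rw [add_zero] at h2
      have h3 := ((Complex.continuous_ofReal.tendsto _).comp h2).add_const (ν * u)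
      exact (Complex.continuous_exp.tendsto _).comp h3
  refine (h.div_const 2).congr fun x => ?_
  rw [exp_mul_macdonald]

/-- The leading behaviour of Macdonald's function as `z → +∞`. -/
theorem tendsto_exp_mul_macdonald_atTop (ν : ℂ) :
    Tendsto (fun x : ℝ => Complex.exp (Complex.exp x + x / 2) * macdonald ν x) atTop
      (𝓝 (Real.sqrt (Real.pi / 2) : ℂ)) := by
  have hrep : ∀ x : ℝ, Complex.exp (Complex.exp x + x / 2) * macdonald ν x =
      (∫ v : ℝ, Complex.exp (((-(2 * (Real.sinh (Real.exp (-x / 2) * v / 2) /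
        Real.exp (-x / 2)) ^ 2) : ℝ) : ℂ) + ν * ((Real.exp (-x / 2) * v : ℝ) : ℂ))) / 2 := by
    intro x
    -- the substitution `u = e^(-x/2) v` and `cosh u - 1 = 2 sinh² (u/2)`
    have ha : 0 < Real.exp (-x / 2) := Real.exp_pos _
    have h1 := Measure.integral_comp_mul_left (fun u : ℝ =>
      Complex.exp (((-(Real.exp x * (Real.cosh u - 1)) : ℝ) : ℂ) + ν * u)) (Real.exp (-x / 2))
    have h2 : |(Real.exp (-x / 2))⁻¹| = Real.exp (x / 2) := by
      rw [abs_of_pos (inv_pos.mpr ha), ← Real.exp_neg]; ring_nf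
    rw [h2, Complex.real_smul] at h1
    have h3 : ∫ u : ℝ, Complex.exp (((-(Real.exp x * (Real.cosh u - 1)) : ℝ) : ℂ) + ν * u) =
        Complex.exp (Complex.exp x) *
          ∫ u : ℝ, Complex.exp (((-(Real.exp x * Real.cosh u) : ℝ) : ℂ) + ν * u) := by
      rw [← integral_const_mul]
      congr 1
      funext u
      rw [← Complex.exp_add]
      congr 1
      push_cast
      ring
    rw [h3] at h1
    unfold macdonald
    rw [Complex.exp_add, show Complex.exp ((x : ℂ) / 2) = ((Real.exp (x / 2) : ℝ) : ℂ) by push_cast; rfl]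
    have h4 : ∀ v : ℝ, Real.exp x * (Real.cosh (Real.exp (-x / 2) * v) - 1) =
        2 * (Real.sinh (Real.exp (-x / 2) * v / 2) / Real.exp (-x / 2)) ^ 2 := by
      intro v
      have h5 := Real.cosh_two_mul (Real.exp (-x / 2) * v / 2)
      rw [Real.cosh_sq, mul_div_cancel₀ _ two_ne_zero] at h5
      have h6 : Real.exp x * Real.exp (-x / 2) ^ 2 = 1 := by
        rw [← Real.exp_nat_mul, ← Real.exp_add, Real.exp_eq_one_iff]
        push_cast
        ring
      rw [h5, div_pow, eq_comm, mul_div_assoc', div_eq_iff (by positivity)]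
      linear_combination (-2 * Real.sinh (Real.exp (-x / 2) * v / 2) ^ 2) * h6
    simp only [← h4]
    rw [h1]
    ring
  have hlim : Tendsto (fun x : ℝ => ∫ v : ℝ, Complex.exp (((-(2 *
      (Real.sinh (Real.exp (-x / 2) * v / 2) / Real.exp (-x / 2)) ^ 2) : ℝ) : ℂ) +
        ν * ((Real.exp (-x / 2) * v : ℝ) : ℂ))) atTop
      (𝓝 (∫ v : ℝ, ((Real.exp (-(1 / 2) * v ^ 2) : ℝ) : ℂ))) := by
    have hexp0 : Tendsto (fun x : ℝ => Real.exp (-x / 2)) atTop (𝓝 0) := by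
      refine Real.tendsto_exp_atBot.comp ?_
      exact tendsto_neg_atTop_atBot.atBot_div_const two_pos
    refine tendsto_integral_filter_of_dominated_convergence
      (fun v => Real.exp (ν.re ^ 2) * Real.exp (-(1 / 4) * v ^ 2))
      (Eventually.of_forall fun x => Continuous.aestronglyMeasurable ?_) ?_
      ((integrable_exp_neg_mul_sq (by norm_num)).const_mul _) (Eventually.of_forall fun v => ?_)
    · have := Real.continuous_sinh
      fun_prop
    · filter_upwards [eventually_ge_atTop (0 : ℝ)] with x hx
      refine Eventually.of_forall fun v => ?_
      set a := Real.exp (-x / 2) with ha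
      have ha0 : 0 < a := Real.exp_pos _
      have ha1 : a ≤ 1 := by rw [ha, Real.exp_le_one_iff]; linarith
      rw [Complex.norm_exp, ← Real.exp_add]
      apply Real.exp_le_exp.mpr
      have h1 : |v / 2| ≤ |Real.sinh (a * v / 2) / a| := by
        rw [abs_div (Real.sinh _), abs_of_pos ha0, le_div_iff₀ ha0, Real.abs_sinh]
        have h2 : |v / 2| * a = |a * v / 2| := by
          rw [mul_div_assoc, abs_mul, abs_of_pos ha0, mul_comm]
        rw [h2]
        exact Real.self_le_sinh_iff.mpr (abs_nonneg _)
      have h3 := sq_le_sq.mpr h1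
      simp only [Complex.add_re, Complex.ofReal_re, Complex.mul_re, Complex.ofReal_im, mul_zero,
        sub_zero]
      have h4 : ν.re * (a * v) ≤ |ν.re| * |v| := by
        calc ν.re * (a * v) ≤ |ν.re * (a * v)| := le_abs_self _
          _ = |ν.re| * (a * |v|) := by rw [abs_mul, abs_mul, abs_of_pos ha0]
          _ ≤ |ν.re| * (1 * |v|) := by gcongr
          _ = _ := by rw [one_mul]
      nlinarith [sq_nonneg (|v| / 2 - |ν.re|), sq_abs v, sq_abs ν.re]
    · have hder : HasDerivAt (fun a : ℝ => Real.sinh (a * v / 2)) (v / 2) 0 := by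
        have h1 : HasDerivAt (fun a : ℝ => a * v / 2) (v / 2) 0 := by
          simpa using ((hasDerivAt_id (0 : ℝ)).mul_const v).div_const 2
        simpa using h1.sinh
      have h2 := hasDerivAt_iff_tendsto_slope_zero.mp hder
      have h3 : Tendsto (fun x : ℝ => Real.exp (-x / 2)) atTop (𝓝[≠] 0) :=
        tendsto_nhdsWithin_iff.mpr ⟨hexp0, Eventually.of_forall fun x => (Real.exp_pos _).ne'⟩
      have h4 := h2.comp h3
      have h5 : Tendsto (fun x : ℝ => Real.sinh (Real.exp (-x / 2) * v / 2) / Real.exp (-x / 2))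
          atTop (𝓝 (v / 2)) := by
        refine h4.congr fun x => ?_
        simp [div_eq_inv_mul]
      have h6 := ((h5.pow 2).const_mul 2).neg
      have h7 := (hexp0.mul_const v)
      have h8 := ((Complex.continuous_ofReal.tendsto _).comp h6).add
        (((Complex.continuous_ofReal.tendsto _).comp h7).const_mul ν)
      have h9 := (Complex.continuous_exp.tendsto _).comp h8
      have h10 : Complex.exp (((-(2 * (v / 2) ^ 2) : ℝ) : ℂ) + ν * ((0 * v : ℝ) : ℂ)) =
          ((Real.exp (-(1 / 2) * v ^ 2) : ℝ) : ℂ) := by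
        rw [Complex.ofReal_exp]
        congr 1
        push_cast
        ring
      rw [h10] at h9
      exact h9
  have hval : (∫ v : ℝ, ((Real.exp (-(1 / 2) * v ^ 2) : ℝ) : ℂ)) / 2 =
      (Real.sqrt (Real.pi / 2) : ℂ) := by
    rw [integral_complex_ofReal, integral_gaussian, show Real.pi / (1 / 2) = 2 ^ 2 * (Real.pi / 2) by ring,
      Real.sqrt_mul (by norm_num), Real.sqrt_sq (by norm_num)]
    push_cast
    ring
  rw [← hval]
  exact (hlim.div_const 2).congr fun x => (hrep x).symm

/-! ### Macdonald's integral equals the quotient of series -/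

/-- The quotient `(π/2) (I_{-ν}(z) - I_ν(z)) / sin(πν)`, which is `K_ν(z)` for `ν` not an
integer. -/
def besselKQuotient (ν ζ : ℂ) : ℂ :=
  Real.pi / 2 * (besselI (-ν) ζ - besselI ν ζ) / Complex.sin (Real.pi * ν)

theorem besselKQuotient_neg (ν ζ : ℂ) : besselKQuotient (-ν) ζ = besselKQuotient ν ζ := by
  unfold besselKQuotient
  rw [neg_neg, mul_neg, Complex.sin_neg, div_neg, ← neg_div]
  ring

theorem hasDerivAt_besselKQuotient (ν ζ : ℂ) :
    HasDerivAt (besselKQuotient ν)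
      (-ν * besselKQuotient ν ζ - Complex.exp ζ * besselKQuotient (ν - 1) ζ) ζ := by
  have h := (((hasDerivAt_besselI_add_one (-ν) ζ).sub
    (hasDerivAt_besselI_sub_one ν ζ)).const_mul ((Real.pi : ℂ) / 2)).div_const
      (Complex.sin (Real.pi * ν))
  refine h.congr_deriv ?_
  unfold besselKQuotient
  rw [show (Real.pi : ℂ) * (ν - 1) = Real.pi * ν - Real.pi by ring, Complex.sin_sub_pi,
    show -(ν - 1) = -ν + 1 by ring, div_neg]
  ring

theorem tendsto_exp_mul_besselKQuotient {ν : ℂ} (h0 : 0 < ν.re) :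
    Tendsto (fun x : ℝ => Complex.exp (ν * x) * besselKQuotient ν x) atBot
      (𝓝 (Complex.exp (ν * (Real.log 2 : ℂ)) * (Real.pi / Complex.sin (Real.pi * ν) *
        (Complex.Gamma (1 - ν))⁻¹) / 2)) := by
  have h1 := tendsto_exp_mul_besselI (-ν)
  have h2 := tendsto_exp_mul_besselI ν
  have h3 : Tendsto (fun x : ℝ => Complex.exp (2 * ν * x)) atBot (𝓝 0) := by
    rw [tendsto_zero_iff_norm_tendsto_zero]
    have h4 : Tendsto (fun x : ℝ => 2 * ν.re * x) atBot atBot :=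
      tendsto_id.const_mul_atBot (by positivity)
    refine (Real.tendsto_exp_atBot.comp h4).congr fun x => ?_
    rw [Complex.norm_exp]
    simp
  have h5 := ((h1.sub (h3.mul h2)).const_mul ((Real.pi : ℂ) / 2)).div_const
    (Complex.sin (Real.pi * ν))
  rw [neg_neg, zero_mul, sub_zero, show -ν + 1 = 1 - ν by ring] at h5
  have h6 : (Real.pi : ℂ) / 2 * (Complex.exp (ν * (Real.log 2 : ℂ)) * (Complex.Gamma (1 - ν))⁻¹) /
      Complex.sin (Real.pi * ν) = Complex.exp (ν * (Real.log 2 : ℂ)) *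
        (Real.pi / Complex.sin (Real.pi * ν) * (Complex.Gamma (1 - ν))⁻¹) / 2 := by ring
  rw [h6] at h5
  refine h5.congr fun x => ?_
  have h7 : Complex.exp (2 * ν * x) * (Complex.exp (-ν * x) * besselI ν x) =
      Complex.exp (ν * x) * besselI ν x := by
    rw [← mul_assoc, ← Complex.exp_add]; ring_nf
  rw [h7]
  unfold besselKQuotient
  ring

theorem tendsto_exp_mul_macdonald_sub {ν : ℂ} (h0 : 0 < ν.re) (h1 : ν.re < 1) :
    Tendsto (fun x : ℝ => Complex.exp (ν * x) * (macdonald ν x - besselKQuotient ν x)) atBot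
      (𝓝 0) := by
  have h2 := (tendsto_exp_mul_macdonald_atBot h0).sub (tendsto_exp_mul_besselKQuotient h0)
  rw [← Complex.Gamma_mul_Gamma_one_sub, mul_assoc (Complex.Gamma ν),
    mul_inv_cancel₀ (Complex.Gamma_ne_zero_of_re_pos (by simp; linarith)), mul_one, sub_self] at h2
  exact h2.congr fun x => by ring

theorem hasDerivAt_exp_mul_macdonald_sub (ν : ℂ) (x : ℝ) :
    HasDerivAt (fun x : ℝ => Complex.exp (ν * x) * (macdonald ν x - besselKQuotient ν x))
      (-Complex.exp (2 * ν * x) *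
        (Complex.exp ((1 - ν) * x) * (macdonald (1 - ν) x - besselKQuotient (1 - ν) x))) x := by
  have h1 : HasDerivAt (fun y : ℝ => Complex.exp (ν * y)) (Complex.exp (ν * x) * ν) x := by
    have : HasDerivAt (fun w : ℂ => Complex.exp (ν * w)) (Complex.exp (ν * x) * ν) (x : ℂ) := by
      simpa using ((hasDerivAt_id (x : ℂ)).const_mul ν).cexp
    exact this.comp_ofReal
  have h2 := h1.mul ((hasDerivAt_macdonald ν x).sub (hasDerivAt_besselKQuotient ν x).comp_ofReal)
  refine h2.congr_deriv ?_
  rw [show (1 : ℂ) - ν = -(ν - 1) by ring, macdonald_neg, besselKQuotient_neg]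
  have h3 : Complex.exp (2 * ν * x) * Complex.exp (-(ν - 1) * x) =
      Complex.exp (ν * x) * Complex.exp x := by
    rw [← Complex.exp_add, ← Complex.exp_add]; ring_nf
  simp only [Pi.sub_apply]
  linear_combination (macdonald (ν - 1) x - besselKQuotient (ν - 1) x) * h3

/-- A Gronwall argument: a solution of a linear system with coefficients integrable at `-∞` that
vanishes at `-∞` is identically zero. -/
theorem eq_zero_of_coupled_system {p q : ℝ → ℂ} {a b : ℂ} (ha : 0 < a.re) (hb : 0 < b.re)
    (hp : ∀ x : ℝ, HasDerivAt p (-Complex.exp (a * x) * q x) x)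
    (hq : ∀ x : ℝ, HasDerivAt q (-Complex.exp (b * x) * p x) x)
    (hp0 : Tendsto p atBot (𝓝 0)) (hq0 : Tendsto q atBot (𝓝 0)) (x : ℝ) : p x = 0 := by
  set m : ℝ → ℝ := fun x => ‖p x‖ ^ 2 + ‖q x‖ ^ 2 with hm
  set H : ℝ → ℝ := fun x => Real.exp (a.re * x) / a.re + Real.exp (b.re * x) / b.re with hH
  have hHd : ∀ x, HasDerivAt H (Real.exp (a.re * x) + Real.exp (b.re * x)) x := by
    intro x
    have h1 : ∀ c : ℝ, 0 < c → HasDerivAt (fun x => Real.exp (c * x) / c) (Real.exp (c * x)) x := by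
      intro c hc
      have h2 : HasDerivAt (fun x : ℝ => c * x) c x := by
        simpa using (hasDerivAt_id x).const_mul c
      refine (h2.exp.div_const c).congr_deriv ?_
      field_simp
    exact (h1 _ ha).add (h1 _ hb)
  have hH0 : ∀ x, 0 ≤ H x := fun x => by positivity
  have hFd : ∀ x, ∃ d ≤ 0, HasDerivAt (fun x => m x * Real.exp (-H x)) d x := by
    intro x
    have h1 := ((hp x).norm_sq.add (hq x).norm_sq).mul (hHd x).neg.exp
    refine ⟨_, ?_, h1⟩
    have e1 : ∀ (c : ℂ) (u v : ℂ), inner ℝ u (-Complex.exp (c * x) * v) ≤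
        Real.exp (c.re * x) * (‖u‖ * ‖v‖) := by
      intro c u v
      refine (real_inner_le_norm _ _).trans (le_of_eq ?_)
      rw [norm_mul, norm_neg, Complex.norm_exp]
      simp only [Complex.mul_re, Complex.ofReal_re, Complex.ofReal_im, mul_zero, sub_zero]
      ring
    have e2 := e1 a (p x) (q x)
    have e3 := e1 b (q x) (p x)
    have e4 : 2 * (‖p x‖ * ‖q x‖) ≤ ‖p x‖ ^ 2 + ‖q x‖ ^ 2 := by
      nlinarith [sq_nonneg (‖p x‖ - ‖q x‖)]
    have e5 := mul_le_mul_of_nonneg_left e4 (Real.exp_pos (a.re * x)).le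
    have e6 := mul_le_mul_of_nonneg_left e4 (Real.exp_pos (b.re * x)).le
    have e7 : 2 * inner ℝ (p x) (-Complex.exp (a * x) * q x) +
        2 * inner ℝ (q x) (-Complex.exp (b * x) * p x) ≤
        (Real.exp (a.re * x) + Real.exp (b.re * x)) * (‖p x‖ ^ 2 + ‖q x‖ ^ 2) := by
      linarith
    simp only [Pi.add_apply, Pi.neg_apply]
    have := Real.exp_pos (-H x)
    nlinarith
  choose d hd0 hd using hFd
  have hanti : Antitone fun x => m x * Real.exp (-H x) := by
    refine antitone_of_deriv_nonpos (fun x => (hd x).differentiableAt) fun x => ?_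
    rw [(hd x).deriv]
    exact hd0 x
  have hlim : Tendsto (fun x => m x * Real.exp (-H x)) atBot (𝓝 0) := by
    have h1 : Tendsto m atBot (𝓝 0) := by
      simpa using (hp0.norm.pow 2).add (hq0.norm.pow 2)
    refine squeeze_zero (fun x => by positivity) (fun x => ?_) h1
    refine mul_le_of_le_one_right (by positivity) ?_
    rw [Real.exp_le_one_iff]
    linarith [hH0 x]
  have hle : m x * Real.exp (-H x) ≤ 0 :=
    ge_of_tendsto hlim ((eventually_le_atBot x).mono fun y hy => hanti hy)
  have hmx : m x ≤ 0 := by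
    by_contra! h
    exact absurd hle (not_le.mpr (mul_pos h (Real.exp_pos _)))
  have h2 : ‖p x‖ ^ 2 ≤ 0 := by
    simp only [hm] at hmx
    nlinarith [sq_nonneg ‖q x‖]
  exact norm_eq_zero.mp (pow_eq_zero_iff two_ne_zero |>.mp (le_antisymm h2 (sq_nonneg _)))

theorem macdonald_eq_besselKQuotient_of_re_mem_Ioo {ν : ℂ} (h0 : 0 < ν.re) (h1 : ν.re < 1)
    (x : ℝ) : macdonald ν x = besselKQuotient ν x := by
  have hd := hasDerivAt_exp_mul_macdonald_sub (1 - ν)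
  rw [sub_sub_cancel] at hd
  have h := eq_zero_of_coupled_system (a := 2 * ν) (b := 2 * (1 - ν)) (by simpa using h0)
    (by simpa using h1) (hasDerivAt_exp_mul_macdonald_sub ν) hd
    (tendsto_exp_mul_macdonald_sub h0 h1)
    (tendsto_exp_mul_macdonald_sub (ν := 1 - ν) (by simpa using h1) (by simpa using h0)) x
  exact sub_eq_zero.mp ((mul_eq_zero.mp h).resolve_left (Complex.exp_ne_zero _))

/-- Both sides satisfy the same recurrence in the order, which carries the identity from the strip
`0 < Re ν < 1` to all orders with nonintegral real part. -/
theorem macdonald_eq_besselKQuotient {ν : ℂ} (hν : ∀ n : ℤ, ν.re ≠ n) :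
    ∀ x : ℝ, macdonald ν x = besselKQuotient ν x := by
  have hneg : ∀ μ : ℂ, (∀ x : ℝ, macdonald μ x = besselKQuotient μ x) →
      ∀ x : ℝ, macdonald (-μ) x = besselKQuotient (-μ) x := by
    intro μ h x
    rw [macdonald_neg, besselKQuotient_neg, h]
  have hdown : ∀ μ : ℂ, (∀ x : ℝ, macdonald μ x = besselKQuotient μ x) →
      ∀ x : ℝ, macdonald (μ - 1) x = besselKQuotient (μ - 1) x := by
    intro μ h x
    have h1 := hasDerivAt_macdonald μ x
    rw [show macdonald μ = fun x : ℝ => besselKQuotient μ x from funext h] at h1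
    have h2 := h1.unique (hasDerivAt_besselKQuotient μ x).comp_ofReal
    exact mul_left_cancel₀ (Complex.exp_ne_zero (x : ℂ)) (by linear_combination -h2)
  have hup : ∀ μ : ℂ, (∀ x : ℝ, macdonald μ x = besselKQuotient μ x) →
      ∀ x : ℝ, macdonald (μ + 1) x = besselKQuotient (μ + 1) x := by
    intro μ h
    have h1 := hneg _ (hdown _ (hneg _ h))
    rwa [show -(-μ - 1) = μ + 1 by ring] at h1
  set μ : ℂ := ν - (⌊ν.re⌋ : ℂ) with hμ
  have hre : μ.re = Int.fract ν.re := by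
    rw [← Int.self_sub_floor]; simp [hμ]
  have hμ0 : 0 < μ.re := by
    rw [hre]
    exact lt_of_le_of_ne (Int.fract_nonneg _) fun h => hν ⌊ν.re⌋ (by
      have := Int.self_sub_floor ν.re
      linarith)
  have hμ1 : μ.re < 1 := by rw [hre]; exact Int.fract_lt_one _
  have hall : ∀ n : ℤ, ∀ x : ℝ, macdonald (μ + n) x = besselKQuotient (μ + n) x := by
    intro n
    induction n using Int.induction_on with
    | zero => simpa using macdonald_eq_besselKQuotient_of_re_mem_Ioo hμ0 hμ1
    | succ i ih =>
      have := hup _ ih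
      rwa [show μ + ((i : ℤ) : ℂ) + 1 = μ + (((i : ℤ) + 1 : ℤ) : ℂ) by push_cast; ring] at this
    | pred i ih =>
      have := hdown _ ih
      rwa [show μ + ((-(i : ℤ) : ℤ) : ℂ) - 1 = μ + ((-(i : ℤ) - 1 : ℤ) : ℂ) by
        push_cast; ring] at this
  have h := hall ⌊ν.re⌋
  rwa [show μ + (⌊ν.re⌋ : ℂ) = ν by rw [hμ]; ring] at h

/-! ### Identification of the expansion -/

theorem tendsto_macdonald (ν : ℂ) :
    Tendsto (fun x : ℝ => macdonald ν x) atTop (𝓝 0) ∧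
      Tendsto (fun x : ℝ => Complex.exp x * macdonald ν x) atTop (𝓝 0) := by
  have h := tendsto_exp_mul_macdonald_atTop ν
  constructor
  · have h1 := (tendsto_exp_neg_exp_sub (1 / 2)).mul h
    rw [zero_mul] at h1
    refine h1.congr fun x => ?_
    rw [← mul_assoc, ← Complex.exp_add]
    ring_nf
    simp
  · have h1 := (tendsto_exp_neg_exp_sub (-1 / 2)).mul h
    rw [zero_mul] at h1
    refine h1.congr fun x => ?_
    rw [← mul_assoc, ← Complex.exp_add]
    ring_nf

/-- Two solutions of the modified Bessel equation that decay on the positive real axis are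
proportional: their Wronskian is constant and tends to zero. -/
theorem hankelExpansion_wronskian {N : ℕ} {ν : ℂ} (hν : |ν.re| < (N : ℝ) + 1 / 2) (x : ℝ) :
    hankelExpansion N ν x * (-ν * macdonald ν x - Complex.exp x * macdonald (ν - 1) x) -
      hankelExpansionDeriv N ν x * macdonald ν x = 0 := by
  set W : ℝ → ℂ := fun x =>
    hankelExpansion N ν x * (-ν * macdonald ν x - Complex.exp x * macdonald (ν - 1) x) -
      hankelExpansionDeriv N ν x * macdonald ν x with hW
  have hd : ∀ x, HasDerivAt W 0 x := by
    intro x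
    have him : |((x : ℂ)).im| < 3 * Real.pi / 2 := by
      simpa using (by positivity : 0 < 3 * Real.pi / 2)
    have y0 := (hasDerivAt_hankelExpansion hν him).comp_ofReal
    have y1 := (hasDerivAt_hankelExpansionDeriv hν him).comp_ofReal
    have X0 := hasDerivAt_macdonald ν x
    have X1 := hasDerivAt_macdonald_add_one (ν - 1) x
    rw [sub_add_cancel] at X1
    have e := (Complex.hasDerivAt_exp (x : ℂ)).comp_ofReal
    have h := (y0.mul ((X0.const_mul (-ν)).sub (e.mul X1))).sub (y1.mul X0)
    refine h.congr_deriv ?_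
    simp only [Pi.sub_apply, Pi.mul_apply]
    ring
  have hlim : Tendsto W atTop (𝓝 0) := by
    have h1 := tendsto_hankelExpansion hν
    have h2 := tendsto_hankelExpansionDeriv hν
    have h3 := (tendsto_macdonald ν).1
    have h4 := (tendsto_macdonald (ν - 1)).2
    have h5 := (h1.mul ((h3.const_mul (-ν)).sub h4)).sub (h2.mul h3)
    simpa only [hW, mul_zero, zero_mul, sub_zero] using h5
  have hconst : ∀ x y, W x = W y :=
    is_const_of_deriv_eq_zero (fun x => (hd x).differentiableAt) fun x => (hd x).deriv
  exact tendsto_nhds_unique (tendsto_const_nhds.congr fun y => hconst x y) hlim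

/-- As the Wronskian vanishes, the quotient of the two solutions is constant wherever `macdonald` has no
zero, hence for large real `z`; the leading terms at infinity give its value. -/
theorem eventually_macdonald_eq {N : ℕ} {ν : ℂ} (hν : |ν.re| < (N : ℝ) + 1 / 2) :
    ∀ᶠ x : ℝ in atTop,
      macdonald ν x = (Real.sqrt (Real.pi / 2) : ℂ) * hankelExpansion N ν x := by
  have hsq : (Real.sqrt (Real.pi / 2) : ℂ) ≠ 0 := by
    have : 0 < Real.sqrt (Real.pi / 2) := Real.sqrt_pos.mpr (by positivity)
    exact_mod_cast this.ne'
  have hX := tendsto_exp_mul_macdonald_atTop ν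
  have hy := tendsto_exp_mul_hankelExpansion hν
  have hev : ∀ᶠ x : ℝ in atTop, macdonald ν x ≠ 0 := by
    filter_upwards [hX.eventually_ne hsq] with x hx h
    exact hx (by rw [h, mul_zero])
  obtain ⟨x₁, hx₁⟩ := eventually_atTop.mp hev
  have hd : ∀ x ∈ Ioi x₁, HasDerivAt (fun x : ℝ => hankelExpansion N ν x / macdonald ν x) 0 x := by
    intro x hx
    have him : |((x : ℂ)).im| < 3 * Real.pi / 2 := by
      simpa using (by positivity : 0 < 3 * Real.pi / 2)
    have h := (hasDerivAt_hankelExpansion hν him).comp_ofReal.div (hasDerivAt_macdonald ν x)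
      (hx₁ x (le_of_lt hx))
    refine h.congr_deriv ?_
    rw [div_eq_zero_iff]
    left
    linear_combination -hankelExpansion_wronskian hν x
  have hconst : ∀ x ∈ Ioi x₁, ∀ y ∈ Ioi x₁, hankelExpansion N ν x / macdonald ν x =
      hankelExpansion N ν y / macdonald ν y := fun x hx y hy =>
    isOpen_Ioi.is_const_of_deriv_eq_zero isPreconnected_Ioi
      (fun x hx => (hd x hx).differentiableAt.differentiableWithinAt)
      (fun x hx => (hd x hx).deriv) hx hy
  have hlim : Tendsto (fun x : ℝ => hankelExpansion N ν x / macdonald ν x) atTop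
      (𝓝 (1 / (Real.sqrt (Real.pi / 2) : ℂ))) := by
    refine (hy.div hX hsq).congr fun x => ?_
    exact mul_div_mul_left _ _ (Complex.exp_ne_zero _)
  filter_upwards [eventually_gt_atTop x₁] with x hx
  have h1 : hankelExpansion N ν x / macdonald ν x = 1 / (Real.sqrt (Real.pi / 2) : ℂ) := by
    refine tendsto_nhds_unique (tendsto_const_nhds.congr' ?_) hlim
    filter_upwards [eventually_gt_atTop x₁] with y hy'
    exact hconst x hx y hy'
  have h2 := hx₁ x (le_of_lt hx)
  field_simp at h1
  rw [← h1]
  ring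

/-- The expansion with integral remainder represents `(π/2) (I_{-ν} - I_ν) / sin(πν)` in the whole
sector `|arg z| < 3π/2`, by analytic continuation from the positive real axis. -/
theorem besselKQuotient_eq_of_re_ne_int {N : ℕ} {ν : ℂ} (hν : |ν.re| < (N : ℝ) + 1 / 2)
    (hint : ∀ n : ℤ, ν.re ≠ n) {ζ : ℂ} (hζ : |ζ.im| < 3 * Real.pi / 2) :
    besselKQuotient ν ζ = (Real.sqrt (Real.pi / 2) : ℂ) * hankelExpansion N ν ζ := by
  set U : Set ℂ := {ζ : ℂ | |ζ.im| < 3 * Real.pi / 2} with hU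
  have hUo : IsOpen U := isOpen_lt (by fun_prop) continuous_const
  have hUc : Convex ℝ U := by
    have : U = Complex.imLm ⁻¹' (Ioo (-(3 * Real.pi / 2)) (3 * Real.pi / 2)) := by
      ext w
      simp [hU, abs_lt]
    rw [this]
    exact (convex_Ioo _ _).linear_preimage _
  have ha : AnalyticOnNhd ℂ (besselKQuotient ν) U := DifferentiableOn.analyticOnNhd
    (fun w _ => (hasDerivAt_besselKQuotient ν w).differentiableAt.differentiableWithinAt) hUo
  have hb : AnalyticOnNhd ℂ (fun ζ => (Real.sqrt (Real.pi / 2) : ℂ) * hankelExpansion N ν ζ) U :=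
    DifferentiableOn.analyticOnNhd (fun w hw =>
      ((hasDerivAt_hankelExpansion hν hw).const_mul _).differentiableAt.differentiableWithinAt) hUo
  obtain ⟨x₁, hx₁⟩ := eventually_atTop.mp (eventually_macdonald_eq hν)
  have hx : ∀ x : ℝ, x₁ ≤ x →
      besselKQuotient ν x = (Real.sqrt (Real.pi / 2) : ℂ) * hankelExpansion N ν x := fun x hx => by
    rw [← macdonald_eq_besselKQuotient hint, hx₁ x hx]
  have hmem : ((x₁ : ℝ) : ℂ) ∈ U := by
    simpa [hU] using (by positivity : 0 < 3 * Real.pi / 2)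
  have hfreq : ∃ᶠ w in 𝓝[≠] ((x₁ : ℝ) : ℂ), besselKQuotient ν w =
      (Real.sqrt (Real.pi / 2) : ℂ) * hankelExpansion N ν w := by
    have ht : Tendsto (fun x : ℝ => (x : ℂ)) (𝓝[>] x₁) (𝓝[≠] ((x₁ : ℝ) : ℂ)) := by
      refine tendsto_nhdsWithin_iff.mpr ⟨?_, ?_⟩
      · exact (Complex.continuous_ofReal.tendsto x₁).mono_left nhdsWithin_le_nhds
      · filter_upwards [self_mem_nhdsWithin] with x hx'
        have hx'' : x₁ < x := hx'
        exact fun h => hx''.ne' (Complex.ofReal_injective h)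
    refine ht.frequently (Eventually.frequently ?_)
    filter_upwards [self_mem_nhdsWithin] with x hx'
    exact hx x (le_of_lt hx')
  exact ha.eqOn_of_preconnected_of_frequently_eq hb hUc.isPreconnected hmem hfreq hζ

/-! ### Exceptional orders by continuity -/

theorem continuous_coeffA (n : ℕ) : Continuous (coeffA n) := by
  unfold coeffA
  fun_prop

theorem continuousAt_hankelExpansion_order {N : ℕ} {ν : ℂ} (hν : |ν.re| < (N : ℝ) + 1 / 2) {ζ : ℂ}
    (hζ : |ζ.im| < 3 * Real.pi / 2) : ContinuousAt (fun μ => hankelExpansion N μ ζ) ν := by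
  have h1 : Continuous (remainderConst N) := by
    unfold remainderConst
    fun_prop
  have h2 := continuousAt_terminantIntegral_order hν (p := (N : ℝ) + 1 / 2) (by positivity) hζ
  have h3 : Continuous fun μ => ∑ n ∈ Finset.range N,
      coeffA n μ * Complex.exp (-Complex.exp ζ - ((n : ℂ) + 1 / 2) * ζ) :=
    continuous_finsetSum _ fun n _ => (continuous_coeffA n).mul continuous_const
  exact h3.continuousAt.add (h1.continuousAt.mul (continuousAt_const.mul h2))

theorem neBot_nhdsWithin_re_mem {S : Set ℝ} (hS : Sᶜ.Countable) (ν : ℂ) :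
    (𝓝[{μ : ℂ | μ.re ∈ S}] ν).NeBot := by
  rw [← mem_closure_iff_nhdsWithin_neBot]
  have h1 : Dense S := by simpa using hS.dense_compl ℝ
  exact (h1.preimage Complex.isOpenMap_re) ν

theorem sin_pi_mul_ne_zero {ν : ℂ} (hν : ¬∃ n : ℤ, ν = n) : Complex.sin (Real.pi * ν) ≠ 0 := by
  intro h
  obtain ⟨k, hk⟩ := Complex.sin_eq_zero_iff.mp h
  have hpi : (Real.pi : ℂ) ≠ 0 := by exact_mod_cast Real.pi_ne_zero
  exact hν ⟨k, mul_left_cancel₀ hpi (by rw [hk]; ring)⟩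

/-- Both sides are continuous in the order, and the orders with nonintegral real part are dense. -/
theorem besselKQuotient_eq {N : ℕ} {ν : ℂ} (hν : |ν.re| < (N : ℝ) + 1 / 2)
    (hint : ¬∃ n : ℤ, ν = n) {ζ : ℂ} (hζ : |ζ.im| < 3 * Real.pi / 2) :
    besselKQuotient ν ζ = (Real.sqrt (Real.pi / 2) : ℂ) * hankelExpansion N ν ζ := by
  have hcount : ((range fun n : ℤ => (n : ℝ))ᶜ)ᶜ.Countable := by
    rw [compl_compl]; exact countable_range _
  have hne := neBot_nhdsWithin_re_mem hcount ν
  have h1 : ContinuousAt (fun μ => besselKQuotient μ ζ) ν := by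
    unfold besselKQuotient
    have c1 := (continuous_besselI_order ζ)
    have c2 : Continuous fun μ : ℂ => besselI (-μ) ζ := c1.comp continuous_neg
    exact ((continuous_const.mul (c2.sub c1)).continuousAt).div
      (by fun_prop) (sin_pi_mul_ne_zero hint)
  have h2 := (continuousAt_hankelExpansion_order hν hζ).const_mul (Real.sqrt (Real.pi / 2) : ℂ)
  refine tendsto_nhds_unique_of_eventuallyEq
    (l := 𝓝[{μ : ℂ | μ.re ∈ (range fun n : ℤ => (n : ℝ))ᶜ}] ν)
    (h1.tendsto.mono_left nhdsWithin_le_nhds) (h2.tendsto.mono_left nhdsWithin_le_nhds) ?_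
  have h3 : ∀ᶠ μ : ℂ in 𝓝 ν, |μ.re| < (N : ℝ) + 1 / 2 :=
    (isOpen_lt (by fun_prop) continuous_const).mem_nhds hν
  filter_upwards [self_mem_nhdsWithin, nhdsWithin_le_nhds h3] with μ hμ hμ'
  exact besselKQuotient_eq_of_re_ne_int hμ' (fun n hn => hμ ⟨n, hn.symm⟩) hζ

theorem eventually_not_int (ν : ℂ) : ∀ᶠ μ : ℂ in 𝓝[≠] ν, ¬∃ n : ℤ, μ = (n : ℂ) := by
  have hc : IsClosed ((fun n : ℤ => (n : ℂ)) '' {n : ℤ | (n : ℂ) ≠ ν}) :=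
    Complex.isClosedEmbedding_intCast.isClosedMap _ (isClosed_discrete _)
  have hm : ((fun n : ℤ => (n : ℂ)) '' {n : ℤ | (n : ℂ) ≠ ν})ᶜ ∈ 𝓝 ν :=
    hc.isOpen_compl.mem_nhds fun ⟨n, hn, h⟩ => hn h
  filter_upwards [self_mem_nhdsWithin, nhdsWithin_le_nhds hm] with μ h1 h2
  rintro ⟨n, rfl⟩
  exact h2 ⟨n, h1, rfl⟩

/-- The expansion with integral remainder represents `K_ν(z)` for all orders `|Re ν| < N + 1/2` and
all `|arg z| < 3π/2`. -/
theorem besselK_eq_hankelExpansion {N : ℕ} {ν : ℂ} (hν : |ν.re| < (N : ℝ) + 1 / 2) {ζ : ℂ}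
    (hζ : |ζ.im| < 3 * Real.pi / 2) :
    besselK ν ζ = (Real.sqrt (Real.pi / 2) : ℂ) * hankelExpansion N ν ζ := by
  unfold besselK
  split_ifs with hint
  · refine Tendsto.limUnder_eq ?_
    have h2 := (continuousAt_hankelExpansion_order hν hζ).const_mul (Real.sqrt (Real.pi / 2) : ℂ)
    refine (h2.tendsto.mono_left nhdsWithin_le_nhds).congr' ?_
    have h3 : ∀ᶠ μ : ℂ in 𝓝 ν, |μ.re| < (N : ℝ) + 1 / 2 :=
      (isOpen_lt (by fun_prop) continuous_const).mem_nhds hν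
    filter_upwards [eventually_not_int ν, nhdsWithin_le_nhds h3] with μ hμ hμ'
    exact (besselKQuotient_eq hμ' hμ hζ).symm
  · exact besselKQuotient_eq hν hint hζ

theorem continuousAt_besselK_order (ν : ℂ) {ζ : ℂ} (hζ : |ζ.im| < 3 * Real.pi / 2) :
    ContinuousAt (fun μ => besselK μ ζ) ν := by
  obtain ⟨N, hN⟩ := exists_nat_gt |ν.re|
  have hν : |ν.re| < (N : ℝ) + 1 / 2 := by linarith
  have h3 : ∀ᶠ μ : ℂ in 𝓝 ν, |μ.re| < (N : ℝ) + 1 / 2 :=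
    (isOpen_lt (by fun_prop) continuous_const).mem_nhds hν
  refine ((continuousAt_hankelExpansion_order hν hζ).const_mul
    (Real.sqrt (Real.pi / 2) : ℂ)).congr ?_
  filter_upwards [h3] with μ hμ
  exact (besselK_eq_hankelExpansion hμ hζ).symm

theorem sqrt_mul_sqrt_pi : (Real.sqrt (Real.pi / 2) : ℂ) * (Real.sqrt (2 / Real.pi) : ℂ) = 1 := by
  rw [← Complex.ofReal_mul, ← Real.sqrt_mul (by positivity)]
  have := Real.pi_pos.ne'
  rw [show Real.pi / 2 * (2 / Real.pi) = 1 by field_simp]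
  simp

/-- The integral representation of the remainder `R_N^{(K)}`. -/
theorem remainderK_eq {N : ℕ} {ν : ℂ} (hν : |ν.re| < (N : ℝ) + 1 / 2) {ζ : ℂ}
    (hζ : |ζ.im| < 3 * Real.pi / 2) :
    remainderK N ν ζ = remainderConst N ν * (Complex.exp (-(N : ℂ) * ζ) *
      terminantIntegral ν ((N : ℝ) + 1 / 2) ((N : ℝ) + 1 / 2) ζ) := by
  unfold remainderK
  rw [besselK_eq_hankelExpansion hν hζ, hankelExpansion]
  have he : ∀ n : ℕ, Complex.exp (-Complex.exp ζ - ((n : ℂ) + 1 / 2) * ζ) *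
      Complex.exp (ζ / 2) * Complex.exp (Complex.exp ζ) = Complex.exp (-(n : ℂ) * ζ) := by
    intro n; rw [← Complex.exp_add, ← Complex.exp_add]; ring_nf
  have hs : (∑ n ∈ Finset.range N,
      coeffA n ν * Complex.exp (-Complex.exp ζ - ((n : ℂ) + 1 / 2) * ζ)) *
        Complex.exp (ζ / 2) * Complex.exp (Complex.exp ζ) =
      ∑ n ∈ Finset.range N, coeffA n ν / Complex.exp ζ ^ n := by
    rw [Finset.sum_mul, Finset.sum_mul]
    refine Finset.sum_congr rfl fun n _ => ?_
    rw [mul_assoc (coeffA n ν), mul_assoc (coeffA n ν), he, neg_mul, Complex.exp_neg,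
      Complex.exp_nat_mul, div_eq_mul_inv]
  rw [← hs, ← he N]
  linear_combination ((∑ n ∈ Finset.range N,
      coeffA n ν * Complex.exp (-Complex.exp ζ - ((n : ℂ) + 1 / 2) * ζ) +
    remainderConst N ν * (Complex.exp (-Complex.exp ζ - ((N : ℂ) + 1 / 2) * ζ) *
      terminantIntegral ν ((N : ℝ) + 1 / 2) ((N : ℝ) + 1 / 2) ζ)) *
      Complex.exp (ζ / 2) * Complex.exp (Complex.exp ζ)) * sqrt_mul_sqrt_pi

/-! ### The constant in the bound -/

/-- A closed form of `orderFactor`, in which the exceptional orders are no longer exceptional. -/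
theorem orderFactor_eq (N : ℕ) {ν : ℂ} (hν : |ν.re| < (N : ℝ) + 1 / 2) :
    orderFactor N ν = ‖Complex.cos (Real.pi * ν)‖ *
      |Real.Gamma ((N : ℝ) + 1 / 2 + ν.re) * Real.Gamma ((N : ℝ) + 1 / 2 - ν.re)| /
        (Real.pi * (2 ^ N * N.factorial)) := by
  obtain ⟨hl, hr⟩ := abs_lt.mp hν
  have hcount : {x : ℝ | Real.cos (Real.pi * x) ≠ 0}ᶜ.Countable := by
    refine (countable_range fun k : ℤ => (2 * (k : ℝ) + 1) / 2).mono fun x hx => ?_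
    obtain ⟨k, hk⟩ := Real.cos_eq_zero_iff.mp (not_not.mp hx)
    refine ⟨k, mul_left_cancel₀ Real.pi_ne_zero ?_⟩
    rw [hk]; ring
  have hne : (𝓝[{μ : ℂ | Real.cos (Real.pi * μ.re) ≠ 0}] ν).NeBot :=
    neBot_nhdsWithin_re_mem hcount ν
  have hG : ∀ s : ℝ, 0 < s → ContinuousAt Real.Gamma s := fun s hs =>
    (Real.differentiableAt_Gamma fun m h => by
      have : (0 : ℝ) ≤ m := Nat.cast_nonneg m
      linarith).continuousAt
  have c1 : ContinuousAt (fun μ : ℂ => Real.Gamma ((N : ℝ) + 1 / 2 + μ.re)) ν :=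
    ContinuousAt.comp (f := fun μ : ℂ => (N : ℝ) + 1 / 2 + μ.re) (hG _ (by linarith))
      (by fun_prop)
  have c2 : ContinuousAt (fun μ : ℂ => Real.Gamma ((N : ℝ) + 1 / 2 - μ.re)) ν :=
    ContinuousAt.comp (f := fun μ : ℂ => (N : ℝ) + 1 / 2 - μ.re) (hG _ (by linarith))
      (by fun_prop)
  have c3 : ContinuousAt (fun μ : ℂ => ‖Complex.cos (Real.pi * μ)‖) ν := by fun_prop
  have hc := (c3.mul (c1.mul c2).abs).div_const (Real.pi * (2 ^ N * N.factorial))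
  refine tendsto_nhds_unique_of_eventuallyEq (tendsto_orderQuotient N ν hν)
    (hc.tendsto.mono_left nhdsWithin_le_nhds) ?_
  filter_upwards [self_mem_nhdsWithin] with μ hμ
  exact orderQuotient_eq N μ hμ

/-- By the Beta integral for the weight at the order `Re ν`, the constant of the bound is exactly
`orderFactor`, also at the exceptional orders. -/
theorem norm_remainderConst_mul_integral (N : ℕ) {ν : ℂ} (hν : |ν.re| < (N : ℝ) + 1 / 2) :
    ‖remainderConst N ν‖ * ∫ u, ‖coshWeight ν ((N : ℝ) + 1 / 2) u‖ = orderFactor N ν := by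
  set I := ∫ u, ‖coshWeight ν ((N : ℝ) + 1 / 2) u‖ with hI
  have hI' : ∫ u, coshWeight (ν.re : ℂ) ((N : ℝ) + 1 / 2) u = (I : ℂ) := by
    rw [hI, ← integral_complex_ofReal]
    congr 1
    funext u
    rw [norm_coshWeight, coshWeight]
    push_cast
    rfl
  have h1 := integral_coshWeight_half N (ν := (ν.re : ℂ)) (by simpa using hν)
  rw [hI'] at h1
  have h2 : I * ((2 * N).factorial : ℝ) = (2 : ℝ) ^ ((N : ℝ) + 1 / 2) *
      (Real.Gamma ((N : ℝ) + 1 / 2 + ν.re) * Real.Gamma ((N : ℝ) + 1 / 2 - ν.re)) := by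
    have e1 : ((N : ℂ) + 1 / 2 + (ν.re : ℂ)) = (((N : ℝ) + 1 / 2 + ν.re : ℝ) : ℂ) := by push_cast; rfl
    have e2 : ((N : ℂ) + 1 / 2 - (ν.re : ℂ)) = (((N : ℝ) + 1 / 2 - ν.re : ℝ) : ℂ) := by push_cast; rfl
    rw [e1, e2, Complex.Gamma_ofReal, Complex.Gamma_ofReal] at h1
    exact_mod_cast h1
  have hI0 : 0 ≤ I := integral_nonneg fun u => norm_nonneg _
  have hpos : 0 < (2 : ℝ) ^ ((N : ℝ) + 1 / 2) := Real.rpow_pos_of_pos two_pos _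
  have h3 : |Real.Gamma ((N : ℝ) + 1 / 2 + ν.re) * Real.Gamma ((N : ℝ) + 1 / 2 - ν.re)| =
      I * ((2 * N).factorial : ℝ) / (2 : ℝ) ^ ((N : ℝ) + 1 / 2) := by
    rw [h2, mul_div_cancel_left₀ _ hpos.ne', abs_of_nonneg]
    have h4 : 0 ≤ (2 : ℝ) ^ ((N : ℝ) + 1 / 2) *
        (Real.Gamma ((N : ℝ) + 1 / 2 + ν.re) * Real.Gamma ((N : ℝ) + 1 / 2 - ν.re)) := by
      rw [← h2]; positivity
    exact nonneg_of_mul_nonneg_right h4 hpos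
  rw [orderFactor_eq N hν, h3, remainderConst]
  simp only [norm_div, norm_mul, norm_pow, norm_neg, norm_one, one_pow, one_mul, Complex.norm_real,
    Complex.norm_natCast, Complex.norm_ofNat, Real.norm_eq_abs, abs_of_pos Real.pi_pos,
    abs_of_pos hpos]
  have := Real.pi_pos
  field_simp

/-! ### The Bessel functions of the first and second kind -/

theorem besselI_add_half_pi (ν ζ : ℂ) :
    besselI ν (ζ + Real.pi / 2 * Complex.I) =
      Complex.exp (Real.pi / 2 * ν * Complex.I) * besselJ ν ζ := by
  unfold besselI besselJ
  rw [← tsum_mul_left]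
  refine tsum_congr fun k => ?_
  have h : (ν + 2 * (k : ℂ)) * (ζ + Real.pi / 2 * Complex.I - (Real.log 2 : ℂ)) =
      Real.pi / 2 * ν * Complex.I + (k * (Real.pi * Complex.I) +
        (ν + 2 * (k : ℂ)) * (ζ - (Real.log 2 : ℂ))) := by ring
  rw [h, Complex.exp_add, Complex.exp_add, Complex.exp_nat_mul, Complex.exp_pi_mul_I]
  ring

theorem besselI_sub_half_pi (ν ζ : ℂ) :
    besselI ν (ζ - Real.pi / 2 * Complex.I) =
      Complex.exp (-(Real.pi / 2 * ν * Complex.I)) * besselJ ν ζ := by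
  unfold besselI besselJ
  rw [← tsum_mul_left]
  refine tsum_congr fun k => ?_
  have h : (ν + 2 * (k : ℂ)) * (ζ - Real.pi / 2 * Complex.I - (Real.log 2 : ℂ)) =
      -(Real.pi / 2 * ν * Complex.I) + (k * (-(Real.pi * Complex.I)) +
        (ν + 2 * (k : ℂ)) * (ζ - (Real.log 2 : ℂ))) := by ring
  rw [h, Complex.exp_add, Complex.exp_add, Complex.exp_nat_mul, Complex.exp_neg (Real.pi * Complex.I),
    Complex.exp_pi_mul_I, inv_neg_one]
  ring

theorem continuous_besselJ_order (ζ : ℂ) : Continuous fun ν => besselJ ν ζ := by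
  have h : (fun ν => besselJ ν ζ) = fun ν => Complex.exp (-(Real.pi / 2 * ν * Complex.I)) *
      besselI ν (ζ + Real.pi / 2 * Complex.I) := by
    funext ν
    rw [besselI_add_half_pi, ← mul_assoc, ← Complex.exp_add]
    simp
  rw [h]
  have := continuous_besselI_order (ζ + Real.pi / 2 * Complex.I)
  fun_prop

theorem exp_mul_besselKQuotient_add (ν ζ : ℂ) :
    Complex.exp (Real.pi / 2 * ν * Complex.I) *
        besselKQuotient ν (ζ + Real.pi / 2 * Complex.I) =
      Real.pi / 2 * (besselJ (-ν) ζ - Complex.exp (Real.pi * ν * Complex.I) * besselJ ν ζ) /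
        Complex.sin (Real.pi * ν) := by
  unfold besselKQuotient
  have e1 : Complex.exp (Real.pi / 2 * ν * Complex.I) *
      Complex.exp (Real.pi / 2 * -ν * Complex.I) = 1 := by
    rw [← Complex.exp_add, ← Complex.exp_zero]; ring_nf
  have e2 : Complex.exp (Real.pi * ν * Complex.I) = Complex.exp (Real.pi / 2 * ν * Complex.I) *
      Complex.exp (Real.pi / 2 * ν * Complex.I) := by
    rw [← Complex.exp_add]; ring_nf
  rw [besselI_add_half_pi, besselI_add_half_pi, e2]
  linear_combination (Real.pi / 2 * besselJ (-ν) ζ / Complex.sin (Real.pi * ν)) * e1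

theorem exp_mul_besselKQuotient_sub (ν ζ : ℂ) :
    Complex.exp (-(Real.pi / 2 * ν * Complex.I)) *
        besselKQuotient ν (ζ - Real.pi / 2 * Complex.I) =
      Real.pi / 2 * (besselJ (-ν) ζ - Complex.exp (-(Real.pi * ν * Complex.I)) * besselJ ν ζ) /
        Complex.sin (Real.pi * ν) := by
  unfold besselKQuotient
  have e1 : Complex.exp (-(Real.pi / 2 * ν * Complex.I)) *
      Complex.exp (-(Real.pi / 2 * -ν * Complex.I)) = 1 := by
    rw [← Complex.exp_add, ← Complex.exp_zero]; ring_nf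
  have e2 : Complex.exp (-(Real.pi * ν * Complex.I)) =
      Complex.exp (-(Real.pi / 2 * ν * Complex.I)) *
      Complex.exp (-(Real.pi / 2 * ν * Complex.I)) := by
    rw [← Complex.exp_add]; ring_nf
  rw [besselI_sub_half_pi, besselI_sub_half_pi, e2]
  linear_combination (Real.pi / 2 * besselJ (-ν) ζ / Complex.sin (Real.pi * ν)) * e1

theorem exp_mul_I_add_sub (w : ℂ) :
    Complex.exp (w * Complex.I) + Complex.exp (-(w * Complex.I)) = 2 * Complex.cos w ∧
      Complex.exp (w * Complex.I) - Complex.exp (-(w * Complex.I)) =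
        2 * Complex.I * Complex.sin w := by
  have h1 := Complex.exp_mul_I w
  have h2 := Complex.exp_mul_I (-w)
  rw [Complex.cos_neg, Complex.sin_neg, neg_mul] at h2
  rw [h1, h2]
  constructor <;> ring

theorem abs_im_add_half_pi {ζ : ℂ} (hζ : |ζ.im| < Real.pi) :
    |(ζ + Real.pi / 2 * Complex.I).im| < 3 * Real.pi / 2 ∧
      |(ζ - Real.pi / 2 * Complex.I).im| < 3 * Real.pi / 2 := by
  have h : ((Real.pi : ℂ) / 2 * Complex.I).im = Real.pi / 2 := by
    rw [show (Real.pi : ℂ) / 2 = ((Real.pi / 2 : ℝ) : ℂ) by push_cast; rfl]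
    simp
  obtain ⟨h1, h2⟩ := abs_lt.mp hζ
  have := Real.pi_pos
  rw [Complex.add_im, Complex.sub_im, h, abs_lt, abs_lt]
  refine ⟨⟨?_, ?_⟩, ?_, ?_⟩ <;> linarith

theorem besselK_of_not_int {ν : ℂ} (hν : ¬∃ n : ℤ, ν = n) (ζ : ℂ) :
    besselK ν ζ = besselKQuotient ν ζ := by
  unfold besselK
  rw [if_neg hν]
  rfl

/-- The connection formula `J_ν(z) = (i/π) (e^(πiν/2) K_ν(iz) - e^(-πiν/2) K_ν(-iz))`. -/
theorem besselJ_eq_besselK (ν : ℂ) {ζ : ℂ} (hζ : |ζ.im| < Real.pi) :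
    Real.pi * besselJ ν ζ = Complex.I * (Complex.exp (Real.pi / 2 * ν * Complex.I) *
        besselK ν (ζ + Real.pi / 2 * Complex.I) -
      Complex.exp (-(Real.pi / 2 * ν * Complex.I)) *
        besselK ν (ζ - Real.pi / 2 * Complex.I)) := by
  obtain ⟨h1, h2⟩ := abs_im_add_half_pi hζ
  have c1 := continuousAt_besselK_order ν h1
  have c2 := continuousAt_besselK_order ν h2
  have cJ := (continuous_besselJ_order ζ).continuousAt (x := ν)
  have hL : ContinuousAt (fun μ => Real.pi * besselJ μ ζ) ν := continuousAt_const.mul cJ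
  have hR : ContinuousAt (fun μ => Complex.I * (Complex.exp (Real.pi / 2 * μ * Complex.I) *
        besselK μ (ζ + Real.pi / 2 * Complex.I) -
      Complex.exp (-(Real.pi / 2 * μ * Complex.I)) *
        besselK μ (ζ - Real.pi / 2 * Complex.I))) ν := by fun_prop
  -- integer orders follow from the others by continuity in the order
  refine tendsto_nhds_unique_of_eventuallyEq (l := 𝓝[≠] ν)
    (hL.tendsto.mono_left nhdsWithin_le_nhds) (hR.tendsto.mono_left nhdsWithin_le_nhds) ?_
  filter_upwards [eventually_not_int ν] with μ hμ
  rw [besselK_of_not_int hμ, besselK_of_not_int hμ, exp_mul_besselKQuotient_add,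
    exp_mul_besselKQuotient_sub]
  have hs := sin_pi_mul_ne_zero hμ
  have he := (exp_mul_I_add_sub (Real.pi * μ)).2
  generalize Complex.exp (-(Real.pi * μ * Complex.I)) = b at he ⊢
  generalize Complex.exp (Real.pi * μ * Complex.I) = a at he ⊢
  field_simp
  linear_combination Complex.I * besselJ μ ζ * he +
    2 * besselJ μ ζ * Complex.sin (Real.pi * μ) * Complex.I_sq

/-- The connection formula `Y_ν(z) = -(1/π) (e^(πiν/2) K_ν(iz) + e^(-πiν/2) K_ν(-iz))`. -/
theorem besselY_eq_besselK (ν : ℂ) {ζ : ℂ} (hζ : |ζ.im| < Real.pi) :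
    besselY ν ζ = -(1 / Real.pi) * (Complex.exp (Real.pi / 2 * ν * Complex.I) *
        besselK ν (ζ + Real.pi / 2 * Complex.I) +
      Complex.exp (-(Real.pi / 2 * ν * Complex.I)) *
        besselK ν (ζ - Real.pi / 2 * Complex.I)) := by
  obtain ⟨h1, h2⟩ := abs_im_add_half_pi hζ
  have hpi : (Real.pi : ℂ) ≠ 0 := by exact_mod_cast Real.pi_ne_zero
  have key : ∀ μ : ℂ, (¬∃ n : ℤ, μ = n) →
      (Complex.cos (Real.pi * μ) * besselJ μ ζ - besselJ (-μ) ζ) / Complex.sin (Real.pi * μ) =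
      -(1 / Real.pi) * (Complex.exp (Real.pi / 2 * μ * Complex.I) *
        besselK μ (ζ + Real.pi / 2 * Complex.I) +
      Complex.exp (-(Real.pi / 2 * μ * Complex.I)) *
        besselK μ (ζ - Real.pi / 2 * Complex.I)) := by
    intro μ hμ
    rw [besselK_of_not_int hμ, besselK_of_not_int hμ, exp_mul_besselKQuotient_add,
      exp_mul_besselKQuotient_sub]
    have hs := sin_pi_mul_ne_zero hμ
    have he := (exp_mul_I_add_sub (Real.pi * μ)).1
    generalize Complex.exp (-(Real.pi * μ * Complex.I)) = b at he ⊢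
    generalize Complex.exp (Real.pi * μ * Complex.I) = a at he ⊢
    field_simp
    linear_combination -besselJ μ ζ * he
  unfold besselY
  split_ifs with hint
  · have c1 := continuousAt_besselK_order ν h1
    have c2 := continuousAt_besselK_order ν h2
    have hR : ContinuousAt (fun μ => -(1 / (Real.pi : ℂ)) *
      (Complex.exp (Real.pi / 2 * μ * Complex.I) *
        besselK μ (ζ + Real.pi / 2 * Complex.I) +
      Complex.exp (-(Real.pi / 2 * μ * Complex.I)) *
        besselK μ (ζ - Real.pi / 2 * Complex.I))) ν := by fun_prop
    refine Tendsto.limUnder_eq ((hR.tendsto.mono_left nhdsWithin_le_nhds).congr' ?_)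
    filter_upwards [eventually_not_int ν] with μ hμ
    exact (key μ hμ).symm
  · exact key ν hint

theorem exp_pi_div_four_mul : -Complex.I * Complex.exp (Real.pi / 4 * Complex.I) =
    Complex.exp (-(Real.pi / 4 * Complex.I)) := by
  have h : -Complex.I = Complex.exp (-(Real.pi / 2 * Complex.I)) := by
    rw [Complex.exp_neg, Complex.exp_pi_div_two_mul_I, Complex.inv_I]
  rw [h, ← Complex.exp_add]
  ring_nf

theorem exp_add_half_pi (ζ : ℂ) :
    Complex.exp (ζ + Real.pi / 2 * Complex.I) = Complex.I * Complex.exp ζ := by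
  rw [Complex.exp_add, Complex.exp_pi_div_two_mul_I, mul_comm]

theorem exp_sub_half_pi (ζ : ℂ) :
    Complex.exp (ζ - Real.pi / 2 * Complex.I) = -Complex.I * Complex.exp ζ := by
  rw [Complex.exp_sub, Complex.exp_pi_div_two_mul_I, div_eq_mul_inv, Complex.inv_I, mul_comm]

theorem sqrt_pi_div_two_mul :
    (Real.sqrt (Real.pi / 2) : ℂ) * 2 = Real.pi * (Real.sqrt (2 / Real.pi) : ℂ) := by
  have hpi := Real.pi_pos
  have h : Real.sqrt (Real.pi / 2) * 2 = Real.pi * Real.sqrt (2 / Real.pi) := by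
    rw [show Real.pi / 2 = (Real.pi / 2) ^ 2 * (2 / Real.pi) by field_simp,
      Real.sqrt_mul (by positivity), Real.sqrt_sq (by positivity)]
    ring
  exact_mod_cast h

/-- `P + iQ` is `K_ν(z e^(-πi/2))` with its exponential factor removed. -/
theorem hankelP_add_I_mul_hankelQ (ν : ℂ) {ζ : ℂ} (hζ : |ζ.im| < Real.pi) :
    hankelP ν ζ + Complex.I * hankelQ ν ζ =
      besselK ν (ζ - Real.pi / 2 * Complex.I) * (Real.sqrt (2 / Real.pi) : ℂ) *
        Complex.exp ((ζ - Real.pi / 2 * Complex.I) / 2) *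
        Complex.exp (Complex.exp (ζ - Real.pi / 2 * Complex.I)) := by
  have hpi : (Real.pi : ℂ) ≠ 0 := by exact_mod_cast Real.pi_ne_zero
  have hJ := besselJ_eq_besselK ν hζ
  have hY := besselY_eq_besselK ν hζ
  set A := Complex.exp (Real.pi / 2 * ν * Complex.I)
  set B := Complex.exp (-(Real.pi / 2 * ν * Complex.I)) with hB
  set Kp := besselK ν (ζ + Real.pi / 2 * Complex.I)
  set Km := besselK ν (ζ - Real.pi / 2 * Complex.I)
  have hJY : Real.pi * (besselJ ν ζ + Complex.I * besselY ν ζ) = -2 * Complex.I * (B * Km) := by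
    rw [mul_add, hJ, hY]
    field_simp
    ring
  have hω : Complex.cos (phase ν ζ) - Complex.I * Complex.sin (phase ν ζ) =
      Complex.exp (-(phase ν ζ * Complex.I)) := by
    obtain ⟨h1, h2⟩ := exp_mul_I_add_sub (phase ν ζ)
    linear_combination (h2 - h1) / 2
  have hPQ : hankelP ν ζ + Complex.I * hankelQ ν ζ =
      (Real.sqrt (Real.pi / 2) : ℂ) * Complex.exp (ζ / 2) *
        ((besselJ ν ζ + Complex.I * besselY ν ζ) * Complex.exp (-(phase ν ζ * Complex.I))) := by
    rw [← hω, hankelP, hankelQ]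
    linear_combination (-(Real.sqrt (Real.pi / 2) : ℂ) * Complex.exp (ζ / 2) *
      (-besselY ν ζ * Complex.sin (phase ν ζ))) * Complex.I_sq
  have hph : Complex.exp (-(phase ν ζ * Complex.I)) * B =
      Complex.exp (-Complex.I * Complex.exp ζ) * Complex.exp (Real.pi / 4 * Complex.I) := by
    rw [hB, ← Complex.exp_add, ← Complex.exp_add, phase]
    ring_nf
  have hE : Complex.exp ((ζ - Real.pi / 2 * Complex.I) / 2) =
      Complex.exp (ζ / 2) * (-Complex.I * Complex.exp (Real.pi / 4 * Complex.I)) := by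
    rw [exp_pi_div_four_mul, ← Complex.exp_add]
    ring_nf
  apply mul_left_cancel₀ hpi
  rw [hPQ, hE, exp_sub_half_pi]
  linear_combination (Real.sqrt (Real.pi / 2) * Complex.exp (ζ / 2) *
      Complex.exp (-(phase ν ζ * Complex.I))) * hJY +
    (-2 * Complex.I * Km * Real.sqrt (Real.pi / 2) * Complex.exp (ζ / 2)) * hph +
    (-Complex.I * Km * Complex.exp (ζ / 2) * Complex.exp (-Complex.I * Complex.exp ζ) *
      Complex.exp (Real.pi / 4 * Complex.I)) * sqrt_pi_div_two_mul

/-- `P - iQ` is `K_ν(z e^(πi/2))` with its exponential factor removed. -/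
theorem hankelP_sub_I_mul_hankelQ (ν : ℂ) {ζ : ℂ} (hζ : |ζ.im| < Real.pi) :
    hankelP ν ζ - Complex.I * hankelQ ν ζ =
      besselK ν (ζ + Real.pi / 2 * Complex.I) * (Real.sqrt (2 / Real.pi) : ℂ) *
        Complex.exp ((ζ + Real.pi / 2 * Complex.I) / 2) *
        Complex.exp (Complex.exp (ζ + Real.pi / 2 * Complex.I)) := by
  have hpi : (Real.pi : ℂ) ≠ 0 := by exact_mod_cast Real.pi_ne_zero
  have hJ := besselJ_eq_besselK ν hζ
  have hY := besselY_eq_besselK ν hζ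
  set A := Complex.exp (Real.pi / 2 * ν * Complex.I) with hA
  set B := Complex.exp (-(Real.pi / 2 * ν * Complex.I))
  set Kp := besselK ν (ζ + Real.pi / 2 * Complex.I)
  set Km := besselK ν (ζ - Real.pi / 2 * Complex.I)
  have hJY : Real.pi * (besselJ ν ζ - Complex.I * besselY ν ζ) = 2 * Complex.I * (A * Kp) := by
    rw [mul_sub, hJ, hY]
    field_simp
    ring
  have hω : Complex.cos (phase ν ζ) + Complex.I * Complex.sin (phase ν ζ) =
      Complex.exp (phase ν ζ * Complex.I) := by
    obtain ⟨h1, h2⟩ := exp_mul_I_add_sub (phase ν ζ)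
    linear_combination (-h2 - h1) / 2
  have hPQ : hankelP ν ζ - Complex.I * hankelQ ν ζ =
      (Real.sqrt (Real.pi / 2) : ℂ) * Complex.exp (ζ / 2) *
        ((besselJ ν ζ - Complex.I * besselY ν ζ) * Complex.exp (phase ν ζ * Complex.I)) := by
    rw [← hω, hankelP, hankelQ]
    linear_combination (-(Real.sqrt (Real.pi / 2) : ℂ) * Complex.exp (ζ / 2) *
      (-besselY ν ζ * Complex.sin (phase ν ζ))) * Complex.I_sq
  have hph : Complex.exp (phase ν ζ * Complex.I) * A =
      Complex.exp (Complex.I * Complex.exp ζ) * Complex.exp (-(Real.pi / 4 * Complex.I)) := by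
    rw [hA, ← Complex.exp_add, ← Complex.exp_add, phase]
    ring_nf
  have hE : Complex.exp ((ζ + Real.pi / 2 * Complex.I) / 2) =
      Complex.exp (ζ / 2) * (Complex.I * Complex.exp (-(Real.pi / 4 * Complex.I))) := by
    rw [← exp_pi_div_four_mul, show Complex.I * (-Complex.I * Complex.exp (Real.pi / 4 * Complex.I)) =
      Complex.exp (Real.pi / 4 * Complex.I) by
        linear_combination (-Complex.exp (Real.pi / 4 * Complex.I)) * Complex.I_sq,
      ← Complex.exp_add]
    ring_nf
  apply mul_left_cancel₀ hpi
  rw [hPQ, hE, exp_add_half_pi]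
  linear_combination (Real.sqrt (Real.pi / 2) * Complex.exp (ζ / 2) *
      Complex.exp (phase ν ζ * Complex.I)) * hJY +
    (2 * Complex.I * Kp * Real.sqrt (Real.pi / 2) * Complex.exp (ζ / 2)) * hph +
    (Complex.I * Kp * Complex.exp (ζ / 2) * Complex.exp (Complex.I * Complex.exp ζ) *
      Complex.exp (-(Real.pi / 4 * Complex.I))) * sqrt_pi_div_two_mul

/-! ### The remainder of the expansions of `J_ν` and `Y_ν` -/

theorem div_I_mul_pow (a z : ℂ) (n : ℕ) :
    a / (Complex.I * z) ^ n = (-Complex.I) ^ n * (a / z ^ n) := by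
  rw [mul_pow, div_mul_eq_div_div_swap, div_eq_mul_inv _ (Complex.I ^ n), ← inv_pow, Complex.inv_I,
    mul_comm]

theorem div_neg_I_mul_pow (a z : ℂ) (n : ℕ) :
    a / (-Complex.I * z) ^ n = Complex.I ^ n * (a / z ^ n) := by
  rw [mul_pow, div_mul_eq_div_div_swap, div_eq_mul_inv _ ((-Complex.I) ^ n), ← inv_pow, inv_neg,
    Complex.inv_I, neg_neg, mul_comm]

theorem I_pow_even (n : ℕ) :
    Complex.I ^ (2 * n) = (-1) ^ n ∧ (-Complex.I) ^ (2 * n) = (-1) ^ n := by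
  rw [pow_mul, pow_mul, neg_sq, Complex.I_sq]
  exact ⟨rfl, rfl⟩

theorem sum_rotated_add (a : ℕ → ℂ) (z : ℂ) (L : ℕ) :
    ∑ n ∈ Finset.range (2 * L), (a n / (Complex.I * z) ^ n + a n / (-Complex.I * z) ^ n) =
      2 * ∑ l ∈ Finset.range L, (-1) ^ l * (a (2 * l) / z ^ (2 * l)) := by
  induction L with
  | zero => simp
  | succ L ih =>
    obtain ⟨h1, h2⟩ := I_pow_even L
    rw [Finset.sum_range_succ _ L, show 2 * (L + 1) = 2 * L + 1 + 1 by ring, Finset.sum_range_succ,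
      Finset.sum_range_succ, ih]
    simp only [div_I_mul_pow, div_neg_I_mul_pow]
    rw [pow_succ Complex.I, pow_succ (-Complex.I), h1, h2]
    ring

theorem sum_rotated_sub (a : ℕ → ℂ) (z : ℂ) (M : ℕ) :
    ∑ n ∈ Finset.range (2 * M + 1), (a n / (-Complex.I * z) ^ n - a n / (Complex.I * z) ^ n) =
      2 * Complex.I * ∑ m ∈ Finset.range M, (-1) ^ m * (a (2 * m + 1) / z ^ (2 * m + 1)) := by
  induction M with
  | zero => simp
  | succ M ih =>
    obtain ⟨h1, h2⟩ := I_pow_even M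
    rw [Finset.sum_range_succ _ M, Finset.sum_range_succ, show 2 * (M + 1) = 2 * M + 1 + 1 by ring,
      Finset.sum_range_succ, ih]
    simp only [div_I_mul_pow, div_neg_I_mul_pow]
    rw [pow_succ Complex.I (2 * M + 1), pow_succ (-Complex.I) (2 * M + 1),
      pow_succ Complex.I (2 * M), pow_succ (-Complex.I) (2 * M), h1, h2]
    ring

/-- The combination `P = ((P + iQ) + (P - iQ)) / 2` of the rotated expansions of `K_ν`. -/
theorem remainderJ_two_mul (L : ℕ) (ν : ℂ) {ζ : ℂ} (hζ : |ζ.im| < Real.pi) :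
    remainderJ (2 * L) ν ζ = (remainderK (2 * L) ν (ζ + Real.pi / 2 * Complex.I) +
      remainderK (2 * L) ν (ζ - Real.pi / 2 * Complex.I)) / 2 := by
  have h := sum_rotated_add (fun n => coeffA n ν) (Complex.exp ζ) L
  rw [Finset.sum_add_distrib] at h
  rw [remainderK, remainderK, ← hankelP_add_I_mul_hankelQ ν hζ, ← hankelP_sub_I_mul_hankelQ ν hζ,
    exp_add_half_pi, exp_sub_half_pi, remainderJ, if_pos (even_two_mul L),
    Nat.mul_div_cancel_left L two_pos]
  linear_combination h / 2

/-- The combination `Q = ((P + iQ) - (P - iQ)) / (2i)` of the rotated expansions of `K_ν`. -/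
theorem remainderJ_two_mul_add_one (M : ℕ) (ν : ℂ) {ζ : ℂ} (hζ : |ζ.im| < Real.pi) :
    remainderJ (2 * M + 1) ν ζ =
      Complex.I * (remainderK (2 * M + 1) ν (ζ - Real.pi / 2 * Complex.I) -
        remainderK (2 * M + 1) ν (ζ + Real.pi / 2 * Complex.I)) / 2 := by
  have h := sum_rotated_sub (fun n => coeffA n ν) (Complex.exp ζ) M
  rw [Finset.sum_sub_distrib] at h
  rw [remainderK, remainderK, ← hankelP_add_I_mul_hankelQ ν hζ, ← hankelP_sub_I_mul_hankelQ ν hζ,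
    exp_add_half_pi, exp_sub_half_pi, remainderJ, if_neg (Nat.not_even_two_mul_add_one M),
    show (2 * M + 1) / 2 = M by omega]
  set S := ∑ m ∈ Finset.range M,
    (-1) ^ m * (coeffA (2 * m + 1) ν / Complex.exp ζ ^ (2 * m + 1))
  linear_combination Complex.I / 2 * h + (S - hankelQ ν ζ) * Complex.I_sq

theorem exp_neg_nat_mul_add_half_pi (N : ℕ) (ζ : ℂ) :
    Complex.exp (-(N : ℂ) * (ζ + Real.pi / 2 * Complex.I)) =
        (-Complex.I) ^ N * Complex.exp (-(N : ℂ) * ζ) ∧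
      Complex.exp (-(N : ℂ) * (ζ - Real.pi / 2 * Complex.I)) =
        Complex.I ^ N * Complex.exp (-(N : ℂ) * ζ) := by
  have h : ∀ w : ℂ, Complex.exp (-(N : ℂ) * w) = 1 / Complex.exp w ^ N := fun w => by
    rw [neg_mul, Complex.exp_neg, Complex.exp_nat_mul, one_div]
  rw [h, h, h, exp_add_half_pi, exp_sub_half_pi, div_I_mul_pow, div_neg_I_mul_pow]
  exact ⟨rfl, rfl⟩

theorem integral_coshWeight_mul_terminantPi {ν : ℂ} {s p : ℝ} (hν : |ν.re| < s) (hp : 0 ≤ p)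
    {ζ : ℂ} (hζ : |ζ.im| < Real.pi) :
    ∫ u : ℝ, coshWeight ν s u * terminantPi p (ζ + (Real.log (1 + Real.cosh u) : ℝ)) =
      (terminantIntegral ν s p (ζ + Real.pi / 2 * Complex.I) +
        terminantIntegral ν s p (ζ - Real.pi / 2 * Complex.I)) / 2 := by
  obtain ⟨h1, h2⟩ := abs_im_add_half_pi hζ
  rw [terminantIntegral, terminantIntegral,
    ← integral_add (integrable_terminantIntegral hν hp h1) (integrable_terminantIntegral hν hp h2),
    ← integral_div]
  congr 1
  funext u
  rw [terminantPi, add_right_comm ζ (Real.pi / 2 * Complex.I), sub_add_eq_add_sub ζ]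
  ring

/-- The integral representation of the remainder `R_N^{(J)}`, up to a sign `ε`. -/
theorem exists_remainderJ_eq {N : ℕ} {ν : ℂ} (hν : |ν.re| < (N : ℝ) + 1 / 2) {ζ : ℂ}
    (hζ : |ζ.im| < Real.pi) :
    ∃ ε : ℂ, ‖ε‖ = 1 ∧ remainderJ N ν ζ =
      ε * (remainderConst N ν * (Complex.exp (-(N : ℂ) * ζ) *
        ∫ u : ℝ, coshWeight ν ((N : ℝ) + 1 / 2) u *
          terminantPi (((N : ℝ) + 1 / 2 : ℝ) : ℂ) (ζ + (Real.log (1 + Real.cosh u) : ℝ)))) := by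
  obtain ⟨h1, h2⟩ := abs_im_add_half_pi hζ
  obtain ⟨e1, e2⟩ := exp_neg_nat_mul_add_half_pi N ζ
  rw [integral_coshWeight_mul_terminantPi hν (by positivity) hζ]
  obtain ⟨L, rfl⟩ | ⟨M, rfl⟩ := Nat.even_or_odd N
  · rw [← two_mul] at *
    obtain ⟨i1, i2⟩ := I_pow_even L
    refine ⟨(-1) ^ L, by simp, ?_⟩
    rw [remainderJ_two_mul L ν hζ, remainderK_eq hν h1, remainderK_eq hν h2, e1, e2, i1, i2]
    ring
  · obtain ⟨i1, i2⟩ := I_pow_even M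
    refine ⟨-(-1) ^ M, by simp, ?_⟩
    rw [remainderJ_two_mul_add_one M ν hζ, remainderK_eq hν h1, remainderK_eq hν h2, e1, e2,
      pow_succ, pow_succ, i1, i2]
    generalize terminantIntegral _ _ _ _ = T₁
    generalize terminantIntegral _ _ _ _ = T₂
    generalize Complex.exp _ = E
    generalize remainderConst _ _ = κ
    linear_combination ((-1) ^ M * κ * E * (T₁ + T₂) / 2) * Complex.I_sq

/-! ### The bounds -/

theorem norm_exp_neg_nat_mul (N : ℕ) (ζ : ℂ) :
    ‖Complex.exp (-(N : ℂ) * ζ)‖ = (‖Complex.exp ζ‖ ^ N)⁻¹ := by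
  rw [neg_mul, Complex.exp_neg, Complex.exp_nat_mul, norm_inv, norm_pow]

/-- Every `1 + cosh u` is of the form `2r` with `r ≥ 1`, so that the weighted integral of `g` is
controlled by the supremum of `|g|` along the ray `r ≥ 1`. -/
theorem norm_const_mul_integral_le_ciSup {N : ℕ} {ν : ℂ} (hν : |ν.re| < (N : ℝ) + 1 / 2) (ζ : ℂ)
    {g : ℂ → ℂ} (hg : BddAbove (range fun r : Ici (1 : ℝ) =>
      ‖g (ζ + (Real.log (2 * (r : ℝ)) : ℂ))‖)) :
    ‖remainderConst N ν * (Complex.exp (-(N : ℂ) * ζ) *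
        ∫ u : ℝ, coshWeight ν ((N : ℝ) + 1 / 2) u * g (ζ + (Real.log (1 + Real.cosh u) : ℝ)))‖ ≤
      orderFactor N ν / ‖Complex.exp ζ‖ ^ N *
        ⨆ r : Ici (1 : ℝ), ‖g (ζ + (Real.log (2 * (r : ℝ)) : ℂ))‖ := by
  have hu : ∀ u : ℝ, ‖g (ζ + (Real.log (1 + Real.cosh u) : ℝ))‖ ≤
      ⨆ r : Ici (1 : ℝ), ‖g (ζ + (Real.log (2 * (r : ℝ)) : ℂ))‖ := fun u => by
    have h := le_ciSup hg ⟨(1 + Real.cosh u) / 2, by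
      have := Real.one_le_cosh u
      rw [mem_Ici]; linarith⟩
    simpa only [mul_div_cancel₀ (1 + Real.cosh u) (two_ne_zero (α := ℝ))] using h
  have h := norm_integral_coshWeight_mul_le hν hu
  rw [norm_mul, norm_mul, norm_exp_neg_nat_mul, ← norm_remainderConst_mul_integral N hν]
  calc _ ≤ ‖remainderConst N ν‖ * ((‖Complex.exp ζ‖ ^ N)⁻¹ *
        ((∫ u, ‖coshWeight ν ((N : ℝ) + 1 / 2) u‖) *
          ⨆ r : Ici (1 : ℝ), ‖g (ζ + (Real.log (2 * (r : ℝ)) : ℂ))‖)) := by gcongr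
    _ = _ := by ring

theorem bddAbove_norm_terminantLambda {p : ℝ} (hp : 0 ≤ p) {ζ : ℂ}
    (hζ : |ζ.im| < 3 * Real.pi / 2) :
    BddAbove (range fun r : Ici (1 : ℝ) =>
      ‖terminantLambda p (ζ + (Real.log (2 * (r : ℝ)) : ℂ))‖) :=
  ⟨_, forall_mem_range.mpr fun _ => norm_terminantLambda_add_ofReal_le hp hζ _⟩

theorem bddAbove_norm_terminantPi {p : ℝ} (hp : 0 ≤ p) {ζ : ℂ} (hζ : |ζ.im| < Real.pi) :
    BddAbove (range fun r : Ici (1 : ℝ) =>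
      ‖terminantPi p (ζ + (Real.log (2 * (r : ℝ)) : ℂ))‖) := by
  obtain ⟨h1, h2⟩ := abs_im_add_half_pi hζ
  refine ⟨((Real.cos ((ζ + Real.pi / 2 * Complex.I).im / 3) ^ (p + 1))⁻¹ +
    (Real.cos ((ζ - Real.pi / 2 * Complex.I).im / 3) ^ (p + 1))⁻¹) / 2,
    forall_mem_range.mpr fun r => ?_⟩
  rw [terminantPi, add_right_comm, add_sub_right_comm, norm_div, Complex.norm_ofNat]
  exact div_le_div_of_nonneg_right ((norm_add_le _ _).trans (add_le_add
    (norm_terminantLambda_add_ofReal_le hp h1 _) (norm_terminantLambda_add_ofReal_le hp h2 _)))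
    two_pos.le

end BesselBounds

end

theorem theorem6 (N : ℕ) (ν : ℂ) (hν : |ν.re| < (N : ℝ) + 1 / 2) :
    (∀ ζ : ℂ, |ζ.im| < 3 * Real.pi / 2 →
      BddAbove (Set.range fun r : Set.Ici (1 : ℝ) =>
        ‖BesselBounds.terminantLambda ((N : ℂ) + 1 / 2) (ζ + (Real.log (2 * (r : ℝ)) : ℂ))‖) ∧
      ‖BesselBounds.remainderK N ν ζ‖ ≤
        BesselBounds.orderFactor N ν / ‖Complex.exp ζ‖ ^ N *
          ⨆ r : Set.Ici (1 : ℝ),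
            ‖BesselBounds.terminantLambda ((N : ℂ) + 1 / 2)
              (ζ + (Real.log (2 * (r : ℝ)) : ℂ))‖) ∧
    (∀ ζ : ℂ, |ζ.im| < Real.pi →
      BddAbove (Set.range fun r : Set.Ici (1 : ℝ) =>
        ‖BesselBounds.terminantPi ((N : ℂ) + 1 / 2) (ζ + (Real.log (2 * (r : ℝ)) : ℂ))‖) ∧
      ‖BesselBounds.remainderJ N ν ζ‖ ≤
        BesselBounds.orderFactor N ν / ‖Complex.exp ζ‖ ^ N *
          ⨆ r : Set.Ici (1 : ℝ),
            ‖BesselBounds.terminantPi ((N : ℂ) + 1 / 2)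
              (ζ + (Real.log (2 * (r : ℝ)) : ℂ))‖) := by
  have hp : (0 : ℝ) ≤ (N : ℝ) + 1 / 2 := by positivity
  rw [show (N : ℂ) + 1 / 2 = (((N : ℝ) + 1 / 2 : ℝ) : ℂ) by push_cast; rfl]
  refine ⟨fun ζ hζ => ?_, fun ζ hζ => ?_⟩
  · have hb := BesselBounds.bddAbove_norm_terminantLambda hp hζ
    refine ⟨hb, ?_⟩
    rw [BesselBounds.remainderK_eq hν hζ]
    exact BesselBounds.norm_const_mul_integral_le_ciSup hν ζ hb
  · have hb := BesselBounds.bddAbove_norm_terminantPi hp hζ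
    refine ⟨hb, ?_⟩
    obtain ⟨ε, hε, h⟩ := BesselBounds.exists_remainderJ_eq hν hζ
    rw [h, norm_mul, hε, one_mul]
    exact BesselBounds.norm_const_mul_integral_le_ciSup hν ζ hb
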